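/- **Theorem.** For $p\in[0,1]$ let $G(n,p)$ be the binomial random graph on $n$ labelled vertices, let $\mathcal T$ be the set of triangle-free graphs on these vertices, let $\mu_p(\mathcal T)$ be the probability that $G(n,p)$ is triangle-free, and let $\mu_{\mathcal T,p}$ be the law of $G(n,p)$ conditioned on being triangle-free. The Glauber dynamics for $\mu_{\mathcal T,p}$ is the Markov chain on $\mathcal T$ that, at each step, chooses one of the $\binom n2$ potential edges uniformly at random and resamples it given the other edges: with probability $p$ the edge is included if this creates no triangle, and otherwise it is left out. Its mixing time is $\tau_{\mathrm{mix}}=\max_{X_0\in\mathcal T}\min\{t:\|\mu_t^{X_0}-\mu_{\mathcal T,p}\|_{TV}<1/4\}$, where $\mu_t^{X_0}$ is the $t$-step distribution from $X_0$. Fix $c<1/\sqrt2$. 1. There is a constant $K=K(c)$ such that, for all $n\ge 2$ and all $p\in[0,1]$ with $p\le c\,n^{-1/2}$, the Glauber dynamics for $\mu_{\mathcal T,p}$ has mixing time at most $K n^2\log n$. 2. There is a randomized algorithm that, for all $n\ge 1$, all $p\in[0,1]$ with $p\le c\,n^{-1/2}$ and all real $\varepsilon>0$, always halts within time polynomial in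 $n$ and $1/\varepsilon$ and outputs a number $M$ such that, with probability at least $2/3$, $M>0$ and $e^{-\varepsilon}M\le\mu_p(\mathcal T)\le e^{\varepsilon}M$. 3. There is a randomized algorithm that, for all such $n,p,\varepsilon$, always halts within time polynomial in $n$ and $1/\varepsilon$ and always outputs a graph in $\mathcal T$, whose distribution $\hat\mu$ satisfies $\|\hat\mu-\mu_{\mathcal T,p}\|_{TV}<\varepsilon$. In 2 and 3 the algorithm and the polynomial depend only on $c$. An algorithm is a program with finitely many arrays of natural numbers, integer arithmetic, conditionals, loops and fair coin tosses, and its time is counted by the logarithmic cost measure (each operation costs the binary length of the numbers it handles). Its input is $n$ and $\lceil 1/\varepsilon\rceil$, and it has access to the real number $p$ through queries for $\lfloor 2^kp\rfloor$, each of cost at least $k$. The number $M$ is output as a quotient of two natural numbers, and the graph as an adjacency matrix. -/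

import Mathlib

open MeasureTheory ProbabilityTheory

noncomputable section

/-! ## Triangle-free graphs and the conditioned binomial random graph -/

/-- The set `𝒯` of labelled triangle-free graphs on the vertex set `Fin n`. -/
abbrev triangleFree (n : ℕ) : Set (SimpleGraph (Fin n)) := {G | G.CliqueFree 3}

instance triangleFree.instFintype (n : ℕ) : Fintype (triangleFree n) := Fintype.ofFinite _

instance triangleFree.instDecidableEq (n : ℕ) : DecidableEq (triangleFree n) :=
  Classical.decEq _

/-- `μ_p(𝒯)`: the probability that `G(n,p)` is triangle-free. -/
def probTriangleFree (n : ℕ) (p : unitInterval) : ℝ :=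
  (SimpleGraph.binomialRandom (Fin n) p).real (triangleFree n)

/-- The mass function on `𝒯` of `μ_{𝒯,p}`, the law of `G(n,p)` conditioned on `𝒯`. -/
def condTriangleFree (n : ℕ) (p : unitInterval) (G : triangleFree n) : ℝ :=
  (ProbabilityTheory.cond (SimpleGraph.binomialRandom (Fin n) p) (triangleFree n)).real
    {(G : SimpleGraph (Fin n))}

/-! ## Total variation, mixing time, Glauber dynamics -/

/-- Total variation distance between two probability mass functions on a finite set. -/
def tvDist {Ω : Type*} [Fintype Ω] (μ ν : Ω → ℝ) : ℝ := (1 / 2) * ∑ x, |μ x - ν x|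

/-- The mixing time of the finite Markov chain with transition matrix `P` towards `μ`: the maximum,
over the starting states `X₀`, of the least `t` at which the `t`-step distribution is within total
variation distance less than `1/4` of `μ` (it is `⊤` if some `X₀` has no such `t`). -/
def mixingTime {Ω : Type*} [Fintype Ω] [DecidableEq Ω] (P : Matrix Ω Ω ℝ) (μ : Ω → ℝ) : ℕ∞ :=
  ⨆ X₀ : Ω, ⨅ (t : ℕ) (_ : tvDist (fun Y => (P ^ t) X₀ Y) μ < 1 / 4), (t : ℕ∞)

open Classical in
/-- The graph obtained from `G` by a successful attempt to include the potential edge `e`: the edge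
is included, unless this would create a triangle. -/
def tryInclude {n : ℕ} (G : SimpleGraph (Fin n)) (e : Sym2 (Fin n)) : SimpleGraph (Fin n) :=
  if (G ⊔ SimpleGraph.fromEdgeSet {e}).CliqueFree 3 then G ⊔ SimpleGraph.fromEdgeSet {e}
  else G.deleteEdges {e}

open Classical in
/-- The law of the graph after the potential edge `e` of `G` is resampled: with probability `p`
the edge is included if that creates no triangle, and otherwise it is left out. -/
def resample {n : ℕ} (p : unitInterval) (e : Sym2 (Fin n)) (G H : SimpleGraph (Fin n)) : ℝ :=
  (p : ℝ) * (if H = tryInclude G e then 1 else 0)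
    + (1 - (p : ℝ)) * (if H = G.deleteEdges {e} then 1 else 0)

/-- For `0 < p < 1`, resampling `e` amounts to drawing the status of `e` from its conditional law
under `μ_{𝒯,p}`, given the status in `G` of all the other potential edges. -/
theorem resample_eq_cond {n : ℕ} (p : unitInterval) (h0 : 0 < (p : ℝ)) (h1 : (p : ℝ) < 1)
    {e : Sym2 (Fin n)} (he : ¬ e.IsDiag) {G : SimpleGraph (Fin n)} (hG : G ∈ triangleFree n)
    (H : SimpleGraph (Fin n)) :
    resample p e G H =
      (ProbabilityTheory.cond
        (ProbabilityTheory.cond (SimpleGraph.binomialRandom (Fin n) p) (triangleFree n))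
        {F | F.deleteEdges {e} = G.deleteEdges {e}}).real {H} := by
  classical
  have hms : ∀ S : Set (SimpleGraph (Fin n)), MeasurableSet S := fun S =>
    (SimpleGraph.measurableEmbedding_edgeSet.measurableSet_image).1
      (Set.toFinite (SimpleGraph.edgeSet '' S)).measurableSet
  set μ := SimpleGraph.binomialRandom (Fin n) p with hμ
  set D := G.deleteEdges {e} with hD
  set A := G ⊔ SimpleGraph.fromEdgeSet {e} with hA
  set S : Set (SimpleGraph (Fin n)) := {F | F.deleteEdges {e} = D}
  have hfe : (SimpleGraph.fromEdgeSet {e} : SimpleGraph (Fin n)).edgeSet = {e} := by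
    rw [SimpleGraph.edgeSet_fromEdgeSet]; ext x; simp; rintro rfl; exact he
  have hDT : D ∈ triangleFree n := SimpleGraph.CliqueFree.anti (SimpleGraph.deleteEdges_le _) hG
  have eD : D.edgeSet = G.edgeSet \ {e} := SimpleGraph.edgeSet_deleteEdges _
  have eA : A.edgeSet = insert e D.edgeSet := by
    rw [hA, SimpleGraph.edgeSet_sup, hfe, eD]; ext x; by_cases hx : x = e <;> simp [hx]
  have heD : e ∉ D.edgeSet := by simp [eD]
  have hS : S = {D, A} := by
    ext F
    simp only [S, Set.mem_ofPred_eq, Set.mem_insert_iff, Set.mem_singleton_iff,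
      ← SimpleGraph.edgeSet_inj, SimpleGraph.edgeSet_deleteEdges, eA]
    by_cases heF : e ∈ F.edgeSet
    · constructor
      · intro h; right; rw [← h]; simp [Set.insert_eq_of_mem heF]
      · rintro (h | h)
        · rw [h] at heF; exact absurd heF heD
        · rw [h]; simp [heD]
    · constructor
      · intro h; left; rw [← h]; simp [heF]
      · rintro (h | h)
        · rw [h]; simp [heD]
        · rw [h] at heF; simp at heF
  have hDA : D ≠ A := fun h => heD (by rw [h, eA]; simp)
  set k := D.edgeSet.ncard
  have kA : A.edgeSet.ncard = k + 1 := by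
    rw [eA, Set.ncard_insert_of_notMem heD D.edgeSet.toFinite]
  have kN : k + 1 ≤ n.choose 2 := by
    have h2 := SimpleGraph.card_edgeFinset_le_card_choose_two (G := A)
    rw [← kA, ← SimpleGraph.coe_edgeFinset, Set.ncard_coe_finset]
    simpa using h2
  obtain ⟨j, hj⟩ := Nat.exists_eq_add_of_le kN
  have wt : ∀ F, μ.real {F} = (p : ℝ) ^ F.edgeSet.ncard *
      (1 - (p : ℝ)) ^ (n.choose 2 - F.edgeSet.ncard) := by
    intro F
    simp [Measure.real, hμ, SimpleGraph.binomialRandom_singleton]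
  have wD : μ.real {D} = (p : ℝ) ^ k * (1 - p) ^ j * (1 - p) := by
    rw [wt, show n.choose 2 - D.edgeSet.ncard = j + 1 by omega]; ring
  have wA : μ.real {A} = (p : ℝ) ^ k * (1 - p) ^ j * p := by
    rw [wt, kA, show n.choose 2 - (k + 1) = j by omega]; ring
  have hw : 0 < (p : ℝ) ^ k * (1 - p) ^ j := by
    have : 0 < 1 - (p : ℝ) := by linarith
    positivity
  have hcond : ∀ T F : Set (SimpleGraph (Fin n)),
      (ProbabilityTheory.cond μ T).real F = (μ.real T)⁻¹ * μ.real (T ∩ F) := fun T F => by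
    simp [Measure.real, ProbabilityTheory.cond_apply (hms T)]
  rw [cond_cond_eq_cond_inter (hms _) (hms _), hcond]
  by_cases hAT : A ∈ triangleFree n
  · have hTS : triangleFree n ∩ S = {D, A} := by
      rw [hS]; ext F; simp only [Set.mem_inter_iff, Set.mem_insert_iff, Set.mem_singleton_iff]
      constructor
      · exact fun h => h.2
      · rintro (rfl | rfl)
        · exact ⟨hDT, Or.inl rfl⟩
        · exact ⟨hAT, Or.inr rfl⟩
    have htot : μ.real {D, A} = (p : ℝ) ^ k * (1 - p) ^ j := by
      rw [Set.insert_eq, measureReal_union (by simpa using hDA) (hms _), wD, wA]; ring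
    rw [hTS, htot]
    have ht : tryInclude G e = A := if_pos hAT
    unfold resample
    rw [ht, ← hD]
    by_cases h : H = D
    · have : ({D, A} : Set (SimpleGraph (Fin n))) ∩ {H} = {D} := by ext; simp [h]
      rw [this, wD, h, if_neg hDA, if_pos rfl, inv_mul_cancel_left₀ hw.ne']
      ring
    · by_cases h' : H = A
      · have : ({D, A} : Set (SimpleGraph (Fin n))) ∩ {H} = {A} := by ext; simp [h']
        rw [this, wA, h', if_neg hDA.symm, if_pos rfl, inv_mul_cancel_left₀ hw.ne']
        ring
      · have : ({D, A} : Set (SimpleGraph (Fin n))) ∩ {H} = ∅ := by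
          ext x; simp; rintro (rfl | rfl) <;> tauto
        rw [this]; simp [h, h']
  · have hTS : triangleFree n ∩ S = {D} := by
      rw [hS]; ext F; simp only [Set.mem_inter_iff, Set.mem_insert_iff, Set.mem_singleton_iff]
      constructor
      · rintro ⟨h, (rfl | rfl)⟩
        · rfl
        · exact absurd h hAT
      · rintro rfl; exact ⟨hDT, Or.inl rfl⟩
    have ht : tryInclude G e = D := if_neg hAT
    have hpos : 0 < μ.real {D} := by rw [wD]; exact mul_pos hw (by linarith)
    rw [hTS]
    unfold resample
    rw [ht, ← hD]
    by_cases h : H = D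
    · subst h; simp [hpos.ne']
    · have : ({D} : Set (SimpleGraph (Fin n))) ∩ {H} = ∅ := by
          ext x; simp; rintro rfl; tauto
      rw [this]; simp [h]

/-- Transition matrix of the Glauber dynamics for `μ_{𝒯,p}`: one of the `n.choose 2` potential
edges is chosen uniformly at random and resampled. -/
def glauber (n : ℕ) (p : unitInterval) : Matrix (triangleFree n) (triangleFree n) ℝ :=
  Matrix.of fun G H =>
    (∑ e ∈ (⊤ : SimpleGraph (Fin n)).edgeFinset, resample p e G.1 H.1) / (n.choose 2 : ℝ)

/-! ## Randomized algorithms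

A programming language for a randomized machine whose memory consists of arrays (numbered, and
indexed, by natural numbers) of natural numbers. Each program mentions finitely many arrays. The
cost measure is logarithmic: every operation is charged the binary length of the numbers that it
handles. The machine can toss fair coins, and it has access to a real number `p ∈ [0,1]` through
queries for the integer part of `p * 2 ^ k`, each of which costs at least `k`. -/

/-- Arithmetic expressions. -/
inductive Expr : Type
  | const (k : ℕ)
  /-- the entry of the array `a` at the index `i` -/
  | get (a : ℕ) (i : Expr)
  | add (x y : Expr)
  /-- truncated subtraction -/
  | sub (x y : Expr)
  | mul (x y : Expr)
  /-- integer quotient, with `x / 0 = 0` -/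
  | div (x y : Expr)
  /-- remainder, with `x % 0 = x` -/
  | mod (x y : Expr)
  /-- the oracle's answer to the query `k` -/
  | query (k : Expr)

/-- Contents of the memory: `m a i` is the entry of the array `a` at the index `i`. -/
abbrev Memory : Type := ℕ → ℕ → ℕ

namespace Expr

/-- The value of an expression, for the oracle `O` and the memory `m`. -/
def eval (O : ℕ → ℕ) (m : Memory) : Expr → ℕ
  | const k => k
  | get a i => m a (i.eval O m)
  | add x y => x.eval O m + y.eval O m
  | sub x y => x.eval O m - y.eval O m
  | mul x y => x.eval O m * y.eval O m
  | div x y => x.eval O m / y.eval O m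
  | mod x y => x.eval O m % y.eval O m
  | query k => O (k.eval O m)

/-- The cost of evaluating an expression: one plus the binary length of the value, for every
subexpression, and in addition `k` for every oracle query `k`. -/
def cost (O : ℕ → ℕ) (m : Memory) : Expr → ℕ
  | const k => 1 + Nat.size k
  | get a i => i.cost O m + (1 + Nat.size ((get a i).eval O m))
  | add x y => x.cost O m + y.cost O m + (1 + Nat.size ((add x y).eval O m))
  | sub x y => x.cost O m + y.cost O m + (1 + Nat.size ((sub x y).eval O m))
  | mul x y => x.cost O m + y.cost O m + (1 + Nat.size ((mul x y).eval O m))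
  | div x y => x.cost O m + y.cost O m + (1 + Nat.size ((div x y).eval O m))
  | mod x y => x.cost O m + y.cost O m + (1 + Nat.size ((mod x y).eval O m))
  | query k => k.cost O m + k.eval O m + (1 + Nat.size ((query k).eval O m))

end Expr

/-- Programs. -/
inductive Prog : Type
  | skip
  /-- `a[i] := x` -/
  | assign (a : ℕ) (i x : Expr)
  /-- `a[i] :=` the outcome (`0` or `1`) of a fresh toss of a fair coin -/
  | toss (a : ℕ) (i : Expr)
  | seq (P Q : Prog)
  /-- if `x ≠ 0` then `P` else `Q` -/
  | cond (x : Expr) (P Q : Prog)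
  /-- while `x ≠ 0` do `P` -/
  | loop (x : Expr) (P : Prog)

/-- A state of the machine: the memory, and the outcomes of all future coin tosses. -/
structure State : Type where
  mem : Memory
  coins : ℕ → Bool

/-- The state after writing `v` to `a[i]`. -/
def State.write (s : State) (a i v : ℕ) : State :=
  ⟨Function.update s.mem a (Function.update (s.mem a) i v), s.coins⟩

/-- `Exec O P s t s'`: started in the state `s`, the program `P` with oracle `O` halts in the state
`s'` after running for time `t`. -/
inductive Exec (O : ℕ → ℕ) : Prog → State → ℕ → State → Prop
  | skip (s : State) : Exec O .skip s 1 s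
  | assign (a : ℕ) (i x : Expr) (s : State) :
      Exec O (.assign a i x) s (1 + i.cost O s.mem + x.cost O s.mem)
        (s.write a (i.eval O s.mem) (x.eval O s.mem))
  | toss (a : ℕ) (i : Expr) (s : State) :
      Exec O (.toss a i) s (1 + i.cost O s.mem)
        ⟨(s.write a (i.eval O s.mem) (s.coins 0).toNat).mem, fun j => s.coins (j + 1)⟩
  | seq {P Q : Prog} {s s' s'' : State} {t t' : ℕ} :
      Exec O P s t s' → Exec O Q s' t' s'' → Exec O (.seq P Q) s (t + t') s''
  | cond_true {x : Expr} {P Q : Prog} {s s' : State} {t : ℕ} :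
      x.eval O s.mem ≠ 0 → Exec O P s t s' →
        Exec O (.cond x P Q) s (1 + x.cost O s.mem + t) s'
  | cond_false {x : Expr} {P Q : Prog} {s s' : State} {t : ℕ} :
      x.eval O s.mem = 0 → Exec O Q s t s' →
        Exec O (.cond x P Q) s (1 + x.cost O s.mem + t) s'
  | loop_true {x : Expr} {P : Prog} {s s' s'' : State} {t t' : ℕ} :
      x.eval O s.mem ≠ 0 → Exec O P s t s' → Exec O (.loop x P) s' t' s'' →
        Exec O (.loop x P) s (1 + x.cost O s.mem + t + t') s''
  | loop_false {x : Expr} {P : Prog} {s : State} :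
      x.eval O s.mem = 0 → Exec O (.loop x P) s (1 + x.cost O s.mem) s

/-- The running time and the final state are determined by the program and the initial state. -/
theorem Exec.deterministic {O : ℕ → ℕ} {P : Prog} {s s₁ s₂ : State} {t₁ t₂ : ℕ}
    (h₁ : Exec O P s t₁ s₁) (h₂ : Exec O P s t₂ s₂) : t₁ = t₂ ∧ s₁ = s₂ := by
  induction h₁ generalizing t₂ s₂ with
  | skip s => cases h₂; exact ⟨rfl, rfl⟩
  | assign a i x s => cases h₂; exact ⟨rfl, rfl⟩
  | toss a i s => cases h₂; exact ⟨rfl, rfl⟩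
  | seq _ _ ih ih' =>
    cases h₂ with
    | seq g g' =>
      obtain ⟨rfl, rfl⟩ := ih g
      obtain ⟨rfl, rfl⟩ := ih' g'
      exact ⟨rfl, rfl⟩
  | cond_true hx _ ih =>
    cases h₂ with
    | cond_true _ g => obtain ⟨rfl, rfl⟩ := ih g; exact ⟨rfl, rfl⟩
    | cond_false hx' _ => exact absurd hx' hx
  | cond_false hx _ ih =>
    cases h₂ with
    | cond_true hx' _ => exact absurd hx hx'
    | cond_false _ g => obtain ⟨rfl, rfl⟩ := ih g; exact ⟨rfl, rfl⟩
  | loop_true hx _ _ ih ih' =>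
    cases h₂ with
    | loop_true _ g g' =>
      obtain ⟨rfl, rfl⟩ := ih g
      obtain ⟨rfl, rfl⟩ := ih' g'
      exact ⟨rfl, rfl⟩
    | loop_false hx' => exact absurd hx' hx
  | loop_false hx =>
    cases h₂ with
    | loop_true hx' _ _ => exact absurd hx hx'
    | loop_false _ => exact ⟨rfl, rfl⟩

/-- The law of an infinite sequence of independent tosses of a fair coin. -/
def coinLaw : Measure (ℕ → Bool) :=
  Measure.infinitePi fun _ => (PMF.uniformOfFintype Bool).toMeasure

/-- Access to the real number `p`: the query `k` returns the integer part of `p * 2 ^ k`, that is,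
the first `k` binary digits of `p ∈ [0,1)`. -/
def digitOracle (p : unitInterval) (k : ℕ) : ℕ := ⌊(p : ℝ) * 2 ^ k⌋₊

/-- The initial state on the input `(n, ε)`, with coin tosses `ω`: the array `0` holds `n` at index
`0` and `⌈1/ε⌉` at index `1`, and all the other entries of the memory are zero. -/
def inputState (n : ℕ) (ε : ℝ) (ω : ℕ → Bool) : State :=
  ⟨fun a i => if a = 0 ∧ i = 0 then n else if a = 0 ∧ i = 1 then ⌈1 / ε⌉₊ else 0, ω⟩

/-- On the input `(n, ε)`, with access to `p` and with coin tosses `ω`, the program `P` halts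
within time `T`, and its final state satisfies `R`. -/
def HaltsWith (P : Prog) (n : ℕ) (p : unitInterval) (ε : ℝ) (ω : ℕ → Bool) (T : ℝ)
    (R : State → Prop) : Prop :=
  ∃ (t : ℕ) (s : State), Exec (digitOracle p) P (inputState n ε ω) t s ∧ (t : ℝ) ≤ T ∧ R s

/-- On the input `(n, ε)`, with access to `p` and with coin tosses `ω`, the program `P` halts in a
state that satisfies `R`. -/
def Outputs (P : Prog) (n : ℕ) (p : unitInterval) (ε : ℝ) (ω : ℕ → Bool) (R : State → Prop) :
    Prop :=
  ∃ (t : ℕ) (s : State), Exec (digitOracle p) P (inputState n ε ω) t s ∧ R s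

/-- The rational number in the array `1`: numerator at index `0`, denominator at index `1`. -/
def State.outNumber (s : State) : ℝ := (s.mem 1 0 : ℝ) / (s.mem 1 1 : ℝ)

/-- The graph on `Fin n` in the array `1`: for `i < j`, the pair `ij` is an edge if and only if the
entry with index `i * n + j` is not zero. -/
def State.outGraph (n : ℕ) (s : State) : SimpleGraph (Fin n) :=
  SimpleGraph.fromRel fun i j => i < j ∧ s.mem 1 ((i : ℕ) * n + (j : ℕ)) ≠ 0

/-- `Z'` is an `ε`-relative approximation to `Z`. -/
def IsRelApprox (ε Z' Z : ℝ) : Prop :=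
  0 < Z' ∧ Real.exp (-ε) * Z' ≤ Z ∧ Z ≤ Real.exp ε * Z'

/-- The law of the output graph, for fair coin tosses, as a mass function on `𝒯`. -/
def outGraphLaw (P : Prog) (n : ℕ) (p : unitInterval) (ε : ℝ) (G : triangleFree n) : ℝ :=
  coinLaw.real {ω | Outputs P n p ε ω fun s => s.outGraph n = G.1}

end

/-!
A triangle-free graph is treated as a finite set of potential edges, the sites, which contains no
forbidden triple (`IsTriangle`). The Glauber dynamics is the averaging operator `avg` of the
single-site update `upd`.

**Mixing.** Two copies of the dynamics are coupled by using the same site and the same coin in both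
(`coupled`). A new discrepancy can arise at a site `e` only if `e` forms a triangle with an existing
discrepancy `f` and an edge `g` of one of the two graphs, and then only with probability `p`. Once
all sites have been updated, both graphs are contained in a third one `W`, which is updated with the
same sites and coins but without regard to triangles (`dominated`); started in equilibrium, `W` is a
binomial random graph at all times. Except with exponentially small probability, each potential edge
`f` meets at most `2 c ρ √n` edges of `W`, so a discrepancy at `f` creates new ones at a rate of at
most `p * 2 c ρ √n ≤ 2 c² ρ` times the rate at which it disappears. This factor is less than `1` if
`c < 1/√2` and `ρ > 1` is close to `1`; then the expected Hamming distance decays exponentially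
(`avg_pow_hamming_le`), hence the chains meet within `O(n² log n)` steps (`exists_coalescence`). For
the finitely many small `n` it is enough that the chains may meet in the empty graph. All this is
proved for the dynamics on an arbitrary set of potential edges, which is needed for counting.
Comparison with a stationary start gives `glauber_mixingTime`.

**Sampling.** The algorithm runs the dynamics from the empty graph for `K n³ k` steps, with random
numbers of `k = c₀ (n + ⌈1/ε⌉)` bits in place of uniform codes of potential edges and of coins of
bias `p`. Its law is within `samplerError K n k` of the conditioned random graph
(`abs_coinE_sampler_sub_le`), since the coupling fails with probability at most `8⁻ᵏ`, and the
rounding costs `O(n² / 2ᵏ)` in each step.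

**Counting.** The potential edges are added one at a time. The probability of being triangle-free is
the product of the conditional probabilities that the next edge creates no triangle (`prod_ratio`),
and these are at least `1 - p ≥ 1/4`. Each of them is estimated by independent runs of the sampler,
with Chebyshev's inequality (`two_thirds_le_coinE`).

**Programs.** `Runs` is the judgement of a Hoare logic with time bounds: a program whose numbers
have at most `b` binary digits and whose loops have at most `b` iterations takes time at most
`weight * (b + 1) ^ (depth + 1)`, where `weight` and `depth` are computed from its text. The
specifications `runs_sampleMain` and `runs_countMain` therefore give the outputs as explicit
functions of the coin tosses together with polynomial time bounds.
-/

/-! ### Averaging operators of single-site random updates -/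

section Averaging

variable {E S S' : Type*}

/-- The averaging operator of one step of a random update chain on `S`: each site `e ∈ H` is chosen
with probability `α` (with the remaining probability nothing happens), a coin `b` of bias `p` is
tossed, and the state `s` is replaced by `act e b s`. -/
noncomputable def avg (H : Finset E) (α p : ℝ) (act : E → Bool → S → S) : (S → ℝ) →ₗ[ℝ] (S → ℝ) where
  toFun f s := ∑ e ∈ H, α * (p * f (act e true s) + (1 - p) * f (act e false s))
    + (1 - α * H.card) * f s
  map_add' f g := by
    funext s
    simp only [Pi.add_apply]
    rw [show ∀ a b c d : ℝ, a + b + (c + d) = (a + c) + (b + d) by intros; ring,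
      ← Finset.sum_add_distrib]
    congr 1
    · exact Finset.sum_congr rfl fun _ _ => by ring
    · ring
  map_smul' r f := by
    funext s
    simp only [Pi.smul_apply, smul_eq_mul, RingHom.id_apply, mul_add, Finset.mul_sum]
    congr 1
    · exact Finset.sum_congr rfl fun _ _ => by ring
    · ring

/-- The parameters `α`, `p` define probabilities for the site set `H`. -/
structure IsRate (H : Finset E) (α p : ℝ) : Prop where
  p0 : 0 ≤ p
  p1 : p ≤ 1
  a0 : 0 ≤ α
  a1 : α * H.card ≤ 1

theorem avg_apply (H : Finset E) (α p : ℝ) (act : E → Bool → S → S) (f : S → ℝ) (s : S) :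
    avg H α p act f s = ∑ e ∈ H, α * (p * f (act e true s) + (1 - p) * f (act e false s))
      + (1 - α * H.card) * f s := rfl

variable {H : Finset E} {α p : ℝ} {act : E → Bool → S → S}

theorem avg_const (c : ℝ) : avg H α p act (fun _ => c) = fun _ => c := by
  funext s
  rw [avg_apply]
  rw [Finset.sum_const]
  simp only [nsmul_eq_mul]
  ring

theorem avg_pow_const (c : ℝ) (t : ℕ) : (avg H α p act ^ t) (fun _ => c) = fun _ => c := by
  induction t with
  | zero => simp
  | succ t ih => rw [pow_succ, Module.End.mul_apply, avg_const, ih]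

theorem avg_mono_on (hr : IsRate H α p) {I : S → Prop}
    (hI : ∀ e ∈ H, ∀ b s, I s → I (act e b s)) {f g : S → ℝ} (hfg : ∀ s, I s → f s ≤ g s)
    (s : S) (hs : I s) : avg H α p act f s ≤ avg H α p act g s := by
  have h1 : 0 ≤ 1 - p := by linarith [hr.p1]
  have h2 : 0 ≤ 1 - α * H.card := by linarith [hr.a1]
  simp only [avg_apply]
  refine add_le_add (Finset.sum_le_sum fun e he => ?_) ?_
  · exact mul_le_mul_of_nonneg_left (add_le_add
      (mul_le_mul_of_nonneg_left (hfg _ (hI e he _ _ hs)) hr.p0)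
      (mul_le_mul_of_nonneg_left (hfg _ (hI e he _ _ hs)) h1)) hr.a0
  · exact mul_le_mul_of_nonneg_left (hfg s hs) h2

theorem avg_pow_mono_on (hr : IsRate H α p) {I : S → Prop}
    (hI : ∀ e ∈ H, ∀ b s, I s → I (act e b s)) (t : ℕ) {f g : S → ℝ}
    (hfg : ∀ s, I s → f s ≤ g s) (s : S) (hs : I s) :
    (avg H α p act ^ t) f s ≤ (avg H α p act ^ t) g s := by
  induction t generalizing s with
  | zero => simpa using hfg s hs
  | succ t ih =>
    rw [pow_succ', Module.End.mul_apply, Module.End.mul_apply]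
    exact avg_mono_on hr hI ih s hs

theorem avg_pow_mono (hr : IsRate H α p) (t : ℕ) {f g : S → ℝ} (hfg : ∀ s, f s ≤ g s) (s : S) :
    (avg H α p act ^ t) f s ≤ (avg H α p act ^ t) g s :=
  avg_pow_mono_on (I := fun _ => True) hr (fun _ _ _ _ _ => trivial) t (fun s _ => hfg s) s trivial

theorem avg_comp (φ : S → S') {act' : E → Bool → S' → S'}
    (h : ∀ e b s, φ (act e b s) = act' e b (φ s)) (f : S' → ℝ) :
    avg H α p act (fun s => f (φ s)) = fun s => avg H α p act' f (φ s) := by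
  funext s
  simp only [avg_apply, h]

/-- A function of a factor of the chain is averaged by the operator of the factor. -/
theorem avg_pow_comp (φ : S → S') {act' : E → Bool → S' → S'}
    (h : ∀ e b s, φ (act e b s) = act' e b (φ s)) (t : ℕ) (f : S' → ℝ) :
    (avg H α p act ^ t) (fun s => f (φ s)) = fun s => (avg H α p act' ^ t) f (φ s) := by
  induction t generalizing f with
  | zero => simp
  | succ t ih =>
    rw [pow_succ, Module.End.mul_apply, avg_comp φ h, ih, pow_succ, Module.End.mul_apply]

end Averaging

/-! ### The hard-core chain of a system of forbidden triples -/

section Triples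

variable {E : Type*} [DecidableEq E]

/-- No forbidden triple `T e f g` has both `f` and `g` in `X`: the site `e` may be occupied. -/
def IsFree (T : E → E → E → Prop) (e : E) (X : Finset E) : Prop := ∀ f ∈ X, ∀ g ∈ X, ¬ T e f g

/-- The set `X` contains no forbidden triple. -/
def IsIndep (T : E → E → E → Prop) (X : Finset E) : Prop := ∀ e ∈ X, IsFree T e X

open Classical in
/-- The update of the site `e` with coin `b`: the site becomes occupied if the coin says so and
no forbidden triple arises, and vacant otherwise. -/
noncomputable def upd (T : E → E → E → Prop) (e : E) (b : Bool) (X : Finset E) : Finset E :=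
  if b = true ∧ IsFree T e X then insert e X else X.erase e

/-- Symmetric systems of triples with distinct entries, in which two entries determine the
third. -/
structure IsTripleSystem (T : E → E → E → Prop) : Prop where
  swap : ∀ {e f g}, T e f g → T e g f
  rot : ∀ {e f g}, T e f g → T f e g
  irrefl : ∀ {e g}, ¬ T e e g
  unique : ∀ {e e' f g}, T e f g → T e' f g → e = e'

variable {T : E → E → E → Prop}

theorem upd_false (e : E) (X : Finset E) : upd T e false X = X.erase e := by simp [upd]

theorem upd_true_of_free {e : E} {X : Finset E} (h : IsFree T e X) :
    upd T e true X = insert e X := by simp [upd, h]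

theorem upd_true_of_not_free {e : E} {X : Finset E} (h : ¬ IsFree T e X) :
    upd T e true X = X.erase e := by simp [upd, h]

theorem upd_subset {H : Finset E} {e : E} (he : e ∈ H) (b : Bool) {X : Finset E} (hX : X ⊆ H) :
    upd T e b X ⊆ H := by
  unfold upd
  split_ifs
  · exact Finset.insert_subset he hX
  · exact (Finset.erase_subset _ _).trans hX

omit [DecidableEq E] in
theorem IsFree.mono {e : E} {X Y : Finset E} (h : IsFree T e Y) (hXY : X ⊆ Y) : IsFree T e X :=
  fun f hf g hg => h f (hXY hf) g (hXY hg)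

theorem isFree_insert (hT : IsTripleSystem T) {e : E} {X : Finset E} :
    IsFree T e (insert e X) ↔ IsFree T e X := by
  refine ⟨fun h => h.mono (Finset.subset_insert _ _), fun h f hf g hg hefg => ?_⟩
  rcases Finset.mem_insert.1 hf with rfl | hf
  · exact hT.irrefl hefg
  rcases Finset.mem_insert.1 hg with rfl | hg
  · exact hT.irrefl (hT.swap hefg)
  exact h f hf g hg hefg

omit [DecidableEq E] in
theorem IsIndep.mono {X Y : Finset E} (h : IsIndep T Y) (hXY : X ⊆ Y) : IsIndep T X :=
  fun e he => (h e (hXY he)).mono hXY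

theorem isIndep_insert (hT : IsTripleSystem T) {e : E} {X : Finset E} :
    IsIndep T (insert e X) ↔ IsIndep T X ∧ IsFree T e X := by
  constructor
  · exact fun h => ⟨h.mono (Finset.subset_insert _ _),
      (h e (Finset.mem_insert_self _ _)).mono (Finset.subset_insert _ _)⟩
  · rintro ⟨h, he⟩ f hf
    rcases Finset.mem_insert.1 hf with rfl | hfX
    · exact (isFree_insert hT).2 he
    intro g hg k hk h3
    rcases Finset.mem_insert.1 hg with rfl | hgX
    · exact (isFree_insert hT).2 he f (Finset.mem_insert_of_mem hfX) k hk (hT.rot h3)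
    rcases Finset.mem_insert.1 hk with rfl | hkX
    · exact he f hfX g hgX (hT.rot (hT.swap h3))
    exact h f hfX g hgX k hkX h3

theorem IsIndep.upd (hT : IsTripleSystem T) {e : E} {b : Bool} {X : Finset E} (h : IsIndep T X) :
    IsIndep T (upd T e b X) := by
  unfold _root_.upd
  split_ifs with h'
  · exact (isIndep_insert hT).2 ⟨h, h'.2⟩
  · exact h.mono (Finset.erase_subset _ _)

omit [DecidableEq E] in
theorem isTripleSystem_false : IsTripleSystem (fun _ _ _ : E => False) :=
  ⟨id, id, id, fun h => h.elim⟩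

/-! ### The Gibbs measure and its stationarity -/

/-- The probability of `X ⊆ H` under the product Bernoulli measure on `H`. -/
noncomputable def bernoulliWeight (H : Finset E) (p : ℝ) (X : Finset E) : ℝ :=
  p ^ X.card * (1 - p) ^ (H \ X).card

open Classical in
/-- The integral of `f` over the event that the random set (Bernoulli on `H`) is independent. -/
noncomputable def gibbsSum (T : E → E → E → Prop) (H : Finset E) (p : ℝ) (f : Finset E → ℝ) : ℝ :=
  ∑ X ∈ H.powerset, if IsIndep T X then bernoulliWeight H p X * f X else 0

theorem bernoulliWeight_nonneg {H : Finset E} {p : ℝ} (h0 : 0 ≤ p) (h1 : p ≤ 1) (X : Finset E) :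
    0 ≤ bernoulliWeight H p X := by
  have : 0 ≤ 1 - p := by linarith
  unfold bernoulliWeight; positivity

theorem gibbsSum_mono {H : Finset E} {p : ℝ} (h0 : 0 ≤ p) (h1 : p ≤ 1) {f g : Finset E → ℝ}
    (h : ∀ X ⊆ H, f X ≤ g X) : gibbsSum T H p f ≤ gibbsSum T H p g := by
  refine Finset.sum_le_sum fun X hX => ?_
  split_ifs
  · exact mul_le_mul_of_nonneg_left (h X (Finset.mem_powerset.1 hX))
      (bernoulliWeight_nonneg h0 h1 X)
  · exact le_rfl

theorem gibbsSum_add {H : Finset E} {p : ℝ} (f g : Finset E → ℝ) :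
    gibbsSum T H p (fun X => f X + g X) = gibbsSum T H p f + gibbsSum T H p g := by
  unfold gibbsSum
  rw [← Finset.sum_add_distrib]
  refine Finset.sum_congr rfl fun X _ => ?_
  split_ifs <;> ring

theorem gibbsSum_mul {H : Finset E} {p : ℝ} (c : ℝ) (f : Finset E → ℝ) :
    gibbsSum T H p (fun X => c * f X) = c * gibbsSum T H p f := by
  unfold gibbsSum
  rw [Finset.mul_sum]
  refine Finset.sum_congr rfl fun X _ => ?_
  split_ifs <;> ring

theorem gibbsSum_sum {ι : Type*} {H : Finset E} {p : ℝ} (s : Finset ι) (f : ι → Finset E → ℝ) :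
    gibbsSum T H p (fun X => ∑ i ∈ s, f i X) = ∑ i ∈ s, gibbsSum T H p (f i) := by
  classical
  induction s using Finset.induction_on with
  | empty => simp [gibbsSum]
  | insert a s ha ih =>
    simp only [Finset.sum_insert ha]
    rw [gibbsSum_add, ih]

theorem gibbsSum_congr {H : Finset E} {p : ℝ} {f g : Finset E → ℝ}
    (h : ∀ X ⊆ H, f X = g X) : gibbsSum T H p f = gibbsSum T H p g := by
  refine Finset.sum_congr rfl fun X hX => ?_
  rw [h X (Finset.mem_powerset.1 hX)]

/-- Splitting off one site. -/
theorem gibbsSum_insert (hT : IsTripleSystem T) {H : Finset E} {p : ℝ} {e : E} (he : e ∉ H)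
    (f : Finset E → ℝ) :
    gibbsSum T (insert e H) p f = (1 - p) * gibbsSum T H p f
      + p * gibbsSum T H p (fun X => by classical exact if IsFree T e X then f (insert e X) else 0) := by
  classical
  unfold gibbsSum
  rw [Finset.sum_powerset_insert he, Finset.mul_sum, Finset.mul_sum]
  congr 1
  · refine Finset.sum_congr rfl fun X hX => ?_
    have hX' := Finset.mem_powerset.1 hX
    have heX : e ∉ X := fun h => he (hX' h)
    have : insert e H \ X = insert e (H \ X) := Finset.insert_sdiff_of_notMem _ heX
    split_ifs
    · unfold bernoulliWeight
      rw [this, Finset.card_insert_of_notMem (by simp [he])]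
      ring
    · simp
  · refine Finset.sum_congr rfl fun X hX => ?_
    have hX' := Finset.mem_powerset.1 hX
    have heX : e ∉ X := fun h => he (hX' h)
    have : insert e H \ insert e X = H \ X := by
      rw [Finset.insert_sdiff_of_mem _ (Finset.mem_insert_self _ _)]
      ext x; simp only [Finset.mem_sdiff, Finset.mem_insert, not_or]
      constructor
      · exact fun h => ⟨h.1, h.2.2⟩
      · exact fun h => ⟨h.1, fun hx => he (hx ▸ h.1), h.2⟩
    rw [isIndep_insert hT]
    by_cases h1 : IsIndep T X <;> by_cases h2 : IsFree T e X <;> simp only [h1, h2, and_true,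
      and_false, if_true, if_false, mul_zero]
    unfold bernoulliWeight
    rw [this, Finset.card_insert_of_notMem heX]
    ring

/-- Resampling a site preserves the Gibbs measure. -/
theorem gibbsSum_upd (hT : IsTripleSystem T) {H : Finset E} {p : ℝ} {e : E} (he : e ∈ H)
    (f : Finset E → ℝ) :
    gibbsSum T H p (fun X => p * f (upd T e true X) + (1 - p) * f (upd T e false X))
      = gibbsSum T H p f := by
  classical
  obtain ⟨H', heH, rfl⟩ : ∃ H', e ∉ H' ∧ insert e H' = H :=
    ⟨H.erase e, Finset.notMem_erase _ _, Finset.insert_erase he⟩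
  rw [gibbsSum_insert hT heH, gibbsSum_insert hT heH, ← gibbsSum_mul, ← gibbsSum_mul,
    ← gibbsSum_mul, ← gibbsSum_mul, ← gibbsSum_add, ← gibbsSum_add]
  refine gibbsSum_congr fun X hX => ?_
  have heX : e ∉ X := fun h => heH (hX h)
  have h0 : upd T e false X = X := by rw [upd_false, Finset.erase_eq_of_notMem heX]
  by_cases h : IsFree T e X
  · have h' : IsFree T e (insert e X) := (isFree_insert hT).2 h
    simp only [if_pos h, upd_true_of_free h, upd_true_of_free h', upd_false,
      Finset.erase_insert heX, Finset.erase_eq_of_notMem heX, Finset.insert_idem]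
    ring
  · simp only [if_neg h, upd_true_of_not_free h, upd_false, Finset.erase_eq_of_notMem heX]
    ring

theorem gibbsSum_avg (hT : IsTripleSystem T) {H : Finset E} {α p : ℝ} (f : Finset E → ℝ) :
    gibbsSum T H p (avg H α p (upd T) f) = gibbsSum T H p f := by
  have : avg H α p (upd T) f = fun X =>
      (∑ e ∈ H, α * (p * f (upd T e true X) + (1 - p) * f (upd T e false X)))
        + (1 - α * H.card) * f X := rfl
  rw [this, gibbsSum_add, gibbsSum_sum, gibbsSum_mul,
    Finset.sum_congr rfl fun e he => by rw [gibbsSum_mul, gibbsSum_upd hT he], Finset.sum_const,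
    nsmul_eq_mul]
  ring

theorem gibbsSum_avg_pow (hT : IsTripleSystem T) {H : Finset E} {α p : ℝ} (t : ℕ)
    (f : Finset E → ℝ) :
    gibbsSum T H p ((avg H α p (upd T) ^ t) f) = gibbsSum T H p f := by
  induction t with
  | zero => simp
  | succ t ih => rw [pow_succ', Module.End.mul_apply, gibbsSum_avg hT, ih]

/-- The probability generating function of the number of occupied sites in `A`, in the absence of
forbidden triples. -/
theorem gibbsSum_false_prod {H : Finset E} {p z : ℝ} (A : Finset E) :
    gibbsSum (fun _ _ _ => False) H p (fun X => z ^ (A ∩ X).card)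
      = (1 + p * (z - 1)) ^ (A ∩ H).card := by
  classical
  have hi : ∀ X : Finset E, IsIndep (fun _ _ _ => False) X := fun X _ _ _ _ _ _ => id
  have hp : (1 + p * (z - 1)) ^ (A ∩ H).card
      = ∏ e ∈ H, ((if e ∈ A then p * z else p) + (1 - p)) := by
    rw [← Finset.prod_const, Finset.inter_comm, ← Finset.filter_mem_eq_inter, Finset.prod_filter]
    refine Finset.prod_congr rfl fun e _ => ?_
    split_ifs <;> ring
  rw [hp, Finset.prod_add, gibbsSum]
  refine Finset.sum_congr rfl fun X _ => ?_
  rw [if_pos (hi X), bernoulliWeight, Finset.prod_const]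
  have : ∏ e ∈ X, (if e ∈ A then p * z else p) = p ^ X.card * z ^ (A ∩ X).card := by
    rw [Finset.inter_comm, ← Finset.filter_mem_eq_inter, ← Finset.prod_const z, Finset.prod_filter,
      ← Finset.prod_const p, ← Finset.prod_mul_distrib]
    refine Finset.prod_congr rfl fun e _ => ?_
    split_ifs <;> ring
  rw [this]; ring

theorem gibbsSum_false_one (H : Finset E) (p : ℝ) :
    gibbsSum (fun _ _ _ => False) H p (fun _ => 1) = 1 := by
  simpa using gibbsSum_false_prod (H := H) (p := p) (z := 1) ∅

/-- Chernoff bound for a binomial number of occupied sites. -/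
theorem gibbsSum_false_tail {H : Finset E} {p z D : ℝ} (h0 : 0 ≤ p) (h1 : p ≤ 1) (hz : 1 < z)
    (A : Finset E) {Δ : ℕ} (hA : A.card ≤ Δ) :
    gibbsSum (fun _ _ _ => False) H p
      (fun X => by classical exact if D < (A ∩ X).card then 1 else 0)
      ≤ (1 + p * (z - 1)) ^ Δ * z ^ (-D) := by
  classical
  have hz0 : 0 < z := by linarith
  calc _ ≤ gibbsSum (fun _ _ _ => False) H p (fun X => z ^ (-D) * z ^ (A ∩ X).card) := by
        refine gibbsSum_mono h0 h1 fun X _ => ?_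
        split_ifs with h
        · rw [← Real.rpow_natCast, ← Real.rpow_add hz0]
          exact Real.one_le_rpow hz.le (by linarith)
        · positivity
    _ ≤ _ := by
        rw [gibbsSum_mul, gibbsSum_false_prod, mul_comm]
        refine mul_le_mul_of_nonneg_right (pow_le_pow_right₀ ?_ ?_) (by positivity)
        · nlinarith
        · exact (Finset.card_le_card Finset.inter_subset_left).trans hA

end Triples

/-! ### The identity coupling -/

section Coupling

variable {E : Type*} [DecidableEq E] {T : E → E → E → Prop}

/-- The coupled update of a pair of states, with the same site and the same coin. -/
noncomputable def coupled (T : E → E → E → Prop) (e : E) (b : Bool) (s : Finset E × Finset E) :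
    Finset E × Finset E := (upd T e b s.1, upd T e b s.2)

/-- The Hamming distance of a pair of states. -/
def hamming (s : Finset E × Finset E) : ℝ := (symmDiff s.1 s.2).card

open Classical in
/-- The indicator of the event that the two states differ. -/
noncomputable def differ (s : Finset E × Finset E) : ℝ := if s.1 = s.2 then 0 else 1

/-- The coupled update of `((X, Y), (U, W))`, where `X` and `Y` are states, `U` is the set of sites
that have not been updated so far, and `W` is a state of the chain without forbidden triples. -/
noncomputable def dominated (T : E → E → E → Prop) (e : E) (b : Bool)
    (s : (Finset E × Finset E) × (Finset E × Finset E)) :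
    (Finset E × Finset E) × (Finset E × Finset E) :=
  (coupled T e b s.1, (s.2.1.erase e, upd (fun _ _ _ => False) e b s.2.2))

/-- All sets of sites except `W` are contained in `H`, and both states are contained in `W ∪ U`: a
site that has been updated is occupied in `W` whenever it is occupied in `X` or `Y`. -/
def IsDominated (H : Finset E) (s : (Finset E × Finset E) × (Finset E × Finset E)) : Prop :=
  s.1.1 ⊆ H ∧ s.1.2 ⊆ H ∧ s.2.1 ⊆ H ∧ s.1.1 ⊆ s.2.2 ∪ s.2.1 ∧ s.1.2 ⊆ s.2.2 ∪ s.2.1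

theorem differ_le_hamming (s : Finset E × Finset E) : differ s ≤ hamming s := by
  unfold differ hamming
  split_ifs with h
  · positivity
  · have : 0 < (symmDiff s.1 s.2).card := by
      rw [Finset.card_pos, Finset.nonempty_iff_ne_empty]
      intro h0
      exact h (symmDiff_eq_bot.1 h0)
    exact_mod_cast this

theorem hamming_le {H : Finset E} {s : Finset E × Finset E} (h1 : s.1 ⊆ H) (h2 : s.2 ⊆ H) :
    hamming s ≤ H.card := by
  unfold hamming
  exact_mod_cast Finset.card_le_card (symmDiff_le (h1.trans le_sup_right) (h2.trans le_sup_right))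

omit [DecidableEq E] in
theorem isFree_false (e : E) (X : Finset E) : IsFree (fun _ _ _ => False) e X :=
  fun _ _ _ _ => id

theorem upd_subset_union {e : E} {b : Bool} {X U W : Finset E} (h : X ⊆ W ∪ U) :
    upd T e b X ⊆ upd (fun _ _ _ => False) e b W ∪ U.erase e := by
  intro x hx
  have hx' : (x = e ∧ b = true) ∨ (x ≠ e ∧ x ∈ X) := by
    unfold upd at hx
    split_ifs at hx with hb
    · by_cases hxe : x = e
      · exact Or.inl ⟨hxe, hb.1⟩
      · exact Or.inr ⟨hxe, (Finset.mem_insert.1 hx).resolve_left hxe⟩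
    · exact Or.inr (Finset.mem_erase.1 hx)
  rcases hx' with ⟨rfl, rfl⟩ | ⟨hxe, hxX⟩
  · rw [upd_true_of_free (isFree_false _ _)]; simp
  · have := h hxX
    unfold upd
    split_ifs <;> simp only [Finset.mem_union, Finset.mem_insert, Finset.mem_erase] at * <;> tauto

theorem IsDominated.step {H : Finset E} {s : (Finset E × Finset E) × (Finset E × Finset E)}
    {e : E} (he : e ∈ H) {b : Bool} (h : IsDominated H s) : IsDominated H (dominated T e b s) :=
  ⟨upd_subset he b h.1, upd_subset he b h.2.1, (Finset.erase_subset _ _).trans h.2.2.1,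
    upd_subset_union h.2.2.2.1, upd_subset_union h.2.2.2.2⟩

theorem mem_upd_of_ne {e x : E} (hx : x ≠ e) (b : Bool) (X : Finset E) :
    x ∈ upd T e b X ↔ x ∈ X := by
  unfold upd; split_ifs <;> simp [hx]

theorem mem_upd_self {e : E} {b : Bool} {X : Finset E} :
    e ∈ upd T e b X ↔ b = true ∧ IsFree T e X := by
  unfold upd; split_ifs with h <;> simp [h]

open Classical in
theorem hamming_coupled_le (e : E) (b : Bool) (s : Finset E × Finset E) :
    hamming (coupled T e b s) ≤ hamming s - (if e ∈ symmDiff s.1 s.2 then 1 else 0)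
      + (if b = true ∧ ¬ (IsFree T e s.1 ↔ IsFree T e s.2) then 1 else 0) := by
  obtain ⟨X, Y⟩ := s
  simp only [hamming, coupled]
  have hc : (((symmDiff X Y).erase e).card : ℝ)
      = (symmDiff X Y).card - (if e ∈ symmDiff X Y then 1 else 0) := by
    split_ifs with h
    · rw [← Finset.card_erase_add_one h]; push_cast; ring
    · rw [Finset.erase_eq_of_notMem h]; ring
  rw [← hc]
  by_cases hd : b = true ∧ ¬ (IsFree T e X ↔ IsFree T e Y)
  · rw [if_pos hd]
    have : symmDiff (upd T e b X) (upd T e b Y) ⊆ insert e ((symmDiff X Y).erase e) := by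
      intro x hx
      by_cases hxe : x = e
      · simp [hxe]
      · simp only [Finset.mem_symmDiff, mem_upd_of_ne hxe] at hx
        simp [hxe, Finset.mem_symmDiff, hx]
    exact_mod_cast (Finset.card_le_card this).trans (Finset.card_insert_le _ _)
  · rw [if_neg hd, add_zero]
    have : symmDiff (upd T e b X) (upd T e b Y) ⊆ (symmDiff X Y).erase e := by
      intro x hx
      by_cases hxe : x = e
      · subst hxe
        simp only [Finset.mem_symmDiff, mem_upd_self] at hx
        tauto
      · simp only [Finset.mem_symmDiff, mem_upd_of_ne hxe] at hx
        simp [hxe, Finset.mem_symmDiff, hx]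
    exact_mod_cast Finset.card_le_card this

/-- If exactly one of two states leaves the site `e` free, then `e` forms a forbidden triple with
a discrepancy of the two states and an occupied site of one of them. -/
theorem exists_of_isFree_ne (hT : IsTripleSystem T) {e : E} {X Y : Finset E}
    (h : ¬ (IsFree T e X ↔ IsFree T e Y)) :
    ∃ f ∈ symmDiff X Y, ∃ g ∈ X ∪ Y, T e f g := by
  wlog hX : ¬ IsFree T e X generalizing X Y
  · rw [symmDiff_comm, Finset.union_comm]
    exact this (fun h' => h h'.symm) (by tauto)
  have hY : IsFree T e Y := by tauto
  simp only [IsFree, not_forall, not_not] at hX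
  obtain ⟨f, hf, g, hg, hefg⟩ := hX
  by_cases hfY : f ∈ Y
  · by_cases hgY : g ∈ Y
    · exact (hY f hfY g hgY hefg).elim
    · exact ⟨g, by simp [Finset.mem_symmDiff, hg, hgY], f, by simp [hf], hT.swap hefg⟩
  · exact ⟨f, by simp [Finset.mem_symmDiff, hf, hfY], g, by simp [hg], hefg⟩

open Classical in
/-- A discrepancy disappears when its site is updated; a new one arises only at a site which exactly
one of the two states leaves free. -/
theorem avg_hamming_le {H : Finset E} {α p : ℝ} (hr : IsRate H α p) {s : Finset E × Finset E}
    (h1 : s.1 ⊆ H) (h2 : s.2 ⊆ H) :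
    avg H α p (coupled T) hamming s ≤ (1 - α) * hamming s
      + α * p * (H.filter fun e => ¬ (IsFree T e s.1 ↔ IsFree T e s.2)).card := by
  have hp1 : 0 ≤ 1 - p := by linarith [hr.p1]
  have hD : symmDiff s.1 s.2 ⊆ H := symmDiff_le (h1.trans le_sup_right) (h2.trans le_sup_right)
  have hDc : ∑ e ∈ H, (if e ∈ symmDiff s.1 s.2 then (1 : ℝ) else 0) = hamming s := by
    rw [← Finset.sum_filter, Finset.sum_const, nsmul_eq_mul, mul_one, hamming,
      Finset.filter_mem_eq_inter, Finset.inter_eq_right.2 hD]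
  have hFc : ∑ e ∈ H, (if ¬ (IsFree T e s.1 ↔ IsFree T e s.2) then (1 : ℝ) else 0)
      = (H.filter fun e => ¬ (IsFree T e s.1 ↔ IsFree T e s.2)).card := by
    rw [← Finset.sum_filter, Finset.sum_const, nsmul_eq_mul, mul_one]
  calc avg H α p (coupled T) hamming s
      ≤ ∑ e ∈ H, α * (hamming s - (if e ∈ symmDiff s.1 s.2 then 1 else 0)
          + p * (if ¬ (IsFree T e s.1 ↔ IsFree T e s.2) then 1 else 0))
          + (1 - α * H.card) * hamming s := by
        rw [avg_apply]
        refine add_le_add_left (Finset.sum_le_sum fun e _ => mul_le_mul_of_nonneg_left ?_ hr.a0) _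
        have ht := mul_le_mul_of_nonneg_left (hamming_coupled_le (T := T) e true s) hr.p0
        have hf := mul_le_mul_of_nonneg_left (hamming_coupled_le (T := T) e false s) hp1
        simp only [true_and, Bool.false_eq_true, false_and, if_false] at ht hf
        linarith
    _ = _ := by
        rw [← Finset.mul_sum, Finset.sum_add_distrib, Finset.sum_sub_distrib, hDc, ← Finset.mul_sum,
          hFc, Finset.sum_const, nsmul_eq_mul]
        ring

variable {nb : E → Finset E}

open Classical in
/-- The number of sites at which the two states allow different updates is controlled by the
degrees, in the dominating set `W`, of their discrepancies. -/
theorem card_isFree_ne_le (hT : IsTripleSystem T) (hnb : ∀ {e f g}, T e f g → g ∈ nb f)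
    (H : Finset E) {X Y W : Finset E} (hX : X ⊆ W) (hY : Y ⊆ W) {D : ℝ}
    (hD : ∀ f ∈ symmDiff X Y, ((nb f ∩ W).card : ℝ) ≤ D) :
    ((H.filter fun e => ¬ (IsFree T e X ↔ IsFree T e Y)).card : ℝ) ≤ D * hamming (X, Y) := by
  have hsub : (H.filter fun e => ¬ (IsFree T e X ↔ IsFree T e Y))
      ⊆ (symmDiff X Y).biUnion fun f => H.filter fun e => ∃ g ∈ W, T e f g := by
    intro e he
    rw [Finset.mem_filter] at he
    obtain ⟨f, hf, g, hg, h⟩ := exists_of_isFree_ne hT he.2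
    exact Finset.mem_biUnion.2 ⟨f, hf, Finset.mem_filter.2
      ⟨he.1, g, Finset.union_subset hX hY hg, h⟩⟩
  have hone : ∀ f, (H.filter fun e => ∃ g ∈ W, T e f g).card ≤ (nb f ∩ W).card := by
    intro f
    refine Finset.card_le_card_of_forall_subsingleton (fun e g => T e f g) ?_ ?_
    · intro e he
      obtain ⟨g, hg, h⟩ := (Finset.mem_filter.1 he).2
      exact ⟨g, Finset.mem_inter.2 ⟨hnb h, hg⟩, h⟩
    · intro g _ e he e' he'
      exact hT.unique he.2 he'.2
  calc _ ≤ ((∑ f ∈ symmDiff X Y, (nb f ∩ W).card : ℕ) : ℝ) := by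
        exact_mod_cast (Finset.card_le_card hsub).trans (Finset.card_biUnion_le.trans
          (Finset.sum_le_sum fun f _ => hone f))
    _ ≤ ∑ f ∈ symmDiff X Y, D := by push_cast; exact Finset.sum_le_sum hD
    _ = _ := by rw [Finset.sum_const, nsmul_eq_mul, hamming, mul_comm]

open Classical in
/-- The indicator of the event that some site of `H` has more than `D` neighbours in `W`. -/
noncomputable def hasLargeDegree (nb : E → Finset E) (H : Finset E) (D : ℝ) (W : Finset E) : ℝ :=
  if ∃ f ∈ H, D < (nb f ∩ W).card then 1 else 0

/-- One step of the coupling contracts the Hamming distance, unless some site has not been updated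
yet or the dominating random set has a site of large degree. -/
theorem avg_dominated_le (hT : IsTripleSystem T) (hnb : ∀ {e f g}, T e f g → g ∈ nb f)
    {H : Finset E} {α p D γ : ℝ} (hr : IsRate H α p) (hγ : p * D ≤ 1 - γ) (hγ1 : γ ≤ 1)
    (s : (Finset E × Finset E) × (Finset E × Finset E)) (hs : IsDominated H s) :
    avg H α p (dominated T) (fun s => hamming s.1) s
      ≤ (1 - γ * α) * hamming s.1 + (s.2.1.card + hasLargeDegree nb H D s.2.2) := by
  classical
  obtain ⟨⟨X, Y⟩, ⟨U, W⟩⟩ := s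
  obtain ⟨h1, h2, h3, h4, h5⟩ := hs
  simp only at h1 h2 h3 h4 h5
  rw [avg_comp (fun s : (Finset E × Finset E) × (Finset E × Finset E) => s.1)
    (act' := coupled T) (fun _ _ _ => rfl)]
  refine (avg_hamming_le hr h1 h2).trans ?_
  have hh : 0 ≤ hamming (X, Y) := by unfold hamming; positivity
  have hα := hr.a0
  have hαp : 0 ≤ α * p := mul_nonneg hr.a0 hr.p0
  have hdeg0 : 0 ≤ hasLargeDegree nb H D W := by
    unfold hasLargeDegree; split_ifs <;> norm_num
  simp only
  by_cases hbad : U = ∅ ∧ ¬ ∃ f ∈ H, D < (nb f ∩ W).card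
  · obtain ⟨rfl, hb⟩ := hbad
    push Not at hb
    rw [Finset.union_empty] at h4 h5
    have := card_isFree_ne_le hT hnb H h4 h5 (D := D) fun f hf =>
      hb f (symmDiff_le (h1.trans le_sup_right) (h2.trans le_sup_right) hf)
    have h6 := mul_le_mul_of_nonneg_left this hαp
    have h7 : α * hamming (X, Y) * (p * D) ≤ α * hamming (X, Y) * (1 - γ) :=
      mul_le_mul_of_nonneg_left hγ (mul_nonneg hα hh)
    have h8 : (0 : ℝ) ≤ (∅ : Finset E).card := by positivity
    nlinarith
  · have h6 : 1 ≤ (U.card : ℝ) + hasLargeDegree nb H D W := by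
      by_cases hU : U = ∅
      · have : hasLargeDegree nb H D W = 1 := if_pos (by tauto)
        rw [this]
        have h8 : (0 : ℝ) ≤ U.card := by positivity
        linarith
      · have : (1 : ℝ) ≤ U.card := by
          exact_mod_cast Finset.card_pos.2 (Finset.nonempty_iff_ne_empty.2 hU)
        linarith
    have h7 : ((H.filter fun e => ¬ (IsFree T e X ↔ IsFree T e Y)).card : ℝ) ≤ H.card := by
      exact_mod_cast Finset.card_filter_le _ _
    have h8 : α * p * ((H.filter fun e => ¬ (IsFree T e X ↔ IsFree T e Y)).card : ℝ) ≤ 1 := by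
      calc _ ≤ α * p * H.card := mul_le_mul_of_nonneg_left h7 hαp
        _ = p * (α * H.card) := by ring
        _ ≤ 1 := mul_le_one₀ hr.p1 (mul_nonneg hα (by positivity)) hr.a1
    have h9 : 0 ≤ α * hamming (X, Y) * (1 - γ) :=
      mul_nonneg (mul_nonneg hα hh) (by linarith)
    nlinarith

theorem avg_card_not_updated {H : Finset E} {α p : ℝ} (t : ℕ) {U : Finset E} (hU : U ⊆ H) :
    (avg H α p (fun e _ U => Finset.erase U e) ^ t) (fun U : Finset E => (U.card : ℝ)) U
      = (1 - α) ^ t * U.card := by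
  -- the averaged function is only an eigenfunction on subsets of `H`, so `U` is intersected with
  -- `H`
  have key : avg H α p (fun e _ U => Finset.erase U e) (fun U : Finset E => ((U ∩ H).card : ℝ))
      = (1 - α) • fun U : Finset E => ((U ∩ H).card : ℝ) := by
    funext U
    have : ∀ e ∈ H, α * (p * (((U.erase e) ∩ H).card : ℝ) + (1 - p) * (((U.erase e) ∩ H).card : ℝ))
        = α * ((U ∩ H).card - (if e ∈ U ∩ H then 1 else 0)) := by
      intro e he
      rw [Finset.erase_inter]
      split_ifs with h
      · rw [← Finset.card_erase_add_one h]; push_cast; ring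
      · rw [Finset.erase_eq_of_notMem h]; ring
    rw [avg_apply, Finset.sum_congr rfl this, ← Finset.mul_sum, Finset.sum_sub_distrib,
      ← Finset.sum_filter, Finset.sum_const, Finset.sum_const, Finset.filter_mem_eq_inter,
      Finset.inter_eq_right.2 Finset.inter_subset_right]
    simp only [nsmul_eq_mul, mul_one, Pi.smul_apply, smul_eq_mul]
    ring
  have key' : ∀ t : ℕ, (avg H α p (fun e _ U => Finset.erase U e) ^ t)
      (fun U : Finset E => ((U ∩ H).card : ℝ)) = (1 - α) ^ t • fun U : Finset E => ((U ∩ H).card : ℝ) := by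
    intro t
    induction t with
    | zero => simp
    | succ t ih => rw [pow_succ, Module.End.mul_apply, key, map_smul, ih, smul_smul, ← pow_succ']
  have hcongr : (avg H α p (fun e _ U => Finset.erase U e) ^ t) (fun U : Finset E => (U.card : ℝ)) U
      = (avg H α p (fun e _ U => Finset.erase U e) ^ t)
        (fun U : Finset E => ((U ∩ H).card : ℝ)) U := by
    have hI : ∀ (f g : Finset E → ℝ), (∀ U ⊆ H, f U = g U) → ∀ U ⊆ H,
        (avg H α p (fun e _ U => Finset.erase U e) ^ t) f U
          = (avg H α p (fun e _ U => Finset.erase U e) ^ t) g U := by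
      intro f g hfg
      induction t with
      | zero => simpa using hfg
      | succ t ih =>
        intro U hU
        rw [pow_succ', Module.End.mul_apply, Module.End.mul_apply, avg_apply, avg_apply]
        have := fun e => ih (U.erase e) ((Finset.erase_subset e U).trans hU)
        simp only [this, ih U hU]
    exact hI _ _ (fun U hU => by rw [Finset.inter_eq_left.2 hU]) U hU
  rw [hcongr, key']
  simp [Finset.inter_eq_left.2 hU]

/-- The expected Hamming distance after `t` coupled steps. Here `q` bounds the probability that the
Bernoulli random subset of `H` has a site of large degree. This random subset is the stationary law
of the dominating chain, so the failures of the contraction contribute at most `q` in each step, and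
`q / (γ α)` in total. -/
theorem avg_pow_hamming_le (hT : IsTripleSystem T) (hnb : ∀ {e f g}, T e f g → g ∈ nb f)
    {H : Finset E} {α p D γ q : ℝ} (hr : IsRate H α p) (hγ : p * D ≤ 1 - γ) (hγ0 : 0 < γ)
    (hγ1 : γ ≤ 1 / 2) (hα : 0 < α) (hα1 : α ≤ 1)
    (hq : gibbsSum (fun _ _ _ => False) H p (hasLargeDegree nb H D) ≤ q)
    (t : ℕ) {X Y : Finset E} (hX : X ⊆ H) (hY : Y ⊆ H) :
    (avg H α p (coupled T) ^ t) hamming (X, Y)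
      ≤ H.card * (1 + 4 * t) * (1 - γ * α) ^ t + q / (γ * α) := by
  have hq0 : 0 ≤ q := by
    refine le_trans ?_ hq
    have := gibbsSum_mono (T := fun _ _ _ => False) (H := H) hr.p0 hr.p1 (f := fun _ => 0)
      (g := hasLargeDegree nb H D) (fun X _ => by unfold hasLargeDegree; split_ifs <;> norm_num)
    simpa [gibbsSum] using this
  have hρ : 1 / 2 ≤ 1 - γ * α := by nlinarith
  induction t with
  | zero =>
    have := hamming_le (s := (X, Y)) hX hY
    simp only [pow_zero, Module.End.one_apply, Nat.cast_zero, mul_zero, add_zero, mul_one]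
    have : 0 ≤ q / (γ * α) := by positivity
    linarith
  | succ t ih =>
    have hrec : (avg H α p (coupled T) ^ (t + 1)) hamming (X, Y)
        ≤ (1 - γ * α) * (avg H α p (coupled T) ^ t) hamming (X, Y) + ((1 - α) ^ t * H.card + q) := by
      -- the inequality for a fixed initial state `W` of the dominating chain
      have hW : ∀ W ⊆ H, (avg H α p (coupled T) ^ (t + 1)) hamming (X, Y)
          ≤ ((1 - γ * α) * (avg H α p (coupled T) ^ t) hamming (X, Y) + (1 - α) ^ t * H.card)
            + (avg H α p (upd fun _ _ _ => False) ^ t) (hasLargeDegree nb H D) W := by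
        intro W _
        have e1 := congrFun (avg_pow_comp (H := H) (α := α) (p := p) (act := dominated T)
          (fun s => s.1) (act' := coupled T) (fun _ _ _ => rfl) (t + 1) hamming) ((X, Y), (H, W))
        have e2 := congrFun (avg_pow_comp (H := H) (α := α) (p := p) (act := dominated T)
          (fun s => s.1) (act' := coupled T) (fun _ _ _ => rfl) t hamming) ((X, Y), (H, W))
        have e3 := congrFun (avg_pow_comp (H := H) (α := α) (p := p) (act := dominated T)
          (fun s => s.2.1) (act' := fun e _ U => U.erase e) (fun _ _ _ => rfl) t
          (fun U => (U.card : ℝ))) ((X, Y), (H, W))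
        have e4 := congrFun (avg_pow_comp (H := H) (α := α) (p := p) (act := dominated T)
          (fun s => s.2.2) (act' := upd fun _ _ _ => False) (fun _ _ _ => rfl) t
          (hasLargeDegree nb H D)) ((X, Y), (H, W))
        simp only at e1 e2 e3 e4
        rw [← e1, ← e2, ← e4, ← avg_card_not_updated (p := p) t subset_rfl, ← e3, pow_succ,
          Module.End.mul_apply]
        have := avg_pow_mono_on hr (I := IsDominated H) (act := dominated T)
          (fun e he b s hs => hs.step he) t (avg_dominated_le hT hnb hr hγ (by linarith))
          ((X, Y), (H, W)) ⟨hX, hY, subset_rfl, hX.trans Finset.subset_union_right,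
            hY.trans Finset.subset_union_right⟩
        refine this.trans (le_of_eq ?_)
        have split : (fun s : (Finset E × Finset E) × (Finset E × Finset E) =>
            (1 - γ * α) * hamming s.1 + (s.2.1.card + hasLargeDegree nb H D s.2.2))
            = (1 - γ * α) • (fun s : (Finset E × Finset E) × (Finset E × Finset E) => hamming s.1)
              + ((fun s => (s.2.1.card : ℝ)) + fun s => hasLargeDegree nb H D s.2.2) := by
          funext s; simp
        rw [split, map_add, map_add, map_smul]
        simp only [Pi.add_apply, Pi.smul_apply, smul_eq_mul]
        ring
      -- average over a stationary initial state `W`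
      have h1 := gibbsSum_mono (T := fun _ _ _ => False) (H := H) hr.p0 hr.p1 hW
      rw [gibbsSum_add, gibbsSum_avg_pow isTripleSystem_false] at h1
      have c1 : ∀ c : ℝ, gibbsSum (fun _ _ _ => False) H p (fun _ => c) = c := fun c => by
        simpa [gibbsSum_false_one] using gibbsSum_mul (T := fun _ _ _ => False) (H := H) (p := p)
          c (fun _ => 1)
      rw [c1, c1] at h1
      linarith
    have h1 : (1 - α) ^ t ≤ (1 - γ * α) ^ t :=
      pow_le_pow_left₀ (by linarith) (by nlinarith) t
    have h2 : (1 - α) ^ t * H.card ≤ (1 - γ * α) ^ t * H.card :=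
      mul_le_mul_of_nonneg_right h1 (by positivity)
    have h3 := mul_le_mul_of_nonneg_left ih (by linarith : 0 ≤ 1 - γ * α)
    have h4 : (1 - γ * α) * (q / (γ * α)) + q = q / (γ * α) := by field_simp; ring
    have h5 : 0 ≤ (1 - γ * α) ^ t * H.card := mul_nonneg (pow_nonneg (by linarith) t) (by positivity)
    have h6 := mul_le_mul_of_nonneg_left hρ h5
    rw [pow_succ (1 - γ * α)]
    push_cast
    nlinarith

end Coupling

/-! ### Coalescence of the coupled chains -/

section Coalescence

variable {E : Type*} [DecidableEq E] {T : E → E → E → Prop} {H : Finset E} {α p : ℝ}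

theorem differ_le_one (s : Finset E × Finset E) : differ s ≤ 1 := by
  unfold differ; split_ifs <;> norm_num

theorem avg_pow_differ_le_one (hr : IsRate H α p) (t : ℕ) (s : Finset E × Finset E) :
    (avg H α p (coupled T) ^ t) differ s ≤ 1 := by
  have := avg_pow_mono hr (act := coupled T) t differ_le_one s
  rwa [avg_pow_const] at this

theorem avg_pow_differ_self (t : ℕ) (X : Finset E) :
    (avg H α p (coupled T) ^ t) differ (X, X) = 0 := by
  induction t generalizing X with
  | zero => simp [differ]
  | succ t ih =>
    rw [pow_succ', Module.End.mul_apply, avg_apply]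
    simp [coupled, ih]

/-- Once they have met, the coupled chains stay together. -/
theorem avg_pow_differ_le_mul {c : ℝ} {m : ℕ} {s : Finset E × Finset E}
    (h : (avg H α p (coupled T) ^ m) differ s ≤ c) :
    (avg H α p (coupled T) ^ m) differ s ≤ c * differ s := by
  obtain ⟨X, Y⟩ := s
  by_cases hXY : X = Y
  · subst hXY
    rw [avg_pow_differ_self]; simp [differ]
  · simpa [differ, hXY] using h

theorem avg_pow_differ_add_le (hr : IsRate H α p) {c : ℝ} {m : ℕ}
    (h : ∀ X ⊆ H, ∀ Y ⊆ H, (avg H α p (coupled T) ^ m) differ (X, Y) ≤ c) (t : ℕ)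
    {X Y : Finset E} (hX : X ⊆ H) (hY : Y ⊆ H) :
    (avg H α p (coupled T) ^ (t + m)) differ (X, Y)
      ≤ c * (avg H α p (coupled T) ^ t) differ (X, Y) := by
  rw [pow_add, Module.End.mul_apply]
  have := avg_pow_mono_on hr (act := coupled T) (I := fun s => s.1 ⊆ H ∧ s.2 ⊆ H)
    (fun e he b s hs => ⟨upd_subset he b hs.1, upd_subset he b hs.2⟩) t
    (f := (avg H α p (coupled T) ^ m) differ) (g := c • differ)
    (fun s hs => avg_pow_differ_le_mul (h s.1 hs.1 s.2 hs.2)) (X, Y) ⟨hX, hY⟩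
  rwa [map_smul] at this

theorem avg_pow_differ_antitone (hr : IsRate H α p) {m t : ℕ} (hmt : m ≤ t)
    {X Y : Finset E} (hX : X ⊆ H) (hY : Y ⊆ H) :
    (avg H α p (coupled T) ^ t) differ (X, Y) ≤ (avg H α p (coupled T) ^ m) differ (X, Y) := by
  obtain ⟨k, rfl⟩ := Nat.exists_eq_add_of_le hmt
  simpa using avg_pow_differ_add_le hr (m := k) (c := 1)
    (fun _ _ _ _ => avg_pow_differ_le_one hr k _) m hX hY

theorem avg_pow_differ_mul_le (hr : IsRate H α p) {c : ℝ} (hc : 0 ≤ c) {m : ℕ}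
    (h : ∀ X ⊆ H, ∀ Y ⊆ H, (avg H α p (coupled T) ^ m) differ (X, Y) ≤ c) (l : ℕ)
    {X Y : Finset E} (hX : X ⊆ H) (hY : Y ⊆ H) :
    (avg H α p (coupled T) ^ (m * l)) differ (X, Y) ≤ c ^ l := by
  induction l with
  | zero => simpa using differ_le_one (X, Y)
  | succ l ih =>
    rw [Nat.mul_succ, pow_succ']
    exact (avg_pow_differ_add_le hr h _ hX hY).trans (mul_le_mul_of_nonneg_left ih hc)

/-- With probability at least `(α (1 - p)) ^ #A`, the sites of `A` are vacated one after another,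
in a fixed order. -/
theorem avg_pow_card_differ_le (hr : IsRate H α p) {A : Finset E} (hA : A ⊆ H) {X Y : Finset E}
    (hX : X ⊆ A) (hY : Y ⊆ A) :
    (avg H α p (coupled T) ^ A.card) differ (X, Y) ≤ 1 - (α * (1 - p)) ^ A.card := by
  induction A using Finset.induction_on generalizing X Y with
  | empty =>
    rw [Finset.subset_empty.1 hX, Finset.subset_empty.1 hY]; simp [differ]
  | insert a A ha ih =>
    rw [Finset.card_insert_of_notMem ha, pow_succ', Module.End.mul_apply]
    set F := (avg H α p (coupled T) ^ A.card) differ with hF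
    have hF1 : ∀ s, F s ≤ 1 := avg_pow_differ_le_one hr _
    have hp1 : 0 ≤ 1 - p := by linarith [hr.p1]
    have haH : a ∈ H := hA (Finset.mem_insert_self _ _)
    have h1 := ih ((Finset.subset_insert _ _).trans hA)
      (X := X.erase a) (Y := Y.erase a) (Finset.subset_insert_iff.1 hX)
      (Finset.subset_insert_iff.1 hY)
    have hc : coupled T a false (X, Y) = (X.erase a, Y.erase a) := by
      simp [coupled, upd_false]
    -- every update but the vacating of `a` is only bounded trivially
    have hsum : ∑ e ∈ H, α * (p * F (coupled T e true (X, Y)) + (1 - p) * F (coupled T e false (X, Y)))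
        ≤ ∑ e ∈ H, (α - if e = a then α * (1 - p) * (α * (1 - p)) ^ A.card else 0) := by
      refine Finset.sum_le_sum fun e _ => ?_
      have h2 := mul_le_mul_of_nonneg_left (hF1 (coupled T e true (X, Y))) hr.p0
      split_ifs with hea
      · subst hea
        rw [hc]
        have h3 := mul_le_mul_of_nonneg_left h1 hp1
        have := mul_le_mul_of_nonneg_left (add_le_add h2 h3) hr.a0
        linarith
      · have h3 := mul_le_mul_of_nonneg_left (hF1 (coupled T e false (X, Y))) hp1
        have := mul_le_mul_of_nonneg_left (add_le_add h2 h3) hr.a0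
        linarith
    rw [Finset.sum_sub_distrib, Finset.sum_ite_eq' H a, if_pos haH, Finset.sum_const,
      nsmul_eq_mul] at hsum
    rw [avg_apply]
    have h4 := mul_le_mul_of_nonneg_left (hF1 (X, Y)) (by linarith [hr.a1] : 0 ≤ 1 - α * H.card)
    rw [pow_succ']
    linarith

/-- Comparison of the chain started at `X` with the stationary measure. -/
theorem abs_avg_pow_sub_gibbsSum_le (hT : IsTripleSystem T) (hr : IsRate H α p) {c : ℝ} {t : ℕ}
    (h : ∀ X ⊆ H, ∀ Y ⊆ H, (avg H α p (coupled T) ^ t) differ (X, Y) ≤ c)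
    {f : Finset E → ℝ} (hf : ∀ X, |f X| ≤ 1) {X : Finset E} (hX : X ⊆ H) :
    |gibbsSum T H p (fun _ => 1) * (avg H α p (upd T) ^ t) f X - gibbsSum T H p f|
      ≤ gibbsSum T H p (fun _ => 1) * (2 * c) := by
  -- two starting states are compared by the coupling, and then `Y` is averaged over the Gibbs
  -- measure
  have key : ∀ Y ⊆ H, |(avg H α p (upd T) ^ t) f X - (avg H α p (upd T) ^ t) f Y| ≤ 2 * c := by
    intro Y hY
    have e1 := congrFun (avg_pow_comp (H := H) (α := α) (p := p) (act := coupled T)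
      (fun s => s.1) (act' := upd T) (fun _ _ _ => rfl) t f) (X, Y)
    have e2 := congrFun (avg_pow_comp (H := H) (α := α) (p := p) (act := coupled T)
      (fun s => s.2) (act' := upd T) (fun _ _ _ => rfl) t f) (X, Y)
    have e3 : (avg H α p (upd T) ^ t) f X - (avg H α p (upd T) ^ t) f Y
        = (avg H α p (coupled T) ^ t) (fun s => f s.1 - f s.2) (X, Y) := by
      rw [show (fun s : Finset E × Finset E => f s.1 - f s.2)
        = (fun s => f s.1) - fun s => f s.2 from rfl, map_sub]
      simp only [Pi.sub_apply, e1, e2]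
    have b1 : ∀ s : Finset E × Finset E, |f s.1 - f s.2| ≤ 2 * differ s := by
      intro s
      by_cases hs : s.1 = s.2
      · simp [hs, differ]
      · have h1 := abs_le.1 (hf s.1)
        have h2 := abs_le.1 (hf s.2)
        simp only [differ, hs, if_false, abs_le]
        constructor <;> linarith
    have u := avg_pow_mono hr (act := coupled T) t (f := fun s => f s.1 - f s.2) (g := (2 : ℝ) • differ)
      (fun s => (abs_le.1 (b1 s)).2) (X, Y)
    have l := avg_pow_mono hr (act := coupled T) t (f := (-2 : ℝ) • differ) (g := fun s => f s.1 - f s.2)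
      (fun s => by have := (abs_le.1 (b1 s)).1; simp only [Pi.smul_apply, smul_eq_mul]; linarith) (X, Y)
    rw [map_smul, Pi.smul_apply, smul_eq_mul] at u l
    have := h X hX Y hY
    rw [e3, abs_le]
    constructor <;> linarith
  have m1 := gibbsSum_mono (T := T) hr.p0 hr.p1 fun Y hY => (abs_le.1 (key Y hY)).2
  have m2 := gibbsSum_mono (T := T) hr.p0 hr.p1 fun Y hY => (abs_le.1 (key Y hY)).1
  have c1 : ∀ c : ℝ, gibbsSum T H p (fun _ => c) = gibbsSum T H p (fun _ => 1) * c := fun c => by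
    simpa [mul_comm] using gibbsSum_mul (T := T) (H := H) (p := p) c (fun _ => 1)
  have e4 : gibbsSum T H p (fun Y => (avg H α p (upd T) ^ t) f X - (avg H α p (upd T) ^ t) f Y)
      = gibbsSum T H p (fun _ => 1) * (avg H α p (upd T) ^ t) f X - gibbsSum T H p f := by
    have := gibbsSum_add (T := T) (H := H) (p := p) (fun _ => (avg H α p (upd T) ^ t) f X)
      (fun Y => (-1) * (avg H α p (upd T) ^ t) f Y)
    rw [gibbsSum_mul, gibbsSum_avg_pow hT, c1] at this
    rw [sub_eq_add_neg, ← neg_one_mul (gibbsSum T H p f), ← this]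
    exact gibbsSum_congr fun Y _ => by ring
  rw [e4, c1 (2 * c)] at m1
  rw [e4, c1 (-(2 * c))] at m2
  rw [abs_le]
  constructor <;> linarith

end Coalescence

/-! ### Triangles -/

/-- The pairs `e`, `f`, `g` are the sides of a triangle. -/
def IsTriangle {V : Type*} (e f g : Sym2 V) : Prop :=
  ∃ a b c, a ≠ b ∧ a ≠ c ∧ b ≠ c ∧ e = s(a, b) ∧ f = s(a, c) ∧ g = s(b, c)

theorem isTripleSystem_isTriangle {V : Type*} : IsTripleSystem (IsTriangle (V := V)) where
  swap := by
    rintro e f g ⟨a, b, c, h1, h2, h3, rfl, rfl, rfl⟩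
    exact ⟨b, a, c, h1.symm, h3, h2, Sym2.eq_swap, rfl, rfl⟩
  rot := by
    rintro e f g ⟨a, b, c, h1, h2, h3, rfl, rfl, rfl⟩
    exact ⟨a, c, b, h2, h1, h3.symm, rfl, rfl, Sym2.eq_swap⟩
  irrefl := by
    rintro e g ⟨a, b, c, h1, h2, h3, rfl, h, rfl⟩
    rw [Sym2.eq_iff] at h
    grind
  unique := by
    rintro e e' f g ⟨a, b, c, h1, h2, h3, rfl, rfl, rfl⟩ ⟨a', b', c', h1', h2', h3', rfl, hf, hg⟩
    rw [Sym2.eq_iff] at hf hg ⊢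
    grind

open Classical in
/-- The pairs that share a vertex with `f`. -/
noncomputable def incidentPairs {n : ℕ} (f : Sym2 (Fin n)) : Finset (Sym2 (Fin n)) :=
  Finset.univ.filter fun g => ∃ a, a ∈ f ∧ a ∈ g

theorem mem_incidentPairs_of_isTriangle {n : ℕ} {e f g : Sym2 (Fin n)} (h : IsTriangle e f g) :
    g ∈ incidentPairs f := by
  obtain ⟨a, b, c, -, -, -, rfl, rfl, rfl⟩ := h
  simp only [incidentPairs, Finset.mem_filter, Finset.mem_univ, true_and]
  exact ⟨c, by simp, by simp⟩

theorem card_incidentPairs_le {n : ℕ} (f : Sym2 (Fin n)) : (incidentPairs f).card ≤ 2 * n := by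
  classical
  induction f using Sym2.ind with
  | _ a b =>
    have : incidentPairs s(a, b) ⊆ Finset.univ.image (fun x => s(a, x))
        ∪ Finset.univ.image (fun x => s(b, x)) := by
      intro g hg
      simp only [incidentPairs, Finset.mem_filter, Finset.mem_univ, true_and] at hg
      obtain ⟨v, hv, hg⟩ := hg
      obtain ⟨w, rfl⟩ := hg
      simp only [Finset.mem_union, Finset.mem_image, Finset.mem_univ, true_and]
      rcases Sym2.mem_iff.1 hv with rfl | rfl
      · exact Or.inl ⟨w, rfl⟩
      · exact Or.inr ⟨w, rfl⟩
    refine (Finset.card_le_card this).trans ((Finset.card_union_le _ _).trans ?_)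
    have h1 := (Finset.card_image_le (s := (Finset.univ : Finset (Fin n))) (f := fun x => s(a, x)))
    have h2 := (Finset.card_image_le (s := (Finset.univ : Finset (Fin n))) (f := fun x => s(b, x)))
    simp only [Finset.card_univ, Fintype.card_fin] at h1 h2
    omega

theorem card_pairs_le {n : ℕ} (H : Finset (Sym2 (Fin n))) : H.card ≤ n ^ 2 := by
  refine (Finset.card_le_univ H).trans ?_
  rw [Sym2.card, Fintype.card_fin, Nat.choose_two_right]
  apply Nat.div_le_of_le_mul
  simp only [Nat.add_sub_cancel]
  nlinarith [Nat.le_mul_self n]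

/-! ### Coalescence time of the triangle chain -/

/-- A union bound and the Chernoff bound: in the binomial random graph with `p ≤ c / √n`, all pairs
have at most `2 c ρ √n` incident edges, except with probability exponentially small in `√n`. -/
theorem gibbsSum_hasLargeDegree_le {n : ℕ} {c ρ p : ℝ} (hρ : 1 < ρ) (hn : 0 < n)
    (H : Finset (Sym2 (Fin n))) (h0 : 0 ≤ p) (h1 : p ≤ 1) (hp : p ≤ c / Real.sqrt n) :
    gibbsSum (fun _ _ _ => False) H p (hasLargeDegree incidentPairs H (2 * c * ρ * Real.sqrt n))
      ≤ (n : ℝ) ^ 2 * Real.exp (-(2 * c * (ρ * Real.log ρ - (ρ - 1)) * Real.sqrt n)) := by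
  classical
  set D := 2 * c * ρ * Real.sqrt n with hD
  have hs : 0 < Real.sqrt n := Real.sqrt_pos.2 (by exact_mod_cast hn)
  have hss : Real.sqrt n * Real.sqrt n = n := Real.mul_self_sqrt (by positivity)
  have hpc : p * Real.sqrt n ≤ c := (le_div_iff₀ hs).1 hp
  have tail : (1 + p * (ρ - 1)) ^ (2 * n) * ρ ^ (-D)
      ≤ Real.exp (-(2 * c * (ρ * Real.log ρ - (ρ - 1)) * Real.sqrt n)) := by
    have e1 : (1 + p * (ρ - 1)) ^ (2 * n) ≤ Real.exp (2 * c * (ρ - 1) * Real.sqrt n) := by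
      have h2 : 1 + p * (ρ - 1) ≤ Real.exp (p * (ρ - 1)) := by
        linarith [Real.add_one_le_exp (p * (ρ - 1))]
      have h3 : 0 ≤ p * (ρ - 1) := mul_nonneg h0 (by linarith)
      refine (pow_le_pow_left₀ (by linarith) h2 _).trans ?_
      rw [← Real.exp_nat_mul]
      refine Real.exp_le_exp.2 ?_
      push_cast
      have : (p * Real.sqrt n) * ((ρ - 1) * Real.sqrt n) ≤ c * ((ρ - 1) * Real.sqrt n) :=
        mul_le_mul_of_nonneg_right hpc (mul_nonneg (by linarith) hs.le)
      nlinarith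
    have e2 : ρ ^ (-D) = Real.exp (-(2 * c * ρ * Real.log ρ * Real.sqrt n)) := by
      rw [Real.rpow_def_of_pos (by linarith)]
      congr 1; rw [hD]; ring
    rw [e2]
    refine (mul_le_mul_of_nonneg_right e1 (Real.exp_pos _).le).trans ?_
    rw [← Real.exp_add]
    refine le_of_eq ?_
    congr 1; ring
  calc _ ≤ gibbsSum (fun _ _ _ => False) H p (fun X => ∑ f ∈ H,
        if D < (incidentPairs f ∩ X).card then 1 else 0) := by
        refine gibbsSum_mono h0 h1 fun X _ => ?_
        unfold hasLargeDegree
        split_ifs with h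
        · obtain ⟨f, hf, hfD⟩ := h
          refine le_trans ?_ (Finset.single_le_sum (fun i _ => ?_) hf)
          · rw [if_pos hfD]
          · split_ifs <;> norm_num
        · exact Finset.sum_nonneg fun i _ => by split_ifs <;> norm_num
    _ ≤ ∑ f ∈ H, Real.exp (-(2 * c * (ρ * Real.log ρ - (ρ - 1)) * Real.sqrt n)) := by
        rw [gibbsSum_sum]
        refine Finset.sum_le_sum fun f _ => le_trans ?_ tail
        exact gibbsSum_false_tail h0 h1 hρ _ (card_incidentPairs_le f)
    _ ≤ _ := by
        rw [Finset.sum_const, nsmul_eq_mul]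
        exact mul_le_mul_of_nonneg_right (by exact_mod_cast card_pairs_le H) (Real.exp_pos _).le

theorem exists_pow_mul_exp_le {a η : ℝ} (ha : 0 < a) (hη : 0 < η) :
    ∃ n₀ : ℕ, ∀ n : ℕ, n₀ ≤ n → (n : ℝ) ^ 4 * Real.exp (-(a * Real.sqrt n)) ≤ η := by
  have h1 : Filter.Tendsto (fun n : ℕ => a * Real.sqrt n) Filter.atTop Filter.atTop :=
    Filter.Tendsto.const_mul_atTop ha
      (Real.tendsto_sqrt_atTop.comp tendsto_natCast_atTop_atTop)
  have h2 := (Real.tendsto_pow_mul_exp_neg_atTop_nhds_zero 8).comp h1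
  have h3 := (h2.eventually (ge_mem_nhds (show 0 < η * a ^ 8 by positivity)))
  obtain ⟨n₀, h⟩ := Filter.eventually_atTop.1 h3
  refine ⟨n₀, fun n hn => ?_⟩
  have h4 := h n hn
  have h5 : Real.sqrt n ^ 8 = (n : ℝ) ^ 4 := by
    rw [show 8 = 2 * 4 from rfl, pow_mul, Real.sq_sqrt (by positivity)]
  simp only [Function.comp, mul_pow, h5] at h4
  have : 0 < a ^ 8 := by positivity
  nlinarith

theorem exists_mul_exp_neg_mul_log_le {γ : ℝ} (hγ : 0 < γ) :
    ∃ K : ℕ, ∀ n : ℕ, 2 ≤ n → ∀ α : ℝ, 1 / (n : ℝ) ^ 2 ≤ α → γ * α ≤ 1 → γ ≤ 1 → ∀ t : ℕ,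
      K * (n : ℝ) ^ 2 * Real.log n ≤ t →
        (n : ℝ) ^ 2 * (1 + 4 * t) * (1 - γ * α) ^ t ≤ 1 / 16 := by
  set κ := Real.log (144 / γ) / Real.log 2
  obtain ⟨K, hK⟩ := exists_nat_ge (2 * (4 + κ) / γ)
  refine ⟨K, fun n hn α hα hγα hγ1 t ht => ?_⟩
  have hn0 : (0 : ℝ) < n := by positivity
  have hn1 : (1 : ℝ) ≤ n := by exact_mod_cast (by omega : 1 ≤ n)
  have hl2 : 0 < Real.log 2 := Real.log_pos (by norm_num)
  have hln : Real.log 2 ≤ Real.log n :=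
    Real.log_le_log (by norm_num) (by exact_mod_cast hn)
  have hκ : 0 ≤ κ := div_nonneg (Real.log_nonneg (by rw [le_div_iff₀ hγ]; linarith)) hl2.le
  set u := γ * t / (n : ℝ) ^ 2 with hu
  have hu0 : 0 ≤ u := by positivity
  have h1 : (1 - γ * α) ^ t ≤ Real.exp (-u) := by
    refine (pow_le_pow_left₀ (by linarith) (Real.one_sub_le_exp_neg _) t).trans ?_
    rw [← Real.exp_nat_mul]
    refine Real.exp_le_exp.2 ?_
    have : γ * t * (1 / (n : ℝ) ^ 2) ≤ γ * t * α := mul_le_mul_of_nonneg_left hα (by positivity)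
    rw [hu, div_eq_mul_one_div]
    linarith
  have h2 : 1 + 4 * (t : ℝ) ≤ 9 * (n : ℝ) ^ 2 / γ * Real.exp (u / 2) := by
    have e1 : 1 ≤ Real.exp (u / 2) := Real.one_le_exp (by positivity)
    have e2 : u / 2 ≤ Real.exp (u / 2) := by linarith [Real.add_one_le_exp (u / 2)]
    have e3 : (t : ℝ) = (n : ℝ) ^ 2 / γ * u := by rw [hu]; field_simp
    have e4 : 1 ≤ (n : ℝ) ^ 2 / γ := by
      rw [le_div_iff₀ hγ]; nlinarith
    have e5 := mul_le_mul_of_nonneg_left e2 (by linarith : 0 ≤ (n : ℝ) ^ 2 / γ)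
    have e6 := mul_le_mul e4 e1 (by norm_num) (by linarith)
    rw [show 9 * (n : ℝ) ^ 2 / γ = 9 * ((n : ℝ) ^ 2 / γ) by ring]
    generalize (n : ℝ) ^ 2 / γ = m at *
    rw [e3]
    linarith
  have h3 : (4 + κ) * Real.log n ≤ u / 2 := by
    have e1 : 2 * (4 + κ) ≤ K * γ := by rwa [div_le_iff₀ hγ] at hK
    have e2 : K * Real.log n ≤ t / (n : ℝ) ^ 2 := by
      rw [le_div_iff₀ (by positivity)]; linarith
    have e3 := mul_le_mul_of_nonneg_left e2 hγ.le
    have e4 := mul_le_mul_of_nonneg_right e1 (hl2.le.trans hln)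
    rw [hu, mul_div_assoc]
    linarith
  have h4 : Real.exp (-(u / 2)) ≤ γ / 144 / (n : ℝ) ^ 4 := by
    have e1 : κ * Real.log 2 = Real.log (144 / γ) := div_mul_cancel₀ _ hl2.ne'
    have e2 : Real.log (144 / γ) + 4 * Real.log n ≤ u / 2 := by
      have := mul_le_mul_of_nonneg_left hln hκ
      linarith
    calc Real.exp (-(u / 2)) ≤ Real.exp (-(Real.log (144 / γ) + 4 * Real.log n)) :=
          Real.exp_le_exp.2 (by linarith)
      _ = _ := by
          rw [Real.exp_neg, Real.exp_add, Real.exp_log (by positivity),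
            show (4 : ℝ) * Real.log n = ((4 : ℕ) : ℝ) * Real.log n by norm_num, Real.exp_nat_mul,
            Real.exp_log hn0]
          field_simp
  have h5 : Real.exp (u / 2) * Real.exp (-u) = Real.exp (-(u / 2)) := by
    rw [← Real.exp_add]; congr 1; ring
  calc (n : ℝ) ^ 2 * (1 + 4 * t) * (1 - γ * α) ^ t
      ≤ (n : ℝ) ^ 2 * (9 * (n : ℝ) ^ 2 / γ * Real.exp (u / 2)) * Real.exp (-u) := by
        refine mul_le_mul ?_ h1 (pow_nonneg (by linarith) _) (by positivity)
        exact mul_le_mul_of_nonneg_left h2 (by positivity)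
    _ = 9 * (n : ℝ) ^ 4 / γ * Real.exp (-(u / 2)) := by rw [← h5]; ring
    _ ≤ 9 * (n : ℝ) ^ 4 / γ * (γ / 144 / (n : ℝ) ^ 4) :=
        mul_le_mul_of_nonneg_left h4 (by positivity)
    _ = 1 / 16 := by field_simp; norm_num

/-- For large `n` a step of the coupling contracts the distance by the factor `1 - γ α` on average,
where `γ = 1 - 2 c² ρ` is positive and `ρ > 1` leaves room for the fluctuations of the degrees. -/
theorem exists_coalescence_of_large {c : ℝ} (hc2 : 1 / 2 ≤ c) (hc : 2 * c ^ 2 < 1) :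
    ∃ K n₀ : ℕ, ∀ n : ℕ, 2 ≤ n → n₀ ≤ n → ∀ (p α : ℝ) (H : Finset (Sym2 (Fin n))), IsRate H α p →
      p ≤ c / Real.sqrt n → 1 / (n : ℝ) ^ 2 ≤ α → α ≤ 1 → ∀ t : ℕ,
      K * (n : ℝ) ^ 2 * Real.log n ≤ t → ∀ X ⊆ H, ∀ Y ⊆ H,
      (avg H α p (coupled IsTriangle) ^ t) differ (X, Y) ≤ 1 / 8 := by
  classical
  set γ := (1 - 2 * c ^ 2) / 2 with hγ
  set ρ := (1 + 2 * c ^ 2) / (4 * c ^ 2) with hρ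
  have hc0 : 0 < c := by linarith
  have hγ0 : 0 < γ := by rw [hγ]; linarith
  have hγ1 : γ ≤ 1 / 2 := by rw [hγ]; nlinarith
  have hρ1 : 1 < ρ := by rw [hρ, lt_div_iff₀ (by positivity)]; nlinarith
  have ha : 0 < 2 * c * (ρ * Real.log ρ - (ρ - 1)) := by
    have h1 := Real.log_lt_sub_one_of_pos (x := ρ⁻¹) (by positivity) (inv_ne_one.2 hρ1.ne')
    rw [Real.log_inv] at h1
    have h2 := mul_lt_mul_of_pos_left h1 (by linarith : 0 < ρ)
    rw [mul_sub, mul_inv_cancel₀ (by linarith)] at h2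
    have : 0 < ρ * Real.log ρ - (ρ - 1) := by linarith
    positivity
  obtain ⟨K, hK⟩ := exists_mul_exp_neg_mul_log_le hγ0
  obtain ⟨n₀, hn₀⟩ := exists_pow_mul_exp_le ha (show 0 < γ / 16 by positivity)
  refine ⟨K, n₀, fun n hn hnn p α H hr hp hα hα1 t ht X hX Y hY => ?_⟩
  have hn0 : (0 : ℝ) < n := by positivity
  have hs : 0 < Real.sqrt n := Real.sqrt_pos.2 hn0
  have hα0 : 0 < α := lt_of_lt_of_le (by positivity) hα
  have hpD : p * (2 * c * ρ * Real.sqrt n) ≤ 1 - γ := by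
    have h1 : p * Real.sqrt n ≤ c := (le_div_iff₀ hs).1 hp
    have h2 := mul_le_mul_of_nonneg_left h1 (by positivity : 0 ≤ 2 * c * ρ)
    have h3 : 2 * c * ρ * c = 1 - γ := by rw [hρ, hγ]; field_simp; ring
    linarith
  have main := avg_pow_hamming_le isTripleSystem_isTriangle
    (fun {e f g} h => mem_incidentPairs_of_isTriangle h) hr hpD hγ0 hγ1 hα0 hα1
    (gibbsSum_hasLargeDegree_le hρ1 (by omega) H hr.p0 hr.p1 hp) t hX hY
  have h1 := hK n hn α hα (by nlinarith) (by linarith) t ht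
  have h2 : (H.card : ℝ) * (1 + 4 * t) * (1 - γ * α) ^ t
      ≤ (n : ℝ) ^ 2 * (1 + 4 * t) * (1 - γ * α) ^ t := by
    refine mul_le_mul_of_nonneg_right (mul_le_mul_of_nonneg_right ?_ (by positivity))
      (pow_nonneg (by nlinarith) _)
    exact_mod_cast card_pairs_le H
  have h3 : (n : ℝ) ^ 2 * Real.exp (-(2 * c * (ρ * Real.log ρ - (ρ - 1)) * Real.sqrt n)) / (γ * α)
      ≤ 1 / 16 := by
    rw [div_le_iff₀ (by positivity)]
    have h4 := hn₀ n hnn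
    have h5 : 1 ≤ α * (n : ℝ) ^ 2 := by rwa [div_le_iff₀ (by positivity)] at hα
    set x := Real.exp (-(2 * c * (ρ * Real.log ρ - (ρ - 1)) * Real.sqrt n))
    have h6 : (n : ℝ) ^ 2 * x ≤ (n : ℝ) ^ 2 * x * (α * (n : ℝ) ^ 2) :=
      le_mul_of_one_le_right (by positivity) h5
    have h7 := mul_le_mul_of_nonneg_left h4 hα0.le
    nlinarith
  have h8 := avg_pow_mono hr (act := coupled IsTriangle) t differ_le_hamming (X, Y)
  linarith

/-- For a fixed number of vertices the chains meet in the empty graph, since all pairs may be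
vacated one after another; this covers the small `n`. -/
theorem exists_coalescence_of_fixed {c : ℝ} (hc0 : 0 ≤ c) (hc : c < 1) (n : ℕ) (hn : 1 ≤ n) :
    ∃ t₀ : ℕ, ∀ (p α : ℝ) (H : Finset (Sym2 (Fin n))), IsRate H α p →
      p ≤ c → 1 / (n : ℝ) ^ 2 ≤ α → α ≤ 1 → ∀ t : ℕ, t₀ ≤ t → ∀ X ⊆ H, ∀ Y ⊆ H,
      (avg H α p (coupled IsTriangle) ^ t) differ (X, Y) ≤ 1 / 8 := by
  have hn0 : (0 : ℝ) < n := by positivity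
  have hn1 : (1 : ℝ) ≤ (n : ℝ) ^ 2 := one_le_pow₀ (by exact_mod_cast hn)
  set β := (1 / (n : ℝ) ^ 2 * (1 - c)) with hβ
  have hβ0 : 0 < β := mul_pos (by positivity) (by linarith)
  have hβ1 : β ≤ 1 := by
    refine mul_le_one₀ ?_ (by linarith) (by linarith)
    rw [div_le_iff₀ (by positivity)]; linarith
  have hβn : 0 < β ^ (n ^ 2) := by positivity
  have hβn1 : β ^ (n ^ 2) ≤ 1 := pow_le_one₀ hβ0.le hβ1
  obtain ⟨l, hl⟩ := exists_pow_lt_of_lt_one (show (0 : ℝ) < 1 / 8 by norm_num)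
    (show 1 - β ^ (n ^ 2) < 1 by linarith)
  refine ⟨n ^ 2 * l, fun p α H hr hp hα hα1 t ht X hX Y hY => ?_⟩
  have hβle : β ≤ α * (1 - p) := mul_le_mul hα (by linarith) (by linarith) hr.a0
  have hone : ∀ X ⊆ H, ∀ Y ⊆ H,
      (avg H α p (coupled IsTriangle) ^ H.card) differ (X, Y) ≤ 1 - β ^ (n ^ 2) := by
    intro X hX Y hY
    refine (avg_pow_card_differ_le hr subset_rfl hX hY).trans ?_
    have h1 : β ^ (n ^ 2) ≤ β ^ H.card := pow_le_pow_of_le_one hβ0.le hβ1 (card_pairs_le H)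
    have h2 : β ^ H.card ≤ (α * (1 - p)) ^ H.card := pow_le_pow_left₀ hβ0.le hβle _
    linarith
  have h1 := avg_pow_differ_mul_le hr (by linarith) hone l hX hY
  have h2 := avg_pow_differ_antitone (T := IsTriangle) hr
    ((Nat.mul_le_mul_right l (card_pairs_le H)).trans ht) hX hY
  linarith

/-- The two coupled chains have met with probability at least `7/8` after `K n² log n` steps,
uniformly in the set `H` of potential edges and in the rate `α ≥ 1/n²`. -/
theorem exists_coalescence {c : ℝ} (hc : c < 1 / Real.sqrt 2) :
    ∃ K : ℕ, ∀ n : ℕ, 2 ≤ n → ∀ (p α : ℝ) (H : Finset (Sym2 (Fin n))), IsRate H α p →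
      p ≤ c / Real.sqrt n → 1 / (n : ℝ) ^ 2 ≤ α → α ≤ 1 → ∀ t : ℕ,
      K * (n : ℝ) ^ 2 * Real.log n ≤ t → ∀ X ⊆ H, ∀ Y ⊆ H,
      (avg H α p (coupled IsTriangle) ^ t) differ (X, Y) ≤ 1 / 8 := by
  -- enlarging `c`, we may assume `1/2 ≤ c`
  wlog hc2 : 1 / 2 ≤ c generalizing c
  · have h2 : (1 : ℝ) / 2 < 1 / Real.sqrt 2 := by
      have h3 : Real.sqrt 2 < 2 := by
        rw [Real.sqrt_lt' (by norm_num)]; norm_num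
      exact one_div_lt_one_div_of_lt (by positivity) h3
    obtain ⟨K, hK⟩ := this h2 le_rfl
    refine ⟨K, fun n hn p α H hr hp => hK n hn p α H hr (hp.trans ?_)⟩
    exact div_le_div_of_nonneg_right (by linarith) (Real.sqrt_nonneg _)
  have hs2 : Real.sqrt 2 ^ 2 = 2 := Real.sq_sqrt (by norm_num)
  have hcs : c * Real.sqrt 2 < 1 := (lt_div_iff₀ (by positivity)).1 hc
  have hcc : 2 * c ^ 2 < 1 := by
    have h1 : 0 ≤ c * Real.sqrt 2 := by positivity
    have : (c * Real.sqrt 2) ^ 2 < 1 := by nlinarith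
    rw [mul_pow, hs2] at this; linarith
  have hc1 : c < 1 := by nlinarith
  obtain ⟨K, n₀, hK⟩ := exists_coalescence_of_large hc2 hcc
  have hfix : ∀ n : ℕ, ∃ t₀ : ℕ, 1 ≤ n → ∀ (p α : ℝ) (H : Finset (Sym2 (Fin n))), IsRate H α p →
      p ≤ c → 1 / (n : ℝ) ^ 2 ≤ α → α ≤ 1 → ∀ t : ℕ, t₀ ≤ t → ∀ X ⊆ H, ∀ Y ⊆ H,
      (avg H α p (coupled IsTriangle) ^ t) differ (X, Y) ≤ 1 / 8 := by
    intro n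
    by_cases hn : 1 ≤ n
    · obtain ⟨t₀, h⟩ := exists_coalescence_of_fixed (by linarith) hc1 n hn
      exact ⟨t₀, fun _ => h⟩
    · exact ⟨0, fun h => absurd h hn⟩
  choose t₀ ht₀ using hfix
  refine ⟨K + ∑ n ∈ Finset.range n₀, t₀ n, fun n hn p α H hr hp hα hα1 t ht => ?_⟩
  have hl : 1 / 2 ≤ Real.log n := by
    have h1 : Real.log 2 ≤ Real.log n := Real.log_le_log (by norm_num) (by exact_mod_cast hn)
    have := Real.log_two_gt_d9
    linarith
  have hn4 : (4 : ℝ) ≤ (n : ℝ) ^ 2 := by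
    have : (2 : ℝ) ≤ n := by exact_mod_cast hn
    nlinarith
  push_cast at ht
  -- for `n < n₀` the sum of the `t₀ n` over `n < n₀`, multiplied by `n² log n ≥ 1`, is enough
  by_cases hnn : n₀ ≤ n
  · refine hK n hn hnn p α H hr hp hα hα1 t (le_trans ?_ ht)
    have : (0 : ℝ) ≤ ∑ n ∈ Finset.range n₀, (t₀ n : ℝ) := by positivity
    refine mul_le_mul_of_nonneg_right (mul_le_mul_of_nonneg_right ?_ (by positivity)) (by linarith)
    linarith
  · refine ht₀ n (by omega) p α H hr (hp.trans ?_) hα hα1 t ?_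
    · refine div_le_self (by linarith) ?_
      rw [Real.one_le_sqrt]
      exact_mod_cast (by omega : 1 ≤ n)
    · have h1 : (t₀ n : ℝ) ≤ ∑ n ∈ Finset.range n₀, (t₀ n : ℝ) :=
        Finset.single_le_sum (f := fun n => (t₀ n : ℝ)) (fun i _ => by positivity)
          (Finset.mem_range.2 (by omega))
      have h2 : (0 : ℝ) ≤ K := by positivity
      set S := ∑ n ∈ Finset.range n₀, (t₀ n : ℝ)
      have h0 : (0 : ℝ) ≤ t₀ n := by positivity
      have h3 : (2 : ℝ) ≤ (n : ℝ) ^ 2 * Real.log n := by nlinarith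
      have h4 : (K + S) * 2 ≤ (K + S) * ((n : ℝ) ^ 2 * Real.log n) :=
        mul_le_mul_of_nonneg_left h3 (by linarith)
      have : (t₀ n : ℝ) ≤ t := by linarith
      exact_mod_cast this

/-! ### Graphs as sets of pairs -/

section Graphs

/-- The edge set of a graph, as a finset. -/
noncomputable def edges {n : ℕ} (G : SimpleGraph (Fin n)) : Finset (Sym2 (Fin n)) :=
  (Set.toFinite G.edgeSet).toFinset

/-- The set of all potential edges. -/
noncomputable def allPairs (n : ℕ) : Finset (Sym2 (Fin n)) := edges ⊤

variable {n : ℕ}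

@[simp] theorem mem_edges {G : SimpleGraph (Fin n)} {e : Sym2 (Fin n)} :
    e ∈ edges G ↔ e ∈ G.edgeSet := by simp [edges]

theorem mem_allPairs {e : Sym2 (Fin n)} : e ∈ allPairs n ↔ ¬ e.IsDiag := by
  simp [allPairs]

theorem edges_subset (G : SimpleGraph (Fin n)) : edges G ⊆ allPairs n := fun _ he =>
  mem_allPairs.2 (G.not_isDiag_of_mem_edgeSet (mem_edges.1 he))

theorem edgeFinset_top_eq : (⊤ : SimpleGraph (Fin n)).edgeFinset = allPairs n := by
  ext e; rw [mem_allPairs]; simp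

theorem card_allPairs : (allPairs n).card = n.choose 2 := by
  rw [← edgeFinset_top_eq, SimpleGraph.card_edgeFinset_top_eq_card_choose_two, Fintype.card_fin]

theorem fromEdgeSet_edges (G : SimpleGraph (Fin n)) :
    SimpleGraph.fromEdgeSet (edges G : Set (Sym2 (Fin n))) = G := by
  have : (edges G : Set (Sym2 (Fin n))) = G.edgeSet := by ext; simp
  rw [this, SimpleGraph.fromEdgeSet_edgeSet]

theorem edges_fromEdgeSet {X : Finset (Sym2 (Fin n))} (hX : X ⊆ allPairs n) :
    edges (SimpleGraph.fromEdgeSet (X : Set (Sym2 (Fin n)))) = X := by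
  ext e
  have : e ∈ X → ¬ e.IsDiag := fun h => mem_allPairs.1 (hX h)
  simpa using this

theorem edges_injective : Function.Injective (edges (n := n)) := fun G H h => by
  rw [← fromEdgeSet_edges G, h, fromEdgeSet_edges]

theorem cliqueFree_iff_isIndep {G : SimpleGraph (Fin n)} :
    G.CliqueFree 3 ↔ IsIndep IsTriangle (edges G) := by
  constructor
  · rintro h e he f hf g hg ⟨a, b, c, -, -, -, rfl, rfl, rfl⟩
    simp only [mem_edges, SimpleGraph.mem_edgeSet] at he hf hg
    exact h {a, b, c} (SimpleGraph.is3Clique_triple_iff.2 ⟨he, hf, hg⟩)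
  · intro h s hs
    obtain ⟨a, b, c, hab, hac, hbc, rfl⟩ := SimpleGraph.is3Clique_iff.1 hs
    exact h s(a, b) (by simpa) s(a, c) (by simpa) s(b, c) (by simpa)
      ⟨a, b, c, hab.ne, hac.ne, hbc.ne, rfl, rfl, rfl⟩

theorem edges_deleteEdges (G : SimpleGraph (Fin n)) (e : Sym2 (Fin n)) :
    edges (G.deleteEdges {e}) = (edges G).erase e := by
  ext x; simp [SimpleGraph.edgeSet_deleteEdges, and_comm]

theorem edges_sup (G : SimpleGraph (Fin n)) {e : Sym2 (Fin n)} (he : ¬ e.IsDiag) :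
    edges (G ⊔ SimpleGraph.fromEdgeSet {e}) = insert e (edges G) := by
  ext x
  simp only [mem_edges, SimpleGraph.edgeSet_sup, SimpleGraph.edgeSet_fromEdgeSet, Set.mem_union,
    Set.mem_sdiff, Set.mem_singleton_iff, Finset.mem_insert]
  constructor
  · rintro (h | h)
    · exact Or.inr h
    · exact Or.inl h.1
  · rintro (rfl | h)
    · exact Or.inr ⟨rfl, he⟩
    · exact Or.inl h

theorem edges_tryInclude {G : SimpleGraph (Fin n)} (hG : G ∈ triangleFree n) {e : Sym2 (Fin n)}
    (he : ¬ e.IsDiag) : edges (tryInclude G e) = upd IsTriangle e true (edges G) := by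
  have hG' := cliqueFree_iff_isIndep.1 hG
  have hiff : (G ⊔ SimpleGraph.fromEdgeSet {e}).CliqueFree 3 ↔ IsFree IsTriangle e (edges G) := by
    rw [cliqueFree_iff_isIndep, edges_sup G he, isIndep_insert isTripleSystem_isTriangle]
    tauto
  unfold tryInclude
  split_ifs with h
  · rw [upd_true_of_free (hiff.1 h), edges_sup G he]
  · rw [upd_true_of_not_free (fun h' => h (hiff.2 h')), edges_deleteEdges]

theorem tryInclude_mem {G : SimpleGraph (Fin n)} (hG : G ∈ triangleFree n) {e : Sym2 (Fin n)}
    (he : ¬ e.IsDiag) : tryInclude G e ∈ triangleFree n := by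
  refine cliqueFree_iff_isIndep.2 ?_
  rw [edges_tryInclude hG he]
  exact (cliqueFree_iff_isIndep.1 hG).upd isTripleSystem_isTriangle

theorem deleteEdges_mem {G : SimpleGraph (Fin n)} (hG : G ∈ triangleFree n) (e : Sym2 (Fin n)) :
    G.deleteEdges {e} ∈ triangleFree n :=
  SimpleGraph.CliqueFree.anti (SimpleGraph.deleteEdges_le _) hG

/-- The Gibbs sum over all pairs is the sum over triangle-free graphs. -/
theorem gibbsSum_eq_sum_triangleFree (p : ℝ) (f : Finset (Sym2 (Fin n)) → ℝ) :
    gibbsSum IsTriangle (allPairs n) p f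
      = ∑ G : triangleFree n, bernoulliWeight (allPairs n) p (edges G.1) * f (edges G.1) := by
  classical
  unfold gibbsSum
  rw [← Finset.sum_filter]
  symm
  refine Finset.sum_bij (fun G _ => edges G.1) ?_ ?_ ?_ ?_
  · exact fun G _ => Finset.mem_filter.2 ⟨Finset.mem_powerset.2 (edges_subset _),
      cliqueFree_iff_isIndep.1 G.2⟩
  · exact fun G _ H _ h => Subtype.ext (edges_injective h)
  · intro X hX
    obtain ⟨h1, h2⟩ := Finset.mem_filter.1 hX
    have h3 := edges_fromEdgeSet (Finset.mem_powerset.1 h1)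
    refine ⟨⟨SimpleGraph.fromEdgeSet (X : Set (Sym2 (Fin n))), ?_⟩, Finset.mem_univ _, h3⟩
    exact cliqueFree_iff_isIndep.2 (h3.symm ▸ h2)
  · exact fun _ _ => rfl

theorem measurableSet_graphs (S : Set (SimpleGraph (Fin n))) : MeasurableSet S :=
  (SimpleGraph.measurableEmbedding_edgeSet.measurableSet_image).1
    (Set.toFinite (SimpleGraph.edgeSet '' S)).measurableSet

theorem binomialRandom_real_singleton (p : unitInterval) (G : SimpleGraph (Fin n)) :
    (SimpleGraph.binomialRandom (Fin n) p).real {G} = bernoulliWeight (allPairs n) p (edges G) := by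
  have h1 : G.edgeSet.ncard = (edges G).card := by
    rw [← Set.ncard_coe_finset]; congr 1; ext; simp
  rw [bernoulliWeight, Finset.card_sdiff_of_subset (edges_subset G), card_allPairs]
  simp [Measure.real, SimpleGraph.binomialRandom_singleton, h1]

theorem probTriangleFree_eq (p : unitInterval) :
    probTriangleFree n p = gibbsSum IsTriangle (allPairs n) p (fun _ => 1) := by
  classical
  rw [gibbsSum_eq_sum_triangleFree, probTriangleFree]
  have h1 : (triangleFree n) = ((Finset.univ : Finset (triangleFree n)).image Subtype.val :
      Finset (SimpleGraph (Fin n))) := by ext; simp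
  have : MeasurableSingletonClass (SimpleGraph (Fin n)) := ⟨fun _ => measurableSet_graphs _⟩
  have h2 := congrArg (SimpleGraph.binomialRandom (Fin n) p).real h1
  rw [← sum_measureReal_singleton] at h2
  rw [h2, Finset.sum_image (fun a _ b _ h => Subtype.ext h)]
  exact Finset.sum_congr rfl fun G _ => by rw [binomialRandom_real_singleton, mul_one]

theorem condTriangleFree_eq (p : unitInterval) (G : triangleFree n) :
    condTriangleFree n p G = (gibbsSum IsTriangle (allPairs n) p (fun _ => 1))⁻¹
      * bernoulliWeight (allPairs n) p (edges G.1) := by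
  have h1 : triangleFree n ∩ {G.1} = {G.1} := by
    ext H; simp only [Set.mem_inter_iff, Set.mem_singleton_iff]
    exact ⟨fun h => h.2, fun h => ⟨h ▸ G.2, h⟩⟩
  rw [← probTriangleFree_eq, ← binomialRandom_real_singleton, condTriangleFree, probTriangleFree]
  simp only [Measure.real, ProbabilityTheory.cond_apply (measurableSet_graphs _), h1,
    ENNReal.toReal_mul, ENNReal.toReal_inv]

theorem gibbsSum_one_pos {H : Finset (Sym2 (Fin n))} {p : ℝ} (h0 : 0 ≤ p) (h1 : p < 1) :
    0 < gibbsSum IsTriangle H p (fun _ => 1) := by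
  classical
  have h2 : bernoulliWeight H p ∅ * 1 ≤ gibbsSum IsTriangle H p (fun _ => 1) := by
    unfold gibbsSum
    have := Finset.single_le_sum (f := fun X => if IsIndep IsTriangle X then
      bernoulliWeight H p X * (1 : ℝ) else 0) (s := H.powerset) (fun X _ => ?_)
      (Finset.empty_mem_powerset H)
    · rwa [if_pos (show IsIndep IsTriangle (∅ : Finset (Sym2 (Fin n))) from fun e he => by simp at he)]
        at this
    · split_ifs
      · simpa using bernoulliWeight_nonneg h0 h1.le X
      · exact le_rfl
  refine lt_of_lt_of_le ?_ h2
  simp only [bernoulliWeight, Finset.card_empty, pow_zero, one_mul, mul_one]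
  exact pow_pos (by linarith) _

theorem tvDist_le {Ω : Type*} [Fintype Ω] {μ ν : Ω → ℝ} {δ : ℝ}
    (h : ∀ f : Ω → ℝ, (∀ x, |f x| ≤ 1) → ∑ x, μ x * f x - ∑ x, ν x * f x ≤ 2 * δ) :
    tvDist μ ν ≤ δ := by
  have h1 := h (fun x => SignType.sign (μ x - ν x)) (fun x => by
    rcases lt_trichotomy (μ x - ν x) 0 with h | h | h
    · simp [sign_neg h]
    · simp [h]
    · simp [sign_pos h])
  have h2 : ∑ x, |μ x - ν x| = ∑ x, μ x * (SignType.sign (μ x - ν x) : ℝ)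
      - ∑ x, ν x * (SignType.sign (μ x - ν x) : ℝ) := by
    rw [← Finset.sum_sub_distrib]
    refine Finset.sum_congr rfl fun x _ => ?_
    rw [← sub_mul, mul_comm, sign_mul_self]
  unfold tvDist
  linarith

open Classical in
/-- The extension by zero to all sets of pairs of a function on triangle-free graphs. -/
noncomputable def extendGraphs (f : triangleFree n → ℝ) (X : Finset (Sym2 (Fin n))) : ℝ :=
  if h : SimpleGraph.fromEdgeSet (X : Set (Sym2 (Fin n))) ∈ triangleFree n then f ⟨_, h⟩ else 0

theorem extendGraphs_edges (f : triangleFree n → ℝ) (G : triangleFree n) :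
    extendGraphs f (edges G.1) = f G := by
  unfold extendGraphs
  have h : SimpleGraph.fromEdgeSet (edges G.1 : Set (Sym2 (Fin n))) ∈ triangleFree n := by
    rw [fromEdgeSet_edges]; exact G.2
  rw [dif_pos h]
  exact congrArg f (Subtype.ext (fromEdgeSet_edges _))

theorem abs_extendGraphs_le {f : triangleFree n → ℝ} (hf : ∀ G, |f G| ≤ 1)
    (X : Finset (Sym2 (Fin n))) : |extendGraphs f X| ≤ 1 := by
  unfold extendGraphs
  split_ifs
  · exact hf _
  · simp

theorem sum_condTriangleFree_mul (p : unitInterval) (f : triangleFree n → ℝ) :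
    ∑ G, condTriangleFree n p G * f G = (gibbsSum IsTriangle (allPairs n) p (fun _ => 1))⁻¹
      * gibbsSum IsTriangle (allPairs n) p (extendGraphs f) := by
  rw [gibbsSum_eq_sum_triangleFree p (extendGraphs f), Finset.mul_sum]
  exact Finset.sum_congr rfl fun G _ => by rw [condTriangleFree_eq, extendGraphs_edges, mul_assoc]

/-! ### Mixing of the Glauber dynamics -/

theorem sum_glauber_mul (hn : 2 ≤ n) (p : unitInterval) (f : Finset (Sym2 (Fin n)) → ℝ)
    (G : triangleFree n) :
    ∑ H, glauber n p G H * f (edges H.1)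
      = avg (allPairs n) (1 / (n.choose 2 : ℝ)) p (upd IsTriangle) f (edges G.1) := by
  classical
  have hN : (0 : ℝ) < n.choose 2 := by exact_mod_cast Nat.choose_pos hn
  have h1 : ∀ e ∈ allPairs n, ∑ H : triangleFree n, resample p e G.1 H.1 * f (edges H.1)
      = p * f (upd IsTriangle e true (edges G.1)) + (1 - p) * f (upd IsTriangle e false (edges G.1)) := by
    intro e he
    have he' := mem_allPairs.1 he
    have h2 : ∀ (K : triangleFree n) (x : ℝ), ∑ H : triangleFree n,
        x * (if H.1 = K.1 then (1 : ℝ) else 0) * f (edges H.1) = x * f (edges K.1) := by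
      intro K x
      rw [Finset.sum_eq_single K]
      · simp
      · intro H _ hH
        rw [if_neg (fun h => hH (Subtype.ext h))]; ring
      · simp
    simp only [resample, add_mul]
    rw [Finset.sum_add_distrib, h2 ⟨_, tryInclude_mem G.2 he'⟩, h2 ⟨_, deleteEdges_mem G.2 e⟩]
    simp only [edges_tryInclude G.2 he', edges_deleteEdges, upd_false]
  simp only [glauber, Matrix.of_apply, edgeFinset_top_eq, avg_apply, card_allPairs]
  rw [one_div_mul_cancel hN.ne', sub_self, zero_mul, add_zero, ← Finset.mul_sum,
    ← Finset.sum_congr rfl h1, Finset.sum_comm, Finset.mul_sum]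
  refine Finset.sum_congr rfl fun H _ => ?_
  rw [← Finset.sum_mul]; ring

theorem sum_glauber_pow_mul (hn : 2 ≤ n) (p : unitInterval) (t : ℕ)
    (f : Finset (Sym2 (Fin n)) → ℝ) (G : triangleFree n) :
    ∑ H, (glauber n p ^ t) G H * f (edges H.1)
      = (avg (allPairs n) (1 / (n.choose 2 : ℝ)) p (upd IsTriangle) ^ t) f (edges G.1) := by
  induction t generalizing G with
  | zero =>
    simp only [pow_zero, Matrix.one_apply, Module.End.one_apply]
    simp
  | succ t ih =>
    rw [pow_succ' (avg _ _ _ _), Module.End.mul_apply, ← sum_glauber_mul hn]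
    simp only [← ih, pow_succ', Matrix.mul_apply, Finset.sum_mul, Finset.mul_sum, mul_assoc]
    exact Finset.sum_comm

theorem glauber_mixingTime {c : ℝ} (hc : c < 1 / Real.sqrt 2) :
    ∃ K : ℝ, ∀ n : ℕ, 2 ≤ n → ∀ p : unitInterval, (p : ℝ) ≤ c / Real.sqrt n →
      mixingTime (glauber n p) (condTriangleFree n p)
        ≤ ((⌊K * (n : ℝ) ^ 2 * Real.log n⌋₊ : ℕ) : ℕ∞) := by
  obtain ⟨K, hK⟩ := exists_coalescence hc
  -- rounding up costs at most one step, which is absorbed by enlarging `K`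
  refine ⟨K + 1, fun n hn p hp => iSup_le fun G => ?_⟩
  set t := ⌊((K : ℝ) + 1) * (n : ℝ) ^ 2 * Real.log n⌋₊ with ht
  refine iInf₂_le t ?_
  have hN : (0 : ℝ) < n.choose 2 := by exact_mod_cast Nat.choose_pos hn
  have hn0 : (0 : ℝ) < n := by positivity
  have hn2 : (2 : ℝ) ≤ n := by exact_mod_cast hn
  have hp1 : (p : ℝ) < 1 := by
    have h2 : (1 : ℝ) ≤ Real.sqrt n := by
      rw [Real.one_le_sqrt]; linarith
    have h3 : (p : ℝ) * Real.sqrt n ≤ c := (le_div_iff₀ (by linarith)).1 hp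
    have h4 : 1 / Real.sqrt 2 ≤ 1 := by
      rw [div_le_one (by positivity), Real.one_le_sqrt]; norm_num
    nlinarith [p.2.1]
  have hr : IsRate (allPairs n) (1 / (n.choose 2 : ℝ)) p :=
    ⟨p.2.1, p.2.2, by positivity, by rw [card_allPairs, one_div_mul_cancel hN.ne']⟩
  have hα : 1 / (n : ℝ) ^ 2 ≤ 1 / (n.choose 2 : ℝ) := by
    refine one_div_le_one_div_of_le hN ?_
    have := card_pairs_le (allPairs n)
    rw [card_allPairs] at this
    exact_mod_cast this
  have hα1 : 1 / (n.choose 2 : ℝ) ≤ 1 := by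
    rw [div_le_one hN]; exact_mod_cast Nat.choose_pos hn
  have htK : K * (n : ℝ) ^ 2 * Real.log n ≤ t := by
    have h1 : ((K : ℝ) + 1) * (n : ℝ) ^ 2 * Real.log n < t + 1 := Nat.lt_floor_add_one _
    have h2 : 1 ≤ (n : ℝ) ^ 2 * Real.log n := by
      have h3 : Real.log 2 ≤ Real.log n := Real.log_le_log (by norm_num) hn2
      have := Real.log_two_gt_d9
      nlinarith
    linarith
  have hco := hK n hn p _ (allPairs n) hr hp hα hα1 t htK
  have hZ := gibbsSum_one_pos (H := allPairs n) p.2.1 hp1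
  refine lt_of_le_of_lt (tvDist_le (δ := 1 / 8) fun f hf => ?_) (by norm_num)
  have h1 := abs_avg_pow_sub_gibbsSum_le isTripleSystem_isTriangle hr hco
    (abs_extendGraphs_le hf) (edges_subset G.1)
  rw [← sum_glauber_pow_mul hn] at h1
  simp only [extendGraphs_edges] at h1
  rw [sum_condTriangleFree_mul]
  have h2 := (abs_le.1 h1).2
  set Z := gibbsSum IsTriangle (allPairs n) p (fun _ => 1)
  refine le_of_mul_le_mul_left ?_ hZ
  rw [mul_sub, mul_inv_cancel_left₀ hZ.ne']
  exact h2

end Graphs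

/-! ### Expectations over fair coin tosses -/

section Coins

/-- The coin tosses after the first one. -/
def tail (ω : ℕ → Bool) : ℕ → Bool := fun j => ω (j + 1)

/-- The sequence of coin tosses that starts with `b` and continues with `ω`. -/
def consCoin (b : Bool) (ω : ℕ → Bool) : ℕ → Bool := fun j => Nat.casesOn j b ω

@[simp] theorem tail_consCoin (b : Bool) (ω : ℕ → Bool) : tail (consCoin b ω) = ω := rfl

@[simp] theorem consCoin_zero (b : Bool) (ω : ℕ → Bool) : consCoin b ω 0 = b := rfl

/-- The function `g` of the coin tosses depends only on the first `L` of them. -/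
def DependsOnFirst {α : Type*} (L : ℕ) (g : (ℕ → Bool) → α) : Prop :=
  ∀ ω ω', (∀ i < L, ω i = ω' i) → g ω = g ω'

instance : IsProbabilityMeasure coinLaw := by unfold coinLaw; infer_instance

theorem measurable_consCoin (b : Bool) : Measurable (consCoin b) := by
  refine measurable_pi_lambda _ fun j => ?_
  cases j with
  | zero => exact measurable_const
  | succ j => exact measurable_pi_apply j

/-- The first coin toss is fair and independent of the others. -/
theorem coinLaw_eq : coinLaw = (2⁻¹ : ENNReal) • coinLaw.map (consCoin false)
    + (2⁻¹ : ENNReal) • coinLaw.map (consCoin true) := by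
  symm
  refine Measure.eq_infinitePi _ fun s t ht => ?_
  classical
  -- restricting to the boxes over initial segments of the index set
  set t' : ℕ → Set Bool := fun i => if i ∈ s then t i else Set.univ with ht'
  obtain ⟨N, hN⟩ : ∃ N, ∀ i ∈ s, i < N + 1 :=
    ⟨s.sup id, fun i hi => Nat.lt_succ_of_le (Finset.le_sup (f := id) hi)⟩
  have hset : Set.pi (s : Set ℕ) t = Set.pi (Finset.range (N + 1) : Set ℕ) t' := by
    ext ω
    simp only [Set.mem_pi, Finset.mem_coe, Finset.mem_range, ht']
    constructor
    · intro h i _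
      split_ifs with hi
      · exact h i hi
      · trivial
    · intro h i hi
      have := h i (hN i hi)
      rwa [if_pos hi] at this
  have hm : ∀ i, MeasurableSet (t' i) := fun i => (Set.toFinite _).measurableSet
  have hprod : ∏ i ∈ s, (PMF.uniformOfFintype Bool).toMeasure (t i)
      = ∏ i ∈ Finset.range (N + 1), (PMF.uniformOfFintype Bool).toMeasure (t' i) := by
    have : s ⊆ Finset.range (N + 1) := fun i hi => Finset.mem_range.2 (hN i hi)
    rw [← Finset.prod_subset this]
    · exact Finset.prod_congr rfl fun i hi => by rw [ht']; simp [hi]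
    · intro i _ hi
      simp only [ht', if_neg hi]
      exact measure_univ
  have hpre : ∀ b, coinLaw.map (consCoin b) (Set.pi (Finset.range (N + 1) : Set ℕ) t')
      = (if b ∈ t' 0 then 1 else 0)
        * ∏ i ∈ Finset.range N, (PMF.uniformOfFintype Bool).toMeasure (t' (i + 1)) := by
    intro b
    rw [Measure.map_apply (measurable_consCoin b)
      (MeasurableSet.pi (Finset.countable_toSet _) fun i _ => hm i)]
    have : consCoin b ⁻¹' (Set.pi (Finset.range (N + 1) : Set ℕ) t')
        = if b ∈ t' 0 then Set.pi (Finset.range N : Set ℕ) (fun i => t' (i + 1)) else ∅ := by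
      ext ω
      simp only [Set.mem_preimage, Set.mem_pi, Finset.mem_coe, Finset.mem_range]
      split_ifs with hb
      · simp only [Set.mem_pi, Finset.mem_coe, Finset.mem_range]
        constructor
        · exact fun h i hi => h (i + 1) (by omega)
        · intro h i hi
          cases i with
          | zero => exact hb
          | succ i => exact h i (by omega)
      · simp only [Set.mem_empty_iff_false, iff_false]
        exact fun h => hb (h 0 (by omega))
    rw [this]
    split_ifs with hb
    · rw [coinLaw, Measure.infinitePi_pi _ (fun i _ => hm _), one_mul]
    · simp
  have hfair : (PMF.uniformOfFintype Bool).toMeasure (t' 0)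
      = 2⁻¹ * (if false ∈ t' 0 then 1 else 0) + 2⁻¹ * (if true ∈ t' 0 then 1 else 0) := by
    rw [PMF.toMeasure_apply_fintype]
    simp [Set.indicator, PMF.uniformOfFintype_apply]
    ring
  rw [hset, hprod, Finset.prod_range_succ', hfair]
  simp only [Measure.add_apply, Measure.smul_apply, smul_eq_mul, hpre]
  ring

namespace DependsOnFirst

variable {α β : Type*} {L : ℕ} {g : (ℕ → Bool) → α}

theorem mono {L' : ℕ} (h : DependsOnFirst L g) (hL : L ≤ L') : DependsOnFirst L' g :=
  fun ω ω' hω => h ω ω' fun i hi => hω i (hi.trans_le hL)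

theorem comp (h : DependsOnFirst L g) (φ : α → β) : DependsOnFirst L fun ω => φ (g ω) :=
  fun ω ω' hω => congrArg φ (h ω ω' hω)

theorem const (a : α) : DependsOnFirst L fun _ => a := fun _ _ _ => rfl

theorem tail_iterate_apply (k : ℕ) (ω : ℕ → Bool) (j : ℕ) : tail^[k] ω j = ω (j + k) := by
  induction k generalizing ω with
  | zero => rfl
  | succ k ih => rw [Function.iterate_succ_apply, ih]; exact congrArg ω (by ring)

theorem comp_tail (h : DependsOnFirst L g) (k : ℕ) :
    DependsOnFirst (k + L) fun ω => g (tail^[k] ω) := fun ω ω' hω =>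
  h _ _ fun i hi => by
    rw [tail_iterate_apply, tail_iterate_apply]
    exact hω _ (by omega)

theorem seq {k : ℕ} {h : (ℕ → Bool) → β} {F : β → (ℕ → Bool) → α} (hh : DependsOnFirst k h)
    (hF : ∀ b, DependsOnFirst L (F b)) :
    DependsOnFirst (k + L) fun ω => F (h ω) (tail^[k] ω) := fun ω ω' hω => by
  have h1 : h ω = h ω' := hh ω ω' fun i hi => hω i (by omega)
  simp only [h1]
  exact (hF (h ω')).comp_tail k ω ω' hω

theorem comp_consCoin (h : DependsOnFirst (L + 1) g) (b : Bool) :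
    DependsOnFirst L fun ω => g (consCoin b ω) := fun ω ω' hω =>
  h _ _ fun i hi => by
    cases i with
    | zero => rfl
    | succ i => exact hω i (by omega)

theorem exists_factor (h : DependsOnFirst L g) :
    ∃ φ : (Fin L → Bool) → α, ∀ ω, g ω = φ fun i => ω i :=
  ⟨fun x => g fun j => if hj : j < L then x ⟨j, hj⟩ else false, fun ω => h _ _ fun i hi => by
    simp [hi]⟩

theorem measurable [MeasurableSpace α] (h : DependsOnFirst L g) : Measurable g := by
  obtain ⟨φ, hφ⟩ := h.exists_factor
  have : g = φ ∘ fun ω (i : Fin L) => ω i := funext hφ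
  rw [this]
  exact (measurable_of_finite φ).comp (measurable_pi_lambda _ fun i => measurable_pi_apply _)

theorem integrable {g : (ℕ → Bool) → ℝ} (h : DependsOnFirst L g) : Integrable g coinLaw := by
  obtain ⟨φ, hφ⟩ := h.exists_factor
  refine Integrable.of_bound h.measurable.aestronglyMeasurable (∑ x, ‖φ x‖)
    (Filter.Eventually.of_forall fun ω => ?_)
  rw [hφ]
  exact Finset.single_le_sum (f := fun x => ‖φ x‖) (fun _ _ => norm_nonneg _) (Finset.mem_univ _)

end DependsOnFirst

/-- The expectation of a function of the coin tosses. -/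
noncomputable def coinE (g : (ℕ → Bool) → ℝ) : ℝ := ∫ ω, g ω ∂coinLaw

theorem coinE_const (c : ℝ) : coinE (fun _ => c) = c := by simp [coinE]

variable {L L' : ℕ} {g h : (ℕ → Bool) → ℝ}

theorem coinE_add (hg : DependsOnFirst L g) (hh : DependsOnFirst L' h) :
    coinE (fun ω => g ω + h ω) = coinE g + coinE h :=
  integral_add hg.integrable hh.integrable

theorem coinE_mul (c : ℝ) (g : (ℕ → Bool) → ℝ) : coinE (fun ω => c * g ω) = c * coinE g :=
  integral_const_mul c g

theorem coinE_mono (hg : DependsOnFirst L g) (hh : DependsOnFirst L' h) (hgh : ∀ ω, g ω ≤ h ω) :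
    coinE g ≤ coinE h :=
  integral_mono hg.integrable hh.integrable hgh

theorem coinE_consCoin (hg : DependsOnFirst L g) :
    coinE g = (coinE (fun ω => g (consCoin false ω)) + coinE (fun ω => g (consCoin true ω))) / 2 := by
  have hm : StronglyMeasurable g := hg.measurable.stronglyMeasurable
  have hi : ∀ b, Integrable g (coinLaw.map (consCoin b)) := fun b =>
    (integrable_map_measure hm.aestronglyMeasurable (measurable_consCoin b).aemeasurable).2
      ((hg.mono (Nat.le_succ L)).comp_consCoin b).integrable
  have h2 : (2⁻¹ : ENNReal) ≠ ⊤ := by simp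
  unfold coinE
  conv_lhs => rw [coinLaw_eq]
  rw [integral_add_measure ((hi _).smul_measure h2) ((hi _).smul_measure h2),
    integral_smul_measure, integral_smul_measure,
    integral_map (measurable_consCoin _).aemeasurable hm.aestronglyMeasurable,
    integral_map (measurable_consCoin _).aemeasurable hm.aestronglyMeasurable]
  simp only [ENNReal.toReal_inv, ENNReal.toReal_ofNat, smul_eq_mul]
  ring

/-- The first `k` coin tosses are independent of the later ones. -/
theorem coinE_seq {β : Type*} {k : ℕ} {h : (ℕ → Bool) → β} {F : β → (ℕ → Bool) → ℝ}
    (hh : DependsOnFirst k h) (hF : ∀ b, DependsOnFirst L (F b)) :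
    coinE (fun ω => F (h ω) (tail^[k] ω)) = coinE (fun ω => coinE (F (h ω))) := by
  induction k generalizing h with
  | zero =>
    have hc : ∀ ω, h ω = h fun _ => false := fun ω => hh _ _ fun i hi => by omega
    simp only [Function.iterate_zero, id_eq]
    simp only [fun ω => hc ω]
    rw [coinE_const]
  | succ k ih =>
    rw [coinE_consCoin (hh.seq hF), coinE_consCoin (hh.comp fun b => coinE (F b))]
    simp only [Function.iterate_succ_apply, tail_consCoin]
    rw [ih (hh.comp_consCoin false), ih (hh.comp_consCoin true)]

theorem coinLaw_real_eq {A : Set (ℕ → Bool)} {g : (ℕ → Bool) → Prop} [DecidablePred g]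
    (hA : ∀ ω, ω ∈ A ↔ g ω) (hg : DependsOnFirst L g) :
    coinLaw.real A = coinE (fun ω => if g ω then 1 else 0) := by
  have h1 : A = g ⁻¹' {True} := by ext ω; simp [hA]
  have hm : MeasurableSet A := by
    rw [h1]; exact hg.measurable (measurableSet_singleton _)
  have : (fun ω => if g ω then (1 : ℝ) else 0) = A.indicator 1 := by
    funext ω; simp [Set.indicator, hA]
  rw [coinE, this, integral_indicator_one hm]

/-! ### Uniform random numbers from coin tosses -/

/-- The number whose binary digits are those of `r` followed by the first `k` coin tosses. -/
def drawFrom (r : ℕ) : ℕ → (ℕ → Bool) → ℕ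
  | 0, _ => r
  | k + 1, ω => drawFrom (2 * r + (ω 0).toNat) k (tail ω)

theorem dependsOnFirst_drawFrom (r k : ℕ) : DependsOnFirst k (drawFrom r k) := by
  induction k generalizing r with
  | zero => exact fun _ _ _ => rfl
  | succ k ih =>
    intro ω ω' hω
    simp only [drawFrom, hω 0 (by omega)]
    exact ih _ _ _ fun i hi => hω (i + 1) (by omega)

theorem coinE_drawFrom (r k : ℕ) (φ : ℕ → ℝ) :
    coinE (fun ω => φ (drawFrom r k ω)) = (∑ x ∈ Finset.range (2 ^ k), φ (r * 2 ^ k + x)) / 2 ^ k := by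
  induction k generalizing r with
  | zero => simp [drawFrom, coinE_const]
  | succ k ih =>
    rw [coinE_consCoin ((dependsOnFirst_drawFrom r (k + 1)).comp φ)]
    simp only [drawFrom, tail_consCoin, consCoin_zero, ih, Bool.toNat_false, Bool.toNat_true]
    rw [pow_succ 2 k, mul_two, Finset.sum_range_add]
    have e1 : ∀ x, (2 * r + 0) * 2 ^ k + x = r * (2 ^ k + 2 ^ k) + x := fun x => by ring
    have e2 : ∀ x, (2 * r + 1) * 2 ^ k + x = r * (2 ^ k + 2 ^ k) + (2 ^ k + x) := fun x => by ring
    simp only [e1, e2]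
    rw [pow_succ]
    field_simp

/-! ### Iterated randomized procedures -/

/-- The result of `t` successive applications, started at `x`, of the randomized procedure `f`,
each of which uses `κ` coin tosses. -/
def iter {A : Type*} (κ : ℕ) (f : A → (ℕ → Bool) → A) : ℕ → A → (ℕ → Bool) → A
  | 0, x, _ => x
  | t + 1, x, ω => iter κ f t (f x ω) (tail^[κ] ω)

/-- The Markov operator of a randomized procedure. -/
noncomputable def markovOp {A : Type*} (f : A → (ℕ → Bool) → A) (g : A → ℝ) (x : A) : ℝ :=
  coinE fun ω => g (f x ω)

theorem dependsOnFirst_iter {A : Type*} {κ : ℕ} {f : A → (ℕ → Bool) → A}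
    (hf : ∀ x, DependsOnFirst κ (f x)) (t : ℕ) (x : A) : DependsOnFirst (κ * t) (iter κ f t x) := by
  induction t generalizing x with
  | zero => exact fun _ _ _ => rfl
  | succ t ih =>
    have := (hf x).seq (F := iter κ f t) ih
    rwa [Nat.mul_succ, add_comm]

theorem coinE_iter {A : Type*} {κ : ℕ} {f : A → (ℕ → Bool) → A}
    (hf : ∀ x, DependsOnFirst κ (f x)) (t : ℕ) (g : A → ℝ) (x : A) :
    coinE (fun ω => g (iter κ f t x ω)) = (markovOp f)^[t] g x := by
  induction t generalizing x with
  | zero => simp [iter, coinE_const]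
  | succ t ih =>
    have := coinE_seq (hf x) (F := fun y ω => g (iter κ f t y ω))
      (fun y => (dependsOnFirst_iter hf t y).comp g)
    simp only [iter]
    rw [this]
    simp only [ih]
    rw [Function.iterate_succ_apply']
    rfl

end Coins

/-! ### Verification of programs with time bounds -/

section Verification

/-- All entries of the memory have binary length at most `b`. -/
def IsBounded (b : ℕ) (m : Memory) : Prop := ∀ a i, m a i < 2 ^ b

/-- All oracle queries in the evaluation of the expression are at most `b`. -/
def Expr.QueriesLe (O : ℕ → ℕ) (m : Memory) (b : ℕ) : Expr → Prop
  | const _ => True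
  | get _ i => i.QueriesLe O m b
  | add x y => x.QueriesLe O m b ∧ y.QueriesLe O m b
  | sub x y => x.QueriesLe O m b ∧ y.QueriesLe O m b
  | mul x y => x.QueriesLe O m b ∧ y.QueriesLe O m b
  | div x y => x.QueriesLe O m b ∧ y.QueriesLe O m b
  | mod x y => x.QueriesLe O m b ∧ y.QueriesLe O m b
  | query k => k.QueriesLe O m b ∧ k.eval O m ≤ b

/-- A coefficient `w` such that the value of the expression has binary length at most
`w * (b + 1)`, if the entries of the memory have binary length at most `b` and the queries are at
most `b`. -/
def Expr.valueWeight : Expr → ℕ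
  | const k => k.size
  | get _ _ => 1
  | add x y => x.valueWeight + y.valueWeight + 1
  | sub x _ => x.valueWeight
  | mul x y => x.valueWeight + y.valueWeight
  | div x _ => x.valueWeight
  | mod x _ => x.valueWeight
  | query _ => 1

/-- A coefficient `w` such that the evaluation of the expression costs at most `w * (b + 1)`, if
the entries of the memory have binary length at most `b` and the queries are at most `b`. -/
def Expr.costWeight : Expr → ℕ
  | const k => 1 + k.size
  | get _ i => i.costWeight + 2
  | add x y => x.costWeight + y.costWeight + (2 + x.valueWeight + y.valueWeight)
  | sub x y => x.costWeight + y.costWeight + (1 + x.valueWeight)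
  | mul x y => x.costWeight + y.costWeight + (1 + x.valueWeight + y.valueWeight)
  | div x y => x.costWeight + y.costWeight + (1 + x.valueWeight)
  | mod x y => x.costWeight + y.costWeight + (1 + x.valueWeight)
  | query k => k.costWeight + 3

variable {O : ℕ → ℕ} {b : ℕ}

theorem size_le_of_lt_two_pow {x b : ℕ} (h : x < 2 ^ b) : x.size ≤ b := Nat.size_le.2 h

theorem size_add_le (x y : ℕ) : (x + y).size ≤ x.size + y.size + 1 := by
  rw [Nat.size_le]
  have hx := Nat.lt_size_self x
  have hy := Nat.lt_size_self y
  have h1 : 2 ^ x.size ≤ 2 ^ (x.size + y.size) := Nat.pow_le_pow_right (by norm_num) (by omega)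
  have h2 : 2 ^ y.size ≤ 2 ^ (x.size + y.size) := Nat.pow_le_pow_right (by norm_num) (by omega)
  rw [pow_succ]
  omega

theorem size_mul_le (x y : ℕ) : (x * y).size ≤ x.size + y.size := by
  rw [Nat.size_le, pow_add]
  exact Nat.mul_lt_mul'' (Nat.lt_size_self x) (Nat.lt_size_self y)

theorem Expr.size_eval_le (hO : ∀ k, O k ≤ 2 ^ k) {m : Memory} (hm : IsBounded b m) (e : Expr)
    (he : e.QueriesLe O m b) : (e.eval O m).size ≤ e.valueWeight * (b + 1) := by
  induction e with
  | const k => exact Nat.le_mul_of_pos_right _ (by omega)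
  | get a i ih =>
    have := size_le_of_lt_two_pow (hm a (i.eval O m))
    simp only [eval, valueWeight]; omega
  | add x y ihx ihy =>
    have := size_add_le (x.eval O m) (y.eval O m)
    have h1 := ihx he.1
    have h2 := ihy he.2
    simp only [eval, valueWeight, add_mul]; omega
  | sub x y ihx ihy => exact (Nat.size_le_size (Nat.sub_le _ _)).trans (ihx he.1)
  | mul x y ihx ihy =>
    have := size_mul_le (x.eval O m) (y.eval O m)
    have h1 := ihx he.1
    have h2 := ihy he.2
    simp only [eval, valueWeight, add_mul]; omega
  | div x y ihx ihy => exact (Nat.size_le_size (Nat.div_le_self _ _)).trans (ihx he.1)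
  | mod x y ihx ihy => exact (Nat.size_le_size (Nat.mod_le _ _)).trans (ihx he.1)
  | query k ih =>
    have h1 : O (k.eval O m) < 2 ^ (b + 1) := by
      refine (hO _).trans_lt ?_
      exact Nat.pow_lt_pow_right (by norm_num) (Nat.lt_succ_of_le he.2)
    have := size_le_of_lt_two_pow h1
    simp only [eval, valueWeight]; omega

theorem Expr.cost_le (hO : ∀ k, O k ≤ 2 ^ k) {m : Memory} (hm : IsBounded b m) (e : Expr)
    (he : e.QueriesLe O m b) : e.cost O m ≤ e.costWeight * (b + 1) := by
  have hs := Expr.size_eval_le hO hm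
  induction e with
  | const k => exact Nat.le_mul_of_pos_right _ (by omega)
  | get a i ih =>
    have h1 := ih he
    have h2 := hs (get a i) he
    simp only [cost, costWeight, add_mul, valueWeight] at *; omega
  | add x y ihx ihy =>
    have h1 := ihx he.1
    have h2 := ihy he.2
    have h3 := hs (add x y) he
    simp only [cost, costWeight, add_mul, valueWeight] at *; omega
  | sub x y ihx ihy =>
    have h1 := ihx he.1
    have h2 := ihy he.2
    have h3 := hs (sub x y) he
    simp only [cost, costWeight, add_mul, valueWeight] at *; omega
  | mul x y ihx ihy =>
    have h1 := ihx he.1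
    have h2 := ihy he.2
    have h3 := hs (mul x y) he
    simp only [cost, costWeight, add_mul, valueWeight] at *; omega
  | div x y ihx ihy =>
    have h1 := ihx he.1
    have h2 := ihy he.2
    have h3 := hs (div x y) he
    simp only [cost, costWeight, add_mul, valueWeight] at *; omega
  | mod x y ihx ihy =>
    have h1 := ihx he.1
    have h2 := ihy he.2
    have h3 := hs (mod x y) he
    simp only [cost, costWeight, add_mul, valueWeight] at *; omega
  | query k ih =>
    have h1 := ih he.1
    have h2 := hs (query k) he
    have h3 := he.2
    simp only [cost, costWeight, add_mul, valueWeight] at *; omega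

/-- The nesting depth of the loops of a program. -/
def Prog.depth : Prog → ℕ
  | skip => 0
  | assign _ _ _ => 0
  | toss _ _ => 0
  | seq P Q => max P.depth Q.depth
  | cond _ P Q => max P.depth Q.depth
  | loop _ P => P.depth + 1

/-- A coefficient `w` such that the program takes time at most `w * (b + 1) ^ (depth + 1)`, if all
numbers have binary length at most `b` and all loops have at most `b` iterations. -/
def Prog.weight : Prog → ℕ
  | skip => 1
  | assign _ i x => 1 + i.costWeight + x.costWeight
  | toss _ i => 1 + i.costWeight
  | seq P Q => P.weight + Q.weight
  | cond x P Q => 1 + x.costWeight + P.weight + Q.weight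
  | loop x P => 1 + x.costWeight + P.weight

/-- Started in the state `s`, the program halts within the time `weight * (b + 1) ^ (depth + 1)`, in
a state which satisfies `Φ` and has all entries of the memory of binary length at most `b`. -/
def Runs (O : ℕ → ℕ) (b : ℕ) (P : Prog) (s : State) (Φ : State → Prop) : Prop :=
  ∃ t s', Exec O P s t s' ∧ t ≤ P.weight * (b + 1) ^ (P.depth + 1) ∧ IsBounded b s'.mem ∧ Φ s'

theorem mul_pow_depth_le {w d d' : ℕ} (h : d ≤ d') :
    w * (b + 1) ^ (d + 1) ≤ w * (b + 1) ^ (d' + 1) :=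
  Nat.mul_le_mul_left _ (Nat.pow_le_pow_right (by omega) (by omega))

theorem mul_succ_le_pow_depth (w d : ℕ) : w * (b + 1) ≤ w * (b + 1) ^ (d + 1) := by
  simpa using mul_pow_depth_le (b := b) (w := w) (Nat.zero_le d)

theorem Runs.mono {P : Prog} {s : State} {Φ Ψ : State → Prop} (h : Runs O b P s Φ)
    (hΦ : ∀ s', IsBounded b s'.mem → Φ s' → Ψ s') : Runs O b P s Ψ := by
  obtain ⟨t, s', h1, h2, h3, h4⟩ := h
  exact ⟨t, s', h1, h2, h3, hΦ s' h3 h4⟩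

theorem Runs.skip {s : State} {Φ : State → Prop} (hs : IsBounded b s.mem) (h : Φ s) :
    Runs O b .skip s Φ :=
  ⟨1, s, .skip s, by simp [Prog.weight, Prog.depth], hs, h⟩

theorem Runs.seq {P Q : Prog} {s : State} {Φ Ψ : State → Prop} (h : Runs O b P s Φ)
    (h' : ∀ s', IsBounded b s'.mem → Φ s' → Runs O b Q s' Ψ) : Runs O b (.seq P Q) s Ψ := by
  obtain ⟨t, s', h1, h2, h3, h4⟩ := h
  obtain ⟨t', s'', h1', h2', h3', h4'⟩ := h' s' h3 h4
  refine ⟨t + t', s'', .seq h1 h1', ?_, h3', h4'⟩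
  simp only [Prog.weight, Prog.depth, add_mul]
  exact add_le_add (h2.trans (mul_pow_depth_le (le_max_left _ _)))
    (h2'.trans (mul_pow_depth_le (le_max_right _ _)))

theorem mem_write (s : State) (a i v a' i' : ℕ) :
    (s.write a i v).mem a' i' = if a' = a ∧ i' = i then v else s.mem a' i' := by
  simp only [State.write, Function.update_apply]
  split_ifs <;> simp_all

@[simp] theorem coins_write (s : State) (a i v : ℕ) : (s.write a i v).coins = s.coins := rfl

theorem IsBounded.write {s : State} (hs : IsBounded b s.mem) (a i : ℕ) {v : ℕ} (hv : v < 2 ^ b) :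
    IsBounded b (s.write a i v).mem := by
  intro a' i'
  rw [mem_write]
  split_ifs
  · exact hv
  · exact hs _ _

theorem Runs.assign (hO : ∀ k, O k ≤ 2 ^ k) {a : ℕ} {i x : Expr} {s : State} {Φ : State → Prop}
    (hs : IsBounded b s.mem) (hi : i.QueriesLe O s.mem b) (hx : x.QueriesLe O s.mem b)
    (hv : x.eval O s.mem < 2 ^ b) (h : Φ (s.write a (i.eval O s.mem) (x.eval O s.mem))) :
    Runs O b (.assign a i x) s Φ := by
  refine ⟨_, _, .assign a i x s, ?_, hs.write _ _ hv, h⟩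
  have h1 := Expr.cost_le hO hs i hi
  have h2 := Expr.cost_le hO hs x hx
  simp only [Prog.weight, Prog.depth, add_mul, zero_add, pow_one]
  omega

theorem Runs.toss (hO : ∀ k, O k ≤ 2 ^ k) (hb : 1 ≤ b) {a : ℕ} {i : Expr} {s : State}
    {Φ : State → Prop} (hs : IsBounded b s.mem) (hi : i.QueriesLe O s.mem b)
    (h : Φ ⟨(s.write a (i.eval O s.mem) (s.coins 0).toNat).mem, tail s.coins⟩) :
    Runs O b (.toss a i) s Φ := by
  refine ⟨_, _, .toss a i s, ?_, hs.write _ _ ?_, h⟩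
  · have h1 := Expr.cost_le hO hs i hi
    simp only [Prog.weight, Prog.depth, add_mul, zero_add, pow_one]
    omega
  · have h1 := Bool.toNat_lt (s.coins 0)
    have h2 : 2 ^ 1 ≤ 2 ^ b := Nat.pow_le_pow_right (by norm_num) hb
    omega

theorem Runs.cond (hO : ∀ k, O k ≤ 2 ^ k) {x : Expr} {P Q : Prog} {s : State} {Φ : State → Prop}
    (hs : IsBounded b s.mem) (hx : x.QueriesLe O s.mem b)
    (hP : x.eval O s.mem ≠ 0 → Runs O b P s Φ) (hQ : x.eval O s.mem = 0 → Runs O b Q s Φ) :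
    Runs O b (.cond x P Q) s Φ := by
  have h1 := (Expr.cost_le hO hs x hx).trans (mul_succ_le_pow_depth _ (max P.depth Q.depth))
  have h0 : 1 ≤ (b + 1) ^ (max P.depth Q.depth + 1) := Nat.one_le_pow _ _ (by omega)
  by_cases h : x.eval O s.mem = 0
  · obtain ⟨t, s', e, h2, h3, h4⟩ := hQ h
    refine ⟨_, s', .cond_false h e, ?_, h3, h4⟩
    have h5 := h2.trans (mul_pow_depth_le (le_max_right P.depth Q.depth))
    simp only [Prog.weight, Prog.depth, add_mul]
    omega
  · obtain ⟨t, s', e, h2, h3, h4⟩ := hP h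
    refine ⟨_, s', .cond_true h e, ?_, h3, h4⟩
    have h5 := h2.trans (mul_pow_depth_le (le_max_left P.depth Q.depth))
    simp only [Prog.weight, Prog.depth, add_mul]
    omega

/-- The scalar variable `a`, stored in the array `a` at the index `0`. -/
def var (a : ℕ) : Expr := .get a (.const 0)

/-- Assignment to a scalar variable. -/
def setVar (a : ℕ) (x : Expr) : Prog := .assign a (.const 0) x

/-- The loop in which the variable `c` runs downwards, from one less than its initial value
to `0`. -/
def countdown (c : ℕ) (P : Prog) : Prog :=
  .loop (var c) (.seq (setVar c (.sub (var c) (.const 1))) P)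

theorem Runs.setVar (hO : ∀ k, O k ≤ 2 ^ k) {a : ℕ} {x : Expr} {s : State} {Φ : State → Prop}
    (hs : IsBounded b s.mem) (hx : x.QueriesLe O s.mem b)
    (hv : x.eval O s.mem < 2 ^ b) (h : Φ (s.write a 0 (x.eval O s.mem))) :
    Runs O b (_root_.setVar a x) s Φ :=
  Runs.assign hO hs trivial hx hv h

/-- An assignment followed by a program. -/
theorem Runs.setVar_seq (hO : ∀ k, O k ≤ 2 ^ k) {a : ℕ} {x : Expr} {Q : Prog} {s : State}
    {Φ : State → Prop} (hs : IsBounded b s.mem) (hx : x.QueriesLe O s.mem b)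
    (hv : x.eval O s.mem < 2 ^ b)
    (h : IsBounded b (s.write a 0 (x.eval O s.mem)).mem →
      Runs O b Q (s.write a 0 (x.eval O s.mem)) Φ) :
    Runs O b (.seq (_root_.setVar a x) Q) s Φ :=
  Runs.seq (Φ := fun s' => s' = s.write a 0 (x.eval O s.mem)) (Runs.setVar hO hs hx hv rfl)
    (by rintro s' hs' rfl; exact h hs')

/-- The invariant rule for counting loops: `I j` holds whenever `j` iterations remain. -/
theorem Runs.countdown (hO : ∀ k, O k ≤ 2 ^ k) {c : ℕ} {P : Prog} (I : ℕ → State → Prop) {J : ℕ}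
    (hJ : J ≤ b)
    (hP : ∀ j s, j < J → IsBounded b (s.write c 0 j).mem → s.mem c 0 = j + 1 → I (j + 1) s →
      Runs O b P (s.write c 0 j) fun s' => s'.mem c 0 = j ∧ I j s')
    {s : State} (hs : IsBounded b s.mem) (hc : s.mem c 0 = J) (hI : I J s) :
    Runs O b (_root_.countdown c P) s fun s' => s'.mem c 0 = 0 ∧ I 0 s' := by
  set B : Prog := .seq (_root_.setVar c (.sub (var c) (.const 1))) P with hB
  have hd : B.depth = P.depth := by simp [hB, Prog.depth, _root_.setVar]
  have key : ∀ j s, j ≤ J → IsBounded b s.mem → s.mem c 0 = j → I j s →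
      ∃ t s', Exec O (.loop (var c) B) s t s' ∧
        t ≤ (j + 1) * ((var c).costWeight * (b + 1) + 1) + j * (B.weight * (b + 1) ^ (B.depth + 1))
        ∧ IsBounded b s'.mem ∧ s'.mem c 0 = 0 ∧ I 0 s' := by
    intro j
    induction j with
    | zero =>
      intro s _ hs hc hI
      refine ⟨_, s, .loop_false hc, ?_, hs, hc, hI⟩
      have h1 := Expr.cost_le hO hs (var c) trivial
      omega
    | succ j ih =>
      intro s hj hs hc hI
      have h1 := Expr.cost_le hO hs (var c) trivial
      have hv : ((var c).sub (.const 1)).eval O s.mem = j := by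
        simp [var, Expr.eval, hc]
      have hlt : j < 2 ^ b := by
        have := hs c 0
        omega
      obtain ⟨t, s', e, h2, h3, h4, h5⟩ : Runs O b B s fun s' => s'.mem c 0 = j ∧ I j s' := by
        refine Runs.setVar_seq hO hs ⟨trivial, trivial⟩ (by rw [hv]; exact hlt) ?_
        rw [hv]
        exact fun hs' => hP j s (by omega) hs' hc hI
      obtain ⟨t', s'', e', h2', h3', h4'⟩ := ih s' (by omega) h3 h4 h5
      refine ⟨_, s'', .loop_true (by simp [var, Expr.eval, hc]) e e', ?_, h3', h4'⟩
      have e1 : ∀ u v : ℕ, (j + 1 + 1) * u + (j + 1) * v = u + v + ((j + 1) * u + j * v) :=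
        fun u v => by ring
      rw [e1]
      omega
  obtain ⟨t, s', e, h2, h3, h4⟩ := key J s le_rfl hs hc hI
  refine ⟨t, s', e, h2.trans ?_, h3, h4⟩
  have hw : (_root_.countdown c P).weight = 1 + (var c).costWeight + B.weight := rfl
  have hdep : (_root_.countdown c P).depth = B.depth + 1 := rfl
  rw [hw, hdep, pow_succ (b + 1) (B.depth + 1)]
  have h6 : b + 1 ≤ (b + 1) ^ (B.depth + 1) := Nat.le_self_pow (by omega) _
  have h7 : (var c).costWeight * (b + 1) + 1 ≤ (1 + (var c).costWeight) * (b + 1) ^ (B.depth + 1) := by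
    have := Nat.mul_le_mul_left (1 + (var c).costWeight) h6
    rw [add_mul] at this
    omega
  calc (J + 1) * ((var c).costWeight * (b + 1) + 1) + J * (B.weight * (b + 1) ^ (B.depth + 1))
      ≤ (b + 1) * ((1 + (var c).costWeight) * (b + 1) ^ (B.depth + 1))
        + (b + 1) * (B.weight * (b + 1) ^ (B.depth + 1)) :=
        add_le_add (Nat.mul_le_mul (by omega) h7) (Nat.mul_le_mul_right _ (by omega))
    _ = _ := by ring

end Verification

/-! ### The Glauber dynamics as a program -/

section Sampler

/-- The potential edge with code `j`, where the pair `uv` with `u < v` has the code `u * n + v`. -/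
def pairOf (n : ℕ) [NeZero n] (j : ℕ) : Sym2 (Fin n) := s(Fin.ofNat n (j / n), Fin.ofNat n (j % n))

/-- One step of the Glauber dynamics on the potential edges with codes less than `i`: a random
number of `k` bits selects a code, and another one is compared with `q`, the oracle's approximation
to `p * 2 ^ k`. -/
noncomputable def stepFn (n : ℕ) [NeZero n] (k q i : ℕ) (X : Finset (Sym2 (Fin n)))
    (ω : ℕ → Bool) : Finset (Sym2 (Fin n)) :=
  let j := drawFrom 0 k ω % (n * n)
  if j / n < j % n ∧ j < i then
    upd IsTriangle (pairOf n j) (decide (drawFrom 0 k (tail^[k] ω) < q)) X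
  else X

/-- The array `1` holds the graph with edge set `X`. -/
def Holds (n : ℕ) [NeZero n] (X : Finset (Sym2 (Fin n))) (m : Memory) : Prop :=
  ∀ j < n * n, m 1 j = if j / n < j % n ∧ pairOf n j ∈ X then 1 else 0

/-- The two memories agree, except possibly in the arrays listed in `S`. -/
def AgreeOff (S : List ℕ) (m m' : Memory) : Prop := ∀ a, a ∉ S → m' a = m a

/-! The arrays are used as follows: `0` the input, `1` the graph, `2` the number of bits of a random
number, `3` the number of steps of the dynamics, `4` a loop counter, `5` a random number, `6` the
code of a pair, `7` a flag, `8` and `9` loop counters, `10` the bound for the codes, `17` a coin. -/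

/-- Draw a random number with as many bits as the variable `2` says. -/
def drawProg : Prog :=
  .seq (setVar 4 (var 2)) (.seq (setVar 5 (.const 0))
    (countdown 4 (.seq (.toss 17 (.const 0))
      (setVar 5 (.add (.mul (.const 2) (var 5)) (var 17))))))

/-- The first vertex of the pair with code `6`. -/
def rowExpr : Expr := .div (var 6) (var 0)

/-- The second vertex of the pair with code `6`. -/
def colExpr : Expr := .mod (var 6) (var 0)

/-- A nonzero number if and only if the vertices `x` and `w` are adjacent. Only one of the two
entries of the adjacency array for this pair is in use, and the sum reads both. -/
def adjExpr (x w : Expr) : Expr :=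
  .add (.get 1 (.add (.mul x (var 0)) w)) (.get 1 (.add (.mul w (var 0)) x))

/-- Set the flag `7` if the vertices of the pair with code `6` have a common neighbour. -/
def commonProg : Prog :=
  .seq (setVar 7 (.const 0)) (.seq (setVar 8 (var 0))
    (countdown 8 (.cond (.mul (adjExpr rowExpr (var 8)) (adjExpr colExpr (var 8)))
      (setVar 7 (.const 1)) .skip)))

/-- One step of the Glauber dynamics. Truncated subtraction serves for comparison, since `y - x` is
nonzero if and only if `x < y`, and multiplication serves for conjunction. -/
def stepProg : Prog :=
  .seq drawProg (.seq (setVar 6 (.mod (var 5) (.mul (var 0) (var 0))))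
    (.seq drawProg (.seq commonProg
      (.cond (.mul (.sub colExpr rowExpr) (.sub (var 10) (var 6)))
        (.cond (.mul (.sub (.query (var 2)) (var 5)) (.sub (.const 1) (var 7)))
          (.assign 1 (var 6) (.const 1)) (.assign 1 (var 6) (.const 0)))
        .skip))))

/-- Run the Glauber dynamics from the empty graph. -/
def samplerProg : Prog :=
  .seq (.seq (setVar 8 (.mul (var 0) (var 0))) (countdown 8 (.assign 1 (var 8) (.const 0))))
    (.seq (setVar 9 (var 3)) (countdown 9 stepProg))

variable {O : ℕ → ℕ} {b : ℕ}

theorem AgreeOff.trans {S S' : List ℕ} {m m' m'' : Memory} (h : AgreeOff S m m')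
    (h' : AgreeOff S' m' m'') : AgreeOff (S ++ S') m m'' := fun a ha => by
  rw [List.mem_append, not_or] at ha
  rw [h' a ha.2, h a ha.1]

theorem AgreeOff.mono {S S' : List ℕ} {m m' : Memory} (h : AgreeOff S m m') (hS : S ⊆ S') :
    AgreeOff S' m m' := fun a ha => h a fun h' => ha (hS h')

theorem agreeOff_write (s : State) (a i v : ℕ) : AgreeOff [a] s.mem (s.write a i v).mem := by
  intro a' ha'
  funext i'
  rw [mem_write, if_neg]
  simp only [List.mem_singleton] at ha'
  tauto

theorem runs_draw (hO : ∀ k, O k ≤ 2 ^ k) {k : ℕ} (hk : k ≤ b) (hb : 1 ≤ b) {s : State}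
    (hs : IsBounded b s.mem) (h2 : s.mem 2 0 = k) :
    Runs O b drawProg s fun s' => s'.coins = tail^[k] s.coins ∧
      s'.mem 5 0 = drawFrom 0 k s.coins ∧ AgreeOff [4, 5, 17] s.mem s'.mem := by
  have hkb : k < 2 ^ b := hk.trans_lt Nat.lt_two_pow_self
  refine Runs.setVar_seq hO hs trivial (by simpa [var, Expr.eval, h2] using hkb) fun hs1 => ?_
  refine Runs.setVar_seq hO hs1 trivial (by simp [Expr.eval]) fun hs2 => ?_
  refine (Runs.countdown hO (fun j s' => drawFrom (s'.mem 5 0) j s'.coins = drawFrom 0 k s.coins ∧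
    tail^[j] s'.coins = tail^[k] s.coins ∧ s'.mem 5 0 < 2 ^ (k - j) ∧
    AgreeOff [4, 5, 17] s.mem s'.mem) hk ?_ hs2 ?_ ?_).mono ?_
  · rintro j s' hj hs' hc ⟨h3, h4, h5, h6⟩
    refine Runs.seq (Runs.toss hO hb hs' trivial (Φ := fun s'' => s''.mem 4 0 = j ∧
      s''.mem 5 0 = s'.mem 5 0 ∧ s''.mem 17 0 = (s'.coins 0).toNat ∧ s''.coins = tail s'.coins ∧
      AgreeOff [4, 5, 17] s.mem s''.mem) ⟨?_, ?_, ?_, rfl, ?_⟩) ?_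
    · simp [mem_write]
    · simp [mem_write]
    · simp [mem_write, Expr.eval]
    · exact ((h6.trans (agreeOff_write s' 4 0 j)).trans (agreeOff_write _ _ _ _)).mono (by simp)
    · rintro s'' hs'' ⟨g1, g2, g3, g4, g5⟩
      have hlt : 2 * s'.mem 5 0 + (s'.coins 0).toNat < 2 ^ (k - j) := by
        have e1 : k - j = k - (j + 1) + 1 := by omega
        have := Bool.toNat_lt (s'.coins 0)
        rw [e1, pow_succ]
        omega
      have hle : 2 ^ (k - j) ≤ 2 ^ b := Nat.pow_le_pow_right (by norm_num) (by omega)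
      have hev : (Expr.add (.mul (.const 2) (var 5)) (var 17)).eval O s''.mem
          = 2 * s'.mem 5 0 + (s'.coins 0).toNat := by
        simp [Expr.eval, var, g2, g3]
      refine Runs.setVar hO hs'' ⟨⟨trivial, trivial⟩, trivial⟩ (by rw [hev]; omega) ?_
      rw [hev]
      refine ⟨by simp [mem_write, g1], ?_, ?_, ?_, ?_⟩
      · rw [← h3]; simp [mem_write, g4, drawFrom]
      · rw [← h4, coins_write, g4]; rfl
      · simpa [mem_write] using hlt
      · exact (g5.trans (agreeOff_write _ _ _ _)).mono (by simp)
  · simp [mem_write, var, Expr.eval, h2]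
  · refine ⟨by simp [mem_write, Expr.eval], rfl, by simp [mem_write, Expr.eval], ?_⟩
    exact ((agreeOff_write _ _ _ _).trans (agreeOff_write _ _ _ _)).mono (by simp)
  · rintro s' _ ⟨-, h3, h4, -, h6⟩
    exact ⟨h4, h3, h6⟩

open Classical in
theorem runs_common (hO : ∀ k, O k ≤ 2 ^ k) {n j : ℕ} (hn : n ≤ b) (hb : 1 ≤ b) {s : State}
    (hs : IsBounded b s.mem) (h0 : s.mem 0 0 = n) (h6 : s.mem 6 0 = j) :
    Runs O b commonProg s fun s' => s'.coins = s.coins ∧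
      s'.mem 7 0 = (if ∃ w < n, (s.mem 1 (j / n * n + w) + s.mem 1 (w * n + j / n))
        * (s.mem 1 (j % n * n + w) + s.mem 1 (w * n + j % n)) ≠ 0 then 1 else 0) ∧
      AgreeOff [7, 8] s.mem s'.mem := by
  have hnb : n < 2 ^ b := hn.trans_lt Nat.lt_two_pow_self
  set A : ℕ → ℕ := fun w => (s.mem 1 (j / n * n + w) + s.mem 1 (w * n + j / n))
        * (s.mem 1 (j % n * n + w) + s.mem 1 (w * n + j % n)) with hA
  have h1b : 1 < 2 ^ b := Nat.one_lt_two_pow (by omega)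
  refine Runs.setVar_seq hO hs trivial (by simp [Expr.eval]) fun hs1 => ?_
  refine Runs.setVar_seq hO hs1 trivial (by simpa [var, Expr.eval, mem_write, h0] using hnb)
    fun hs2 => ?_
  refine (Runs.countdown hO (fun i s' => s'.coins = s.coins ∧
    s'.mem 7 0 = (if ∃ w, i ≤ w ∧ w < n ∧ A w ≠ 0 then 1 else 0) ∧
    AgreeOff [7, 8] s.mem s'.mem) hn ?_ hs2 ?_ ?_).mono ?_
  · rintro i s' hi hs' hc ⟨h3, h4, h5⟩
    have e0 : s'.mem 0 0 = n := by rw [h5 0 (by simp), h0]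
    have e6 : s'.mem 6 0 = j := by rw [h5 6 (by simp), h6]
    have e1 : s'.mem 1 = s.mem 1 := h5 1 (by simp)
    have hev : (Expr.mul (adjExpr rowExpr (var 8)) (adjExpr colExpr (var 8))).eval O
        (s'.write 8 0 i).mem = A i := by
      simp [adjExpr, rowExpr, colExpr, Expr.eval, var, mem_write, e0, e6, e1, hA]
    have hag := (h5.trans (agreeOff_write s' 8 0 i)).mono (S' := [7, 8]) (by simp)
    refine Runs.cond hO hs' ?_ ?_ ?_
    · simp [adjExpr, rowExpr, colExpr, Expr.QueriesLe, var]
    · rw [hev]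
      intro hAi
      refine Runs.setVar hO hs' trivial (by simpa [Expr.eval] using by omega) ?_
      refine ⟨by simp [mem_write], h3, ?_, (hag.trans (agreeOff_write _ _ _ _)).mono (by simp)⟩
      rw [if_pos ⟨i, le_rfl, hi, hAi⟩]
      simp [mem_write, Expr.eval]
    · rw [hev]
      intro hAi
      refine Runs.skip hs' ⟨by simp [mem_write], h3, ?_, hag⟩
      have : (∃ w, i ≤ w ∧ w < n ∧ A w ≠ 0) ↔ ∃ w, i + 1 ≤ w ∧ w < n ∧ A w ≠ 0 := by
        constructor
        · rintro ⟨w, h1, h2, h3⟩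
          refine ⟨w, ?_, h2, h3⟩
          rcases Nat.lt_or_ge i w with h | h
          · exact h
          · exact absurd (show A w = 0 by rw [show w = i by omega]; exact hAi) h3
        · rintro ⟨w, h1, h2, h3⟩
          exact ⟨w, by omega, h2, h3⟩
      simp only [this]
      simpa [mem_write] using h4
  · simp [mem_write, var, Expr.eval, h0]
  · refine ⟨rfl, ?_, ((agreeOff_write _ _ _ _).trans (agreeOff_write _ _ _ _)).mono (by simp)⟩
    rw [if_neg (by rintro ⟨w, h1, h2, -⟩; omega)]
    simp [mem_write, Expr.eval]
  · rintro s' _ ⟨-, h3, h4, h5⟩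
    refine ⟨h3, ?_, h5⟩
    rw [h4]
    simp only [hA, Nat.zero_le, true_and]

variable {n : ℕ}

theorem code_div {u v : ℕ} (hv : v < n) : (u * n + v) / n = u := by
  rw [mul_comm, Nat.mul_add_div (by omega), Nat.div_eq_of_lt hv, add_zero]

theorem code_mod {u v : ℕ} (hv : v < n) : (u * n + v) % n = v := by
  rw [mul_comm, Nat.mul_add_mod, Nat.mod_eq_of_lt hv]

theorem code_lt {u v : ℕ} (hu : u < n) (hv : v < n) : u * n + v < n * n := by
  nlinarith

variable [NeZero n]

theorem lt_of_isCode {j : ℕ} (hj : j / n < j % n) : j / n < n ∧ j % n < n ∧ j < n * n := by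
  have h1 : j % n < n := Nat.mod_lt _ (Nat.pos_of_neZero n)
  refine ⟨by omega, h1, ?_⟩
  have := code_lt (n := n) (hj.trans h1) h1
  rwa [mul_comm, Nat.div_add_mod] at this

/-- Entries of the adjacency array, read in both orders. -/
theorem Holds.adj {X : Finset (Sym2 (Fin n))} {m : Memory} (h : Holds n X m) {u w : ℕ} (hu : u < n)
    (hw : w < n) : m 1 (u * n + w) + m 1 (w * n + u) ≠ 0 ↔
      u ≠ w ∧ s(Fin.ofNat n u, Fin.ofNat n w) ∈ X := by
  rw [h _ (code_lt hu hw), h _ (code_lt hw hu)]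
  simp only [pairOf, code_div hu, code_div hw, code_mod hu, code_mod hw]
  rw [Sym2.eq_swap (a := Fin.ofNat n w)]
  rcases lt_trichotomy u w with h | h | h
  · have h1 : ¬ w < u := by omega
    simp [h, h1, h.ne]
  · simp [h]
  · have h1 : ¬ u < w := by omega
    simp [h, h1, h.ne']

theorem ofNat_injOn {u v : ℕ} (hu : u < n) (hv : v < n) (h : Fin.ofNat n u = Fin.ofNat n v) :
    u = v := by
  have := congrArg Fin.val h
  simpa [Fin.ofNat, Nat.mod_eq_of_lt hu, Nat.mod_eq_of_lt hv] using this

theorem ofNat_val (v : Fin n) : Fin.ofNat n v = v := by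
  ext; simp [Fin.ofNat, Nat.mod_eq_of_lt v.2]

theorem Holds.exists_common_iff {X : Finset (Sym2 (Fin n))} {m : Memory} (h : Holds n X m) {j : ℕ}
    (hj : j / n < j % n) :
    (∃ w < n, (m 1 (j / n * n + w) + m 1 (w * n + j / n))
        * (m 1 (j % n * n + w) + m 1 (w * n + j % n)) ≠ 0) ↔ ¬ IsFree IsTriangle (pairOf n j) X := by
  obtain ⟨hu, hv, -⟩ := lt_of_isCode hj
  simp only [mul_ne_zero_iff, IsFree, not_forall, not_not]
  constructor
  · rintro ⟨w, hw, h1, h2⟩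
    rw [h.adj hu hw] at h1
    rw [h.adj hv hw] at h2
    exact ⟨_, h1.2, _, h2.2, _, _, _, fun h => hj.ne (ofNat_injOn hu hv h),
      fun h => h1.1 (ofNat_injOn hu hw h), fun h => h2.1 (ofNat_injOn hv hw h), rfl, rfl, rfl⟩
  · rintro ⟨f, hf, g, hg, a, c, w, hac, haw, hcw, he, rfl, rfl⟩
    rw [pairOf, Sym2.eq_iff] at he
    refine ⟨w, w.2, ?_⟩
    rw [h.adj hu w.2, h.adj hv w.2, ofNat_val]
    rcases he with ⟨rfl, rfl⟩ | ⟨rfl, rfl⟩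
    · exact ⟨⟨fun h => haw (by rw [h, ofNat_val]), hf⟩, ⟨fun h => hcw (by rw [h, ofNat_val]), hg⟩⟩
    · exact ⟨⟨fun h => hcw (by rw [h, ofNat_val]), hg⟩, ⟨fun h => haw (by rw [h, ofNat_val]), hf⟩⟩

theorem pairOf_injOn {j j' : ℕ} (hj : j / n < j % n) (hj' : j' / n < j' % n)
    (h : pairOf n j = pairOf n j') : j = j' := by
  obtain ⟨hu, hv, -⟩ := lt_of_isCode hj
  obtain ⟨hu', hv', -⟩ := lt_of_isCode hj'
  rw [pairOf, pairOf, Sym2.eq_iff] at h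
  rcases h with ⟨h1, h2⟩ | ⟨h1, h2⟩
  · have h1 := ofNat_injOn hu hu' h1
    have h2 := ofNat_injOn hv hv' h2
    rw [← Nat.div_add_mod j n, ← Nat.div_add_mod j' n, h1, h2]
  · have h1 := ofNat_injOn hu hv' h1
    have h2 := ofNat_injOn hv hu' h2
    omega

/-- Writing one entry of the adjacency array updates the graph. -/
theorem Holds.write {X : Finset (Sym2 (Fin n))} {s : State} (h : Holds n X s.mem) {j v : ℕ}
    (hj : j / n < j % n) {Y : Finset (Sym2 (Fin n))}
    (hY : ∀ e, e ≠ pairOf n j → (e ∈ Y ↔ e ∈ X)) (hv : v = if pairOf n j ∈ Y then 1 else 0) :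
    Holds n Y (s.write 1 j v).mem := by
  intro i hi
  rw [mem_write]
  by_cases hij : i = j
  · subst hij
    simp [hj, hv]
  · rw [if_neg (by tauto), h i hi]
    by_cases hc : i / n < i % n
    · have : pairOf n i ≠ pairOf n j := fun h => hij (pairOf_injOn hc hj h)
      simp [hc, hY _ this]
    · simp [hc]

/-- The specification of `stepProg`. The coins are tossed whether or not the code is valid, so that
each step uses the same number of coins. -/
theorem runs_step (hO : ∀ k, O k ≤ 2 ^ k) {k i : ℕ} (hk : k ≤ b) (hn : n * n ≤ b)
    {X : Finset (Sym2 (Fin n))} {s : State} (hs : IsBounded b s.mem) (h0 : s.mem 0 0 = n)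
    (h2 : s.mem 2 0 = k) (h10 : s.mem 10 0 = i) (hX : Holds n X s.mem) :
    Runs O b stepProg s fun s' => s'.coins = tail^[2 * k] s.coins ∧
      Holds n (stepFn n k (O k) i X s.coins) s'.mem ∧
      AgreeOff [1, 4, 5, 6, 7, 8, 17] s.mem s'.mem := by
  classical
  have hn1 : 1 ≤ n := Nat.pos_of_neZero n
  have hnn : n ≤ n * n := Nat.le_mul_self n
  have hb : 1 ≤ b := by omega
  have hbb : b < 2 ^ b := Nat.lt_two_pow_self
  set j := drawFrom 0 k s.coins % (n * n) with hj
  have hjlt : j < n * n := Nat.mod_lt _ (by omega)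
  refine Runs.seq (runs_draw hO hk hb hs h2) ?_
  rintro s1 hs1 ⟨c1, v1, a1⟩
  have e1 : (Expr.mod (var 5) (.mul (var 0) (var 0))).eval O s1.mem = j := by
    simp [Expr.eval, var, v1, a1 0 (by simp), h0, hj]
  refine Runs.setVar_seq hO hs1 ⟨trivial, trivial, trivial⟩ (by rw [e1]; omega) ?_
  rw [e1]
  intro hs2
  have a2 := (a1.trans (agreeOff_write s1 6 0 j)).mono (S' := [4, 5, 6, 17]) (by simp)
  refine Runs.seq (runs_draw hO hk hb hs2 (by rw [a2 2 (by simp), h2])) ?_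
  rintro s3 hs3 ⟨c3, v3, a3⟩
  have e6 : s3.mem 6 0 = j := by rw [a3 6 (by simp)]; simp [mem_write]
  have a4 := (a2.trans a3).mono (S' := [4, 5, 6, 17]) (by simp)
  refine Runs.seq (runs_common hO (hnn.trans hn) hb hs3 (by rw [a4 0 (by simp), h0]) e6) ?_
  rintro s5 hs5 ⟨c5, v5, a5⟩
  have a6 := (a4.trans a5).mono (S' := [4, 5, 6, 7, 8, 17]) (by simp)
  have hcoins : s5.coins = tail^[2 * k] s.coins := by
    rw [c5, c3, coins_write, c1, ← Function.iterate_add_apply, two_mul]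
  have hX3 : Holds n X s3.mem := fun l hl => by rw [a4 1 (by simp)]; exact hX l hl
  have hX5 : Holds n X s5.mem := fun l hl => by rw [a6 1 (by simp)]; exact hX l hl
  have m0 : s5.mem 0 0 = n := by rw [a6 0 (by simp), h0]
  have m2 : s5.mem 2 0 = k := by rw [a6 2 (by simp), h2]
  have m10 : s5.mem 10 0 = i := by rw [a6 10 (by simp), h10]
  have m6 : s5.mem 6 0 = j := by rw [a5 6 (by simp), e6]
  have m5 : s5.mem 5 0 = drawFrom 0 k (tail^[k] s.coins) := by
    rw [a5 5 (by simp), v3, coins_write, c1]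
  have ev1 : (Expr.mul (.sub colExpr rowExpr) (.sub (var 10) (var 6))).eval O s5.mem
      = (j % n - j / n) * (i - j) := by
    simp [Expr.eval, colExpr, rowExpr, var, m0, m6, m10]
  refine Runs.cond hO hs5 (by simp [Expr.QueriesLe, colExpr, rowExpr, var]) ?_ ?_
  · rw [ev1]
    intro hne
    have hc : j / n < j % n ∧ j < i := by
      rw [mul_ne_zero_iff] at hne; omega
    have hflag : s5.mem 7 0 = if IsFree IsTriangle (pairOf n j) X then 0 else 1 := by
      rw [v5]
      simp only [hX3.exists_common_iff hc.1]
      split_ifs <;> simp_all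
    have hst : stepFn n k (O k) i X s.coins
        = upd IsTriangle (pairOf n j) (decide (drawFrom 0 k (tail^[k] s.coins) < O k)) X :=
      if_pos hc
    have ev2 : (Expr.mul (.sub (.query (var 2)) (var 5)) (.sub (.const 1) (var 7))).eval O s5.mem
        = (O k - drawFrom 0 k (tail^[k] s.coins)) * (1 - s5.mem 7 0) := by
      simp [Expr.eval, var, m2, m5]
    have hqle : (Expr.mul (.sub (.query (var 2)) (var 5)) (.sub (.const 1) (var 7))).QueriesLe O
        s5.mem b := by
      simp [Expr.QueriesLe, var, Expr.eval, m2, hk]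
    have hfin : ∀ v, v < 2 ^ b →
        v = (if pairOf n j ∈ stepFn n k (O k) i X s.coins then 1 else 0) →
        Runs O b (.assign 1 (var 6) (.const v)) s5 fun s' => s'.coins = tail^[2 * k] s.coins ∧
          Holds n (stepFn n k (O k) i X s.coins) s'.mem ∧
          AgreeOff [1, 4, 5, 6, 7, 8, 17] s.mem s'.mem := by
      intro v hvb hv
      refine Runs.assign hO hs5 trivial trivial hvb ⟨hcoins, ?_, ?_⟩
      · have : (var 6).eval O s5.mem = j := by simp [var, Expr.eval, m6]
        rw [this]
        refine hX5.write hc.1 (fun e he => ?_) hv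
        rw [hst, mem_upd_of_ne he]
      · exact (a6.trans (agreeOff_write _ _ _ _)).mono (by simp)
    refine Runs.cond hO hs5 hqle ?_ ?_
    · rw [ev2, hflag]
      intro h
      refine hfin 1 (by omega) ?_
      rw [hst, if_pos]
      rw [mem_upd_self]
      by_cases hf : IsFree IsTriangle (pairOf n j) X
      · rw [if_pos hf] at h
        refine ⟨?_, hf⟩
        simp only [decide_eq_true_eq]
        rw [mul_ne_zero_iff] at h
        omega
      · simp [hf] at h
    · rw [ev2, hflag]
      intro h
      refine hfin 0 (by omega) ?_
      rw [hst, if_neg]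
      rw [mem_upd_self]
      rintro ⟨h1, h2⟩
      simp only [decide_eq_true_eq] at h1
      rw [if_pos h2] at h
      omega
  · rw [ev1]
    intro heq
    have hc : ¬ (j / n < j % n ∧ j < i) := by
      rintro ⟨h1, h2⟩
      have : (j % n - j / n) * (i - j) ≠ 0 := mul_ne_zero (by omega) (by omega)
      exact this heq
    have hst : stepFn n k (O k) i X s.coins = X := if_neg hc
    rw [hst]
    exact Runs.skip hs5 ⟨hcoins, hX5, a6.mono (by simp)⟩

theorem runs_sampler (hO : ∀ k, O k ≤ 2 ^ k) {k i t : ℕ} (hk : k ≤ b) (hn : n * n ≤ b)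
    (ht : t ≤ b) {s : State} (hs : IsBounded b s.mem) (h0 : s.mem 0 0 = n) (h2 : s.mem 2 0 = k)
    (h3 : s.mem 3 0 = t) (h10 : s.mem 10 0 = i) :
    Runs O b samplerProg s fun s' => s'.coins = tail^[2 * k * t] s.coins ∧
      Holds n (iter (2 * k) (stepFn n k (O k) i) t ∅ s.coins) s'.mem ∧
      AgreeOff [1, 4, 5, 6, 7, 8, 9, 17] s.mem s'.mem := by
  have hbb : b < 2 ^ b := Nat.lt_two_pow_self
  have clear : Runs O b (.seq (setVar 8 (.mul (var 0) (var 0)))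
      (countdown 8 (.assign 1 (var 8) (.const 0)))) s fun s' => s'.coins = s.coins ∧
        (∀ l < n * n, s'.mem 1 l = 0) ∧ AgreeOff [1, 8] s.mem s'.mem := by
    have e : (Expr.mul (var 0) (var 0)).eval O s.mem = n * n := by simp [Expr.eval, var, h0]
    refine Runs.setVar_seq hO hs ⟨trivial, trivial⟩ (by rw [e]; omega) ?_
    rw [e]
    intro hs1
    refine (Runs.countdown hO (fun j s' => s'.coins = s.coins ∧
      (∀ l, j ≤ l → l < n * n → s'.mem 1 l = 0) ∧ AgreeOff [1, 8] s.mem s'.mem) hn ?_ hs1 ?_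
      ?_).mono ?_
    · rintro j s' hj hs' hc ⟨g1, g2, g3⟩
      refine Runs.assign hO hs' trivial trivial (by simp [Expr.eval]) ?_
      have e2 : (var 8).eval O (s'.write 8 0 j).mem = j := by simp [var, Expr.eval, mem_write]
      rw [e2]
      refine ⟨by simp [mem_write], g1, fun l h1 h2 => ?_, ?_⟩
      · by_cases hl : l = j
        · simp [mem_write, hl, Expr.eval]
        · simp only [mem_write, hl, and_false, if_false]
          simpa using g2 l (by omega) h2
      · exact ((g3.trans (agreeOff_write _ _ _ _)).trans (agreeOff_write _ _ _ _)).mono (by simp)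
    · simp [mem_write]
    · exact ⟨rfl, fun l h1 h2 => by omega, (agreeOff_write _ _ _ _).mono (by simp)⟩
    · rintro s' _ ⟨-, g1, g2, g3⟩
      exact ⟨g1, fun l hl => g2 l (by omega) hl, g3⟩
  refine Runs.seq clear ?_
  rintro s1 hs1 ⟨c1, z1, a1⟩
  have e3 : (var 3).eval O s1.mem = t := by simp [var, Expr.eval, a1 3 (by simp), h3]
  refine Runs.setVar_seq hO hs1 trivial (by rw [e3]; omega) ?_
  rw [e3]
  intro hs2
  set R := iter (2 * k) (stepFn n k (O k) i) t ∅ s.coins with hR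
  -- invariant: the `j` remaining steps, applied to the present graph and coins, give the result `R`
  refine (Runs.countdown hO (fun j s' => tail^[2 * k * j] s'.coins = tail^[2 * k * t] s.coins ∧
    (∃ X, Holds n X s'.mem ∧ iter (2 * k) (stepFn n k (O k) i) j X s'.coins = R) ∧
    AgreeOff [1, 4, 5, 6, 7, 8, 9, 17] s.mem s'.mem) ht ?_ hs2 ?_ ?_).mono ?_
  · rintro j s' hj hs' hc ⟨g1, ⟨X, g2, g3⟩, g4⟩
    have a5 := (g4.trans (agreeOff_write s' 9 0 j)).mono (S' := [1, 4, 5, 6, 7, 8, 9, 17]) (by simp)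
    have hX : Holds n X (s'.write 9 0 j).mem := fun l hl => by
      simpa [mem_write] using g2 l hl
    refine (runs_step hO hk hn hs' (by rw [a5 0 (by simp), h0]) (by rw [a5 2 (by simp), h2])
      (by rw [a5 10 (by simp), h10]) hX).mono ?_
    rintro s'' _ ⟨f1, f2, f3⟩
    refine ⟨by rw [f3 9 (by simp)]; simp [mem_write], ?_, ⟨_, f2, ?_⟩, (a5.trans f3).mono (by simp)⟩
    · rw [f1, ← Function.iterate_add_apply, ← g1, Nat.mul_succ]; rfl
    · rw [f1, ← g3]; rfl
  · simp [mem_write]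
  · refine ⟨by rw [coins_write, c1], ⟨∅, fun l hl => ?_, by rw [coins_write, c1]⟩,
      (a1.trans (agreeOff_write _ _ _ _)).mono (by simp)⟩
    simp [mem_write, z1 l hl]
  · rintro s' _ ⟨-, g1, ⟨X, g2, g3⟩, g4⟩
    have : X = R := by simpa [iter] using g3
    exact ⟨by simpa using g1, this ▸ g2, g4⟩

end Sampler

/-! ### The law of the sampler -/

section SamplerLaw

variable {n : ℕ} [NeZero n]

/-- The potential edges with codes less than `i`. -/
noncomputable def pairsBelow (n : ℕ) [NeZero n] (i : ℕ) : Finset (Sym2 (Fin n)) :=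
  ((Finset.range i).filter fun j => j / n < j % n).image (pairOf n)

theorem injOn_pairOf (i : ℕ) : Set.InjOn (pairOf n)
    ((Finset.range i).filter fun j => j / n < j % n : Finset ℕ) := fun j hj j' hj' h => by
  simp only [Finset.coe_filter, Set.mem_ofPred_eq] at hj hj'
  exact pairOf_injOn hj.2 hj'.2 h

theorem card_pairsBelow_le (i : ℕ) : (pairsBelow n i).card ≤ n * n := by
  rw [pairsBelow, Finset.card_image_of_injOn (injOn_pairOf i)]
  refine (Finset.card_le_card (t := Finset.range (n * n)) fun j hj => ?_).trans_eq
    (Finset.card_range _)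
  exact Finset.mem_range.2 (lt_of_isCode (Finset.mem_filter.1 hj).2).2.2

theorem isRate_pairsBelow {p : ℝ} (h0 : 0 ≤ p) (h1 : p ≤ 1) (i : ℕ) :
    IsRate (pairsBelow n i) (1 / (n : ℝ) ^ 2) p := by
  have hn : (0 : ℝ) < n := by exact_mod_cast Nat.pos_of_neZero n
  refine ⟨h0, h1, by positivity, ?_⟩
  rw [one_div_mul_eq_div, div_le_one (by positivity), sq]
  exact_mod_cast card_pairsBelow_le i

theorem pairOf_code {u v : Fin n} : pairOf n (u * n + v) = s(u, v) := by
  rw [pairOf, code_div v.2, code_mod v.2, ofNat_val, ofNat_val]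

theorem pairsBelow_subset (i : ℕ) : pairsBelow n i ⊆ allPairs n := fun e he => by
  obtain ⟨j, hj, rfl⟩ := Finset.mem_image.1 he
  obtain ⟨h1, h2, -⟩ := lt_of_isCode (Finset.mem_filter.1 hj).2
  rw [mem_allPairs, pairOf, Sym2.mk_isDiag_iff]
  exact fun h => (Finset.mem_filter.1 hj).2.ne (ofNat_injOn h1 h2 h)

theorem pairsBelow_mul_self : pairsBelow n (n * n) = allPairs n := by
  refine (pairsBelow_subset _).antisymm fun e he => ?_
  induction e using Sym2.ind with
  | _ u v =>
    wlog huv : u < v generalizing u v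
    · rw [Sym2.eq_swap] at he ⊢
      refine this v u he ?_
      have : u ≠ v := fun h => by simp [mem_allPairs, h] at he
      exact lt_of_le_of_ne (not_lt.1 huv) this.symm
    refine Finset.mem_image.2 ⟨u * n + v, Finset.mem_filter.2
      ⟨Finset.mem_range.2 (code_lt u.2 v.2), ?_⟩, pairOf_code⟩
    rw [code_div v.2, code_mod v.2]
    exact huv

theorem pairsBelow_succ_of_isCode {i : ℕ} (hi : i / n < i % n) :
    pairsBelow n (i + 1) = insert (pairOf n i) (pairsBelow n i) := by
  rw [pairsBelow, Finset.range_add_one, Finset.filter_insert, if_pos hi, Finset.image_insert]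
  rfl

theorem pairsBelow_succ_of_not_isCode {i : ℕ} (hi : ¬ i / n < i % n) :
    pairsBelow n (i + 1) = pairsBelow n i := by
  rw [pairsBelow, Finset.range_add_one, Finset.filter_insert, if_neg hi]
  rfl

theorem pairOf_notMem_pairsBelow {i : ℕ} (hi : i / n < i % n) : pairOf n i ∉ pairsBelow n i := by
  intro h
  obtain ⟨j, hj, h⟩ := Finset.mem_image.1 h
  have := pairOf_injOn (Finset.mem_filter.1 hj).2 hi h
  have := Finset.mem_range.1 (Finset.mem_filter.1 hj).1
  omega

/-- The expectation of `f` after the pair with code `j` of `X` has been resampled; nothing happens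
unless `j` is the code of a pair and less than `i`. -/
noncomputable def resampleCode (p : ℝ) (i : ℕ) (f : Finset (Sym2 (Fin n)) → ℝ)
    (X : Finset (Sym2 (Fin n))) (j : ℕ) : ℝ :=
  if j / n < j % n ∧ j < i then p * f (upd IsTriangle (pairOf n j) true X)
    + (1 - p) * f (upd IsTriangle (pairOf n j) false X) else f X

/-- The averaging operator chooses a uniformly random code below `n²`. -/
theorem avg_pairsBelow (p : ℝ) (i : ℕ) (f : Finset (Sym2 (Fin n)) → ℝ)
    (X : Finset (Sym2 (Fin n))) :
    avg (pairsBelow n i) (1 / (n : ℝ) ^ 2) p (upd IsTriangle) f X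
      = (∑ j ∈ Finset.range (n * n), resampleCode p i f X j) / (n * n : ℕ) := by
  have hn : (0 : ℝ) < n := by exact_mod_cast Nat.pos_of_neZero n
  set F : ℕ → ℝ := fun j => p * f (upd IsTriangle (pairOf n j) true X)
    + (1 - p) * f (upd IsTriangle (pairOf n j) false X) with hF
  have hset : (Finset.range i).filter (fun j => j / n < j % n)
      = (Finset.range (n * n)).filter fun j => j / n < j % n ∧ j < i := by
    ext j
    simp only [Finset.mem_filter, Finset.mem_range]
    constructor
    · exact fun h => ⟨(lt_of_isCode h.2).2.2, h.2, h.1⟩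
    · exact fun h => ⟨h.2.2, h.2.1⟩
  have hcard : ((pairsBelow n i).card : ℝ)
      = ∑ j ∈ Finset.range (n * n), if j / n < j % n ∧ j < i then (1 : ℝ) else 0 := by
    rw [pairsBelow, Finset.card_image_of_injOn (injOn_pairOf i), hset, ← Finset.sum_filter,
      Finset.sum_const, nsmul_eq_mul, mul_one]
  have hres : ∀ j, resampleCode p i f X j = (if j / n < j % n ∧ j < i then F j else 0)
      + (f X - (if j / n < j % n ∧ j < i then (1 : ℝ) else 0) * f X) := by
    intro j
    unfold resampleCode
    split_ifs
    · simp [hF]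
    · ring
  rw [avg_apply, hcard]
  simp only [hres]
  rw [Finset.sum_add_distrib, Finset.sum_sub_distrib, ← Finset.sum_mul, Finset.sum_const,
    Finset.card_range, ← Finset.sum_filter, ← Finset.sum_filter, ← hset, pairsBelow,
    Finset.sum_image (injOn_pairOf i),
    ← Finset.mul_sum]
  push_cast
  rw [nsmul_eq_mul]
  push_cast
  field_simp
  simp only [hF]

theorem dependsOnFirst_stepFn (k q i : ℕ) (X : Finset (Sym2 (Fin n))) :
    DependsOnFirst (2 * k) (stepFn n k q i X) := by
  rw [two_mul]
  exact (dependsOnFirst_drawFrom 0 k).seq (F := fun r ω =>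
    if (r % (n * n)) / n < (r % (n * n)) % n ∧ r % (n * n) < i then
      upd IsTriangle (pairOf n (r % (n * n))) (decide (drawFrom 0 k ω < q)) X else X)
    (fun r => (dependsOnFirst_drawFrom 0 k).comp fun y =>
      if (r % (n * n)) / n < (r % (n * n)) % n ∧ r % (n * n) < i then
        upd IsTriangle (pairOf n (r % (n * n))) (decide (y < q)) X else X)

theorem sum_range_decide {q N : ℕ} (hq : q ≤ N) (F : Bool → ℝ) :
    ∑ x ∈ Finset.range N, F (decide (x < q)) = q * F true + (N - q) * F false := by
  obtain ⟨d, rfl⟩ := Nat.exists_eq_add_of_le hq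
  rw [Finset.sum_range_add]
  rw [Finset.sum_congr rfl (g := fun _ => F true) fun x hx => by
    simp [Finset.mem_range.1 hx]]
  simp

theorem coinE_bernoulli {k q : ℕ} (hq : q ≤ 2 ^ k) (F : Bool → ℝ) :
    coinE (fun ω => F (decide (drawFrom 0 k ω < q)))
      = (q / 2 ^ k : ℝ) * F true + (1 - q / 2 ^ k) * F false := by
  rw [coinE_drawFrom 0 k fun x => F (decide (x < q))]
  simp only [zero_mul, zero_add]
  rw [sum_range_decide hq]
  push_cast
  field_simp

theorem markovOp_stepFn {k q : ℕ} (hq : q ≤ 2 ^ k) (i : ℕ) (f : Finset (Sym2 (Fin n)) → ℝ)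
    (X : Finset (Sym2 (Fin n))) :
    markovOp (stepFn n k q i) f X
      = (∑ r ∈ Finset.range (2 ^ k), resampleCode (q / 2 ^ k) i f X (r % (n * n))) / 2 ^ k := by
  have h1 := coinE_seq (dependsOnFirst_drawFrom 0 k) (F := fun r ω => f
    (if (r % (n * n)) / n < (r % (n * n)) % n ∧ r % (n * n) < i then
      upd IsTriangle (pairOf n (r % (n * n))) (decide (drawFrom 0 k ω < q)) X else X))
    (fun r => (dependsOnFirst_drawFrom 0 k).comp fun y => f
      (if (r % (n * n)) / n < (r % (n * n)) % n ∧ r % (n * n) < i then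
        upd IsTriangle (pairOf n (r % (n * n))) (decide (y < q)) X else X))
  refine Eq.trans h1 ?_
  have h2 : ∀ r, coinE (fun ω => f
      (if (r % (n * n)) / n < (r % (n * n)) % n ∧ r % (n * n) < i then
        upd IsTriangle (pairOf n (r % (n * n))) (decide (drawFrom 0 k ω < q)) X else X))
      = resampleCode (q / 2 ^ k) i f X (r % (n * n)) := by
    intro r
    unfold resampleCode
    split_ifs with h
    · exact coinE_bernoulli hq fun b => f (upd IsTriangle (pairOf n (r % (n * n))) b X)
    · exact coinE_const _
  simp only [h2]
  rw [coinE_drawFrom 0 k fun r => resampleCode (q / 2 ^ k) i f X (r % (n * n))]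
  simp

/-- The residue of a uniform random number below `N` is almost uniform. -/
theorem abs_sum_mod_sub_le {m : ℕ} (hm : 0 < m) {N : ℕ} (hN : 0 < N) {ψ : ℕ → ℝ}
    (hψ : ∀ j, |ψ j| ≤ 1) :
    |(∑ r ∈ Finset.range N, ψ (r % m)) / N - (∑ j ∈ Finset.range m, ψ j) / m| ≤ 2 * m / N := by
  have hdiv : ∀ a c : ℕ, ∑ r ∈ Finset.range (a * m + c), ψ (r % m)
      = a * ∑ j ∈ Finset.range m, ψ j + ∑ r ∈ Finset.range c, ψ (r % m) := by
    intro a c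
    induction a with
    | zero => simp
    | succ a ih =>
      rw [show (a + 1) * m + c = m + (a * m + c) by ring, Finset.sum_range_add]
      simp only [Nat.add_mod_left, ih]
      rw [Finset.sum_congr rfl fun x hx => by rw [Nat.mod_eq_of_lt (Finset.mem_range.1 hx)]]
      push_cast; ring
  have hb : ∀ (c : ℕ) (φ : ℕ → ℕ), |∑ r ∈ Finset.range c, ψ (φ r)| ≤ c := by
    intro c φ
    refine (Finset.abs_sum_le_sum_abs _ _).trans ?_
    refine (Finset.sum_le_sum fun r _ => hψ (φ r)).trans ?_
    simp
  have h1 := hdiv (N / m) (N % m)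
  rw [show N / m * m + N % m = N by rw [mul_comm]; exact Nat.div_add_mod N m] at h1
  have hm' : (0 : ℝ) < m := by exact_mod_cast hm
  have hN' : (0 : ℝ) < N := by exact_mod_cast hN
  have hNm : (N : ℝ) = m * (N / m : ℕ) + (N % m : ℕ) := by
    exact_mod_cast (Nat.div_add_mod N m).symm
  have e : (∑ r ∈ Finset.range N, ψ (r % m)) / N - (∑ j ∈ Finset.range m, ψ j) / m
      = (m * ∑ r ∈ Finset.range (N % m), ψ (r % m)
        - (N % m : ℕ) * ∑ j ∈ Finset.range m, ψ j) / (m * N) := by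
    rw [h1, div_sub_div _ _ hN'.ne' hm'.ne', mul_comm (N : ℝ) m]
    congr 1
    rw [hNm]; ring
  have h2 := hb (N % m) fun r => r % m
  have h3 := hb m fun r => r
  have h4 : ((N % m : ℕ) : ℝ) ≤ m := by exact_mod_cast (Nat.mod_lt N hm).le
  have h5 : (0 : ℝ) ≤ (N % m : ℕ) := by positivity
  rw [e, abs_div, abs_of_pos (by positivity : (0 : ℝ) < m * N), div_le_div_iff₀ (by positivity) hN']
  have h6 : |(m * ∑ r ∈ Finset.range (N % m), ψ (r % m)
        - (N % m : ℕ) * ∑ j ∈ Finset.range m, ψ j)| ≤ 2 * m * m := by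
    refine (abs_sub _ _).trans ?_
    rw [abs_mul, abs_mul, abs_of_pos hm', abs_of_nonneg h5]
    have h7 := mul_le_mul_of_nonneg_left (h2.trans h4) hm'.le
    have h8 := mul_le_mul h4 h3 (abs_nonneg _) hm'.le
    linarith
  calc _ ≤ 2 * m * m * (N : ℝ) := mul_le_mul_of_nonneg_right h6 hN'.le
    _ = _ := by ring

theorem abs_resampleCode_le {p : ℝ} (h0 : 0 ≤ p) (h1 : p ≤ 1) (i : ℕ)
    {f : Finset (Sym2 (Fin n)) → ℝ} (hf : ∀ X, |f X| ≤ 1) (X : Finset (Sym2 (Fin n))) (j : ℕ) :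
    |resampleCode p i f X j| ≤ 1 := by
  unfold resampleCode
  split_ifs
  · refine (abs_add_le _ _).trans ?_
    rw [abs_mul, abs_mul, abs_of_nonneg h0, abs_of_nonneg (by linarith : 0 ≤ 1 - p)]
    have h2 := mul_le_mul_of_nonneg_left (hf (upd IsTriangle (pairOf n j) true X)) h0
    have h3 := mul_le_mul_of_nonneg_left (hf (upd IsTriangle (pairOf n j) false X))
      (by linarith : 0 ≤ 1 - p)
    linarith
  · exact hf X

/-- A step of the sampler differs from a step of the Glauber dynamics, since a number of `k` bits is
reduced modulo `n²`, and since `p` is rounded to `q / 2 ^ k`. -/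
theorem abs_markovOp_sub_avg_le {k q : ℕ} {p : ℝ} (h0 : 0 ≤ p) (h1 : p ≤ 1) (hq : q ≤ 2 ^ k)
    (hpq : |(q / 2 ^ k : ℝ) - p| ≤ 1 / 2 ^ k) (i : ℕ) {f : Finset (Sym2 (Fin n)) → ℝ}
    (hf : ∀ X, |f X| ≤ 1) (X : Finset (Sym2 (Fin n))) :
    |markovOp (stepFn n k q i) f X
      - avg (pairsBelow n i) (1 / (n : ℝ) ^ 2) p (upd IsTriangle) f X|
      ≤ (2 * (n : ℝ) ^ 2 + 2) / 2 ^ k := by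
  have hn := Nat.pos_of_neZero n
  have hq' : (q : ℝ) / 2 ^ k ≤ 1 := by
    rw [div_le_one (by positivity)]; exact_mod_cast hq
  rw [markovOp_stepFn hq, avg_pairsBelow]
  set S := ∑ r ∈ Finset.range (2 ^ k), resampleCode p i f X (r % (n * n)) with hS
  have hdiff : ∀ j, |resampleCode (q / 2 ^ k) i f X j - resampleCode p i f X j| ≤ 2 / 2 ^ k := by
    intro j
    unfold resampleCode
    split_ifs
    · set a := f (upd IsTriangle (pairOf n j) true X)
      set c := f (upd IsTriangle (pairOf n j) false X)
      rw [show (q / 2 ^ k : ℝ) * a + (1 - q / 2 ^ k) * c - (p * a + (1 - p) * c)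
        = (q / 2 ^ k - p) * (a - c) by ring, abs_mul]
      have ha : |a| ≤ 1 := hf _
      have hc : |c| ≤ 1 := hf _
      have h3 : |a - c| ≤ 2 := (abs_sub _ _).trans (by linarith)
      have := mul_le_mul hpq h3 (abs_nonneg _) (by positivity)
      linarith [show (1 : ℝ) / 2 ^ k * 2 = 2 / 2 ^ k by ring]
    · rw [sub_self, abs_zero]; positivity
  have e1 : |(∑ r ∈ Finset.range (2 ^ k), resampleCode (q / 2 ^ k) i f X (r % (n * n))) / 2 ^ k
      - S / 2 ^ k| ≤ 2 / 2 ^ k := by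
    rw [← sub_div, hS, ← Finset.sum_sub_distrib, abs_div, abs_of_pos (by positivity : (0 : ℝ) < 2 ^ k)]
    rw [div_le_iff₀ (by positivity)]
    refine (Finset.abs_sum_le_sum_abs _ _).trans
      ((Finset.sum_le_sum fun r _ => hdiff (r % (n * n))).trans ?_)
    rw [Finset.sum_const, Finset.card_range, nsmul_eq_mul]
    push_cast
    linarith
  have e2 := abs_sum_mod_sub_le (Nat.mul_pos hn hn) (N := 2 ^ k) (by positivity)
    (abs_resampleCode_le h0 h1 i hf X)
  push_cast at e2 ⊢
  have e3 := abs_sub_le ((∑ r ∈ Finset.range (2 ^ k),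
    resampleCode (q / 2 ^ k) i f X (r % (n * n))) / 2 ^ k) (S / 2 ^ k)
    ((∑ j ∈ Finset.range (n * n), resampleCode p i f X j) / ((n : ℝ) * n))
  refine e3.trans ((add_le_add e1 e2).trans (le_of_eq ?_))
  rw [sq]; ring

theorem abs_coinE_le {L : ℕ} {g : (ℕ → Bool) → ℝ} (hg : DependsOnFirst L g) {c : ℝ}
    (h : ∀ ω, |g ω| ≤ c) : |coinE g| ≤ c := by
  have h1 := coinE_mono hg (.const (L := 0) c) fun ω => (abs_le.1 (h ω)).2
  have h2 := coinE_mono (.const (L := 0) (-c)) hg fun ω => (abs_le.1 (h ω)).1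
  rw [coinE_const] at h1 h2
  exact abs_le.2 ⟨h2, h1⟩

theorem abs_markovOp_iterate_sub_avg_le {k q : ℕ} {p : ℝ} (h0 : 0 ≤ p) (h1 : p ≤ 1)
    (hq : q ≤ 2 ^ k) (hpq : |(q / 2 ^ k : ℝ) - p| ≤ 1 / 2 ^ k) (i t : ℕ)
    {f : Finset (Sym2 (Fin n)) → ℝ} (hf : ∀ X, |f X| ≤ 1) (X : Finset (Sym2 (Fin n))) :
    |(markovOp (stepFn n k q i))^[t] f X
      - (avg (pairsBelow n i) (1 / (n : ℝ) ^ 2) p (upd IsTriangle) ^ t) f X|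
      ≤ t * ((2 * (n : ℝ) ^ 2 + 2) / 2 ^ k) := by
  induction t generalizing f with
  | zero => simp
  | succ t ih =>
    set A := avg (pairsBelow n i) (1 / (n : ℝ) ^ 2) p (upd IsTriangle) with hA
    set M := markovOp (stepFn n k q i) with hM
    set δ := (2 * (n : ℝ) ^ 2 + 2) / 2 ^ k
    have hMf : ∀ X, |M f X| ≤ 1 := fun X =>
      abs_coinE_le ((dependsOnFirst_stepFn k q i X).comp f) fun ω => hf _
    have hr := isRate_pairsBelow (n := n) h0 h1 i
    have hd := abs_markovOp_sub_avg_le h0 h1 hq hpq i hf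
    have e1 := ih hMf
    have e2 : |(A ^ t) (M f) X - (A ^ t) (A f) X| ≤ δ := by
      have u := avg_pow_mono hr (act := upd IsTriangle) t (f := M f - A f) (g := fun _ => δ)
        (fun X => (abs_le.1 (hd X)).2) X
      have l := avg_pow_mono hr (act := upd IsTriangle) t (f := fun _ => -δ) (g := M f - A f)
        (fun X => (abs_le.1 (hd X)).1) X
      rw [avg_pow_const, map_sub] at u l
      exact abs_le.2 ⟨l, u⟩
    rw [Function.iterate_succ_apply, pow_succ, Module.End.mul_apply]
    have e3 := abs_sub_le (M^[t] (M f) X) ((A ^ t) (M f) X) ((A ^ t) (A f) X)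
    push_cast
    linarith

/-- The coupled chains on the pairs with codes less than `i` fail to meet within `K n³ l` steps with
probability at most `8⁻ˡ`. -/
theorem exists_coalescence_pairsBelow {c : ℝ} (hc : c < 1 / Real.sqrt 2) :
    ∃ K : ℕ, ∀ (n : ℕ) [NeZero n] (p : ℝ), 0 ≤ p → p ≤ 1 → p ≤ c / Real.sqrt n → ∀ i l : ℕ,
      ∀ X ⊆ pairsBelow n i, ∀ Y ⊆ pairsBelow n i,
      (avg (pairsBelow n i) (1 / (n : ℝ) ^ 2) p (coupled IsTriangle) ^ (K * n ^ 3 * l)) differ (X, Y)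
        ≤ (1 / 8) ^ l := by
  obtain ⟨K, hK⟩ := exists_coalescence hc
  refine ⟨K, fun n _ p h0 h1 hp i l X hX Y hY => ?_⟩
  have hr := isRate_pairsBelow (n := n) h0 h1 i
  have hn := Nat.pos_of_neZero n
  have hn1 : (1 : ℝ) ≤ n := by exact_mod_cast hn
  refine avg_pow_differ_mul_le hr (by norm_num) (fun X hX Y hY => ?_) l hX hY
  by_cases hn2 : 2 ≤ n
  · refine hK n hn2 p _ _ hr hp le_rfl ?_ _ ?_ X hX Y hY
    · rw [div_le_one (by positivity)]
      exact one_le_pow₀ hn1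
    · push_cast
      have h2 : Real.log n ≤ n := (Real.log_le_sub_one_of_pos (by linarith)).trans (by linarith)
      have := mul_le_mul_of_nonneg_left h2 (by positivity : (0 : ℝ) ≤ K * (n : ℝ) ^ 2)
      linarith [show (K : ℝ) * (n : ℝ) ^ 2 * n = K * (n : ℝ) ^ 3 by ring]
  · -- with a single vertex there are no pairs
    have hH : pairsBelow n i = ∅ := by
      refine Finset.subset_empty.1 fun e he => ?_
      obtain ⟨j, hj, -⟩ := Finset.mem_image.1 he
      have h4 := (Finset.mem_filter.1 hj).2
      have h5 := (lt_of_isCode h4).2.1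
      generalize j % n = x at h4 h5
      generalize j / n = y at h4
      omega
    rw [hH] at hX hY
    rw [Finset.subset_empty.1 hX, Finset.subset_empty.1 hY, avg_pow_differ_self]
    norm_num

/-- A bound for the bias of the sampler which takes `K n³ k` steps and uses random numbers of `k`
bits: the first term accounts for the rounding in every step, the second one for the incomplete
mixing. -/
noncomputable def samplerError (K n k : ℕ) : ℝ :=
  (K * n ^ 3 * k : ℕ) * ((2 * (n : ℝ) ^ 2 + 2) / 2 ^ k) + 2 * (1 / 8) ^ k

theorem abs_coinE_sampler_sub_le {K k q : ℕ} {p : ℝ} (h0 : 0 ≤ p) (h1 : p < 1)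
    (hq : q ≤ 2 ^ k) (hpq : |(q / 2 ^ k : ℝ) - p| ≤ 1 / 2 ^ k) (i : ℕ)
    (hK : ∀ X ⊆ pairsBelow n i, ∀ Y ⊆ pairsBelow n i,
      (avg (pairsBelow n i) (1 / (n : ℝ) ^ 2) p (coupled IsTriangle) ^ (K * n ^ 3 * k)) differ (X, Y)
        ≤ (1 / 8) ^ k)
    {f : Finset (Sym2 (Fin n)) → ℝ} (hf : ∀ X, |f X| ≤ 1) :
    |coinE (fun ω => f (iter (2 * k) (stepFn n k q i) (K * n ^ 3 * k) ∅ ω))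
      - gibbsSum IsTriangle (pairsBelow n i) p f
        / gibbsSum IsTriangle (pairsBelow n i) p (fun _ => 1)| ≤ samplerError K n k := by
  rw [coinE_iter (dependsOnFirst_stepFn k q i)]
  have e1 := abs_markovOp_iterate_sub_avg_le h0 h1.le hq hpq i (K * n ^ 3 * k) hf ∅
  have e2 := abs_avg_pow_sub_gibbsSum_le isTripleSystem_isTriangle
    (isRate_pairsBelow (n := n) h0 h1.le i) hK hf (Finset.empty_subset _)
  have hZ := gibbsSum_one_pos (H := pairsBelow n i) h0 h1
  set Z := gibbsSum IsTriangle (pairsBelow n i) p (fun _ => 1)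
  set a := (avg (pairsBelow n i) (1 / (n : ℝ) ^ 2) p (upd IsTriangle) ^ (K * n ^ 3 * k)) f ∅
  have e3 : |a - gibbsSum IsTriangle (pairsBelow n i) p f / Z| ≤ 2 * (1 / 8) ^ k := by
    rw [show a - gibbsSum IsTriangle (pairsBelow n i) p f / Z
      = (Z * a - gibbsSum IsTriangle (pairsBelow n i) p f) / Z by field_simp, abs_div,
      abs_of_pos hZ, div_le_iff₀ hZ]
    linarith
  have e4 := abs_sub_le ((markovOp (stepFn n k q i))^[K * n ^ 3 * k] f ∅) a
    (gibbsSum IsTriangle (pairsBelow n i) p f / Z)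
  unfold samplerError
  linarith

end SamplerLaw

/-! ### Estimation of a probability by repeated trials -/

section Trials

theorem coinE_sum {ι : Type*} (s : Finset ι) {L : ℕ} {g : ι → (ℕ → Bool) → ℝ}
    (hg : ∀ i, DependsOnFirst L (g i)) :
    coinE (fun ω => ∑ i ∈ s, g i ω) = ∑ i ∈ s, coinE (g i) :=
  integral_finsetSum s fun i _ => (hg i).integrable

theorem coinE_comp_tail {L : ℕ} {g : (ℕ → Bool) → ℝ} (hg : DependsOnFirst L g) (k : ℕ) :
    coinE (fun ω => g (tail^[k] ω)) = coinE g := by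
  have := coinE_seq (k := k) (.const ()) (F := fun _ => g) fun _ => hg
  rwa [coinE_const] at this

/-- The number of successes in `t` independent trials, each of which uses `κ` coin tosses. -/
def successCount (κ : ℕ) (Y : (ℕ → Bool) → ℕ) (t : ℕ) (ω : ℕ → Bool) : ℕ :=
  iter κ (fun s ω => s + Y ω) t 0 ω

theorem dependsOnFirst_successCount {κ : ℕ} {Y : (ℕ → Bool) → ℕ} (hY : DependsOnFirst κ Y)
    (t : ℕ) : DependsOnFirst (κ * t) (successCount κ Y t) :=
  dependsOnFirst_iter (fun s => hY.comp fun y => s + y) t 0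

theorem markovOp_iterate_sq {κ : ℕ} {Y : (ℕ → Bool) → ℕ} (hY : DependsOnFirst κ Y) (c : ℝ) (t x : ℕ) :
    (markovOp fun s ω => s + Y ω)^[t] (fun y : ℕ => ((y : ℝ) - c) ^ 2) x
      = (x + t * coinE (fun ω => (Y ω : ℝ)) - c) ^ 2
        + t * (coinE (fun ω => (Y ω : ℝ) ^ 2) - coinE (fun ω => (Y ω : ℝ)) ^ 2) := by
  induction t generalizing x with
  | zero => simp
  | succ t ih =>
    rw [Function.iterate_succ_apply']
    set μ := coinE (fun ω => (Y ω : ℝ)) with hμ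
    set v := coinE (fun ω => (Y ω : ℝ) ^ 2) with hv
    have h1 : markovOp (fun s ω => s + Y ω)
        ((markovOp fun s ω => s + Y ω)^[t] fun y : ℕ => ((y : ℝ) - c) ^ 2) x
        = coinE (fun ω => ((x + t * μ - c) ^ 2 + t * (v - μ ^ 2))
          + (2 * (x + t * μ - c) * (Y ω : ℝ) + (Y ω : ℝ) ^ 2)) := by
      unfold markovOp at ih ⊢
      congr 1
      funext ω
      rw [ih]
      push_cast; ring
    have d1 : DependsOnFirst κ fun ω => (Y ω : ℝ) := hY.comp fun y => (y : ℝ)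
    have d2 : DependsOnFirst κ fun ω => (Y ω : ℝ) ^ 2 := hY.comp fun y => (y : ℝ) ^ 2
    have d3 : DependsOnFirst κ fun ω => 2 * (x + t * μ - c) * (Y ω : ℝ) :=
      hY.comp fun y => 2 * (x + t * μ - c) * (y : ℝ)
    have d4 : DependsOnFirst κ fun ω => 2 * (x + t * μ - c) * (Y ω : ℝ) + (Y ω : ℝ) ^ 2 :=
      hY.comp fun y => 2 * (x + t * μ - c) * (y : ℝ) + (y : ℝ) ^ 2
    rw [h1, coinE_add (.const (L := 0) _) d4, coinE_const, coinE_add d3 d2, coinE_mul, ← hμ, ← hv]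
    push_cast; ring

open Classical in
/-- Chebyshev's inequality for the fraction of successes. -/
theorem coinE_deviation_le {κ : ℕ} {Y : (ℕ → Bool) → ℕ} (hY : DependsOnFirst κ Y)
    (hY1 : ∀ ω, Y ω ≤ 1) {t : ℕ} (ht : 0 < t) {η : ℝ} (hη : 0 < η) :
    coinE (fun ω => if η < |(successCount κ Y t ω : ℝ) / t - coinE (fun ω => (Y ω : ℝ))| then 1 else 0)
      ≤ 1 / (t * η ^ 2) := by
  set μ := coinE (fun ω => (Y ω : ℝ)) with hμ
  have ht' : (0 : ℝ) < t := by exact_mod_cast ht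
  have hc := dependsOnFirst_successCount hY t
  have hpt : ∀ ω, (if η < |(successCount κ Y t ω : ℝ) / t - μ| then (1 : ℝ) else 0)
      ≤ 1 / (t * η) ^ 2 * ((successCount κ Y t ω : ℝ) - t * μ) ^ 2 := by
    intro ω
    split_ifs with h
    · have h1 : t * η ≤ |(successCount κ Y t ω : ℝ) - t * μ| := by
        have : (successCount κ Y t ω : ℝ) - t * μ = t * ((successCount κ Y t ω : ℝ) / t - μ) := by
          field_simp
        rw [this, abs_mul, abs_of_pos ht']
        exact mul_le_mul_of_nonneg_left h.le ht'.le
      rw [one_div_mul_eq_div, le_div_iff₀ (by positivity), one_mul, ← sq_abs (_ - _)]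
      exact pow_le_pow_left₀ (by positivity) h1 2
    · positivity
  have h1 := coinE_mono (hc.comp fun y => if η < |(y : ℝ) / t - μ| then (1 : ℝ) else 0)
    (hc.comp fun y => 1 / (t * η) ^ 2 * ((y : ℝ) - t * μ) ^ 2) hpt
  refine h1.trans ?_
  rw [coinE_mul]
  have h2 : coinE (fun ω => ((successCount κ Y t ω : ℝ) - t * μ) ^ 2)
      = (markovOp fun s ω => s + Y ω)^[t] (fun y : ℕ => ((y : ℝ) - t * μ) ^ 2) 0 :=
    coinE_iter (fun s => hY.comp fun y => s + y) t (fun y : ℕ => ((y : ℝ) - t * μ) ^ 2) 0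
  have h3 : coinE (fun ω => (Y ω : ℝ) ^ 2) ≤ 1 := by
    have := coinE_mono (hY.comp fun y => (y : ℝ) ^ 2) (.const (L := 0) (1 : ℝ)) fun ω => by
      have : (Y ω : ℝ) ≤ 1 := by exact_mod_cast hY1 ω
      exact pow_le_one₀ (by positivity) this
    rwa [coinE_const] at this
  rw [h2, markovOp_iterate_sq hY, ← hμ]
  have h4 : ((0 : ℕ) + t * μ - t * μ : ℝ) ^ 2 + t * (coinE (fun ω => (Y ω : ℝ) ^ 2) - μ ^ 2) ≤ t := by
    have : (t : ℝ) * (coinE (fun ω => (Y ω : ℝ) ^ 2) - μ ^ 2) ≤ t * 1 :=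
      mul_le_mul_of_nonneg_left (by nlinarith [sq_nonneg μ]) ht'.le
    push_cast
    linarith
  refine (mul_le_mul_of_nonneg_left h4 (by positivity)).trans (le_of_eq ?_)
  field_simp

end Trials

/-! ### The telescoping product for the probability of being triangle-free -/

section Telescope

variable {n : ℕ} [NeZero n]

/-- The probability that the random graph on the pairs with codes less than `i` is triangle-free. -/
noncomputable def partialProb (n : ℕ) [NeZero n] (p : ℝ) (i : ℕ) : ℝ :=
  gibbsSum IsTriangle (pairsBelow n i) p fun _ => 1

open Classical in
/-- The indicator of the event that adding the pair with code `i` creates a triangle. -/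
noncomputable def closesTriangle (i : ℕ) (X : Finset (Sym2 (Fin n))) : ℝ :=
  if i / n < i % n ∧ ¬ IsFree IsTriangle (pairOf n i) X then 1 else 0

theorem abs_closesTriangle_le (i : ℕ) (X : Finset (Sym2 (Fin n))) : |closesTriangle i X| ≤ 1 := by
  unfold closesTriangle; split_ifs <;> simp

theorem partialProb_zero (p : ℝ) : partialProb n p 0 = 1 := by
  have : pairsBelow n 0 = ∅ := rfl
  have h : IsIndep IsTriangle (∅ : Finset (Sym2 (Fin n))) := fun e he => by simp at he
  rw [partialProb, this, gibbsSum, Finset.powerset_empty, Finset.sum_singleton, if_pos h]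
  simp [bernoulliWeight]

theorem partialProb_succ (p : ℝ) (i : ℕ) : partialProb n p (i + 1)
    = partialProb n p i - p * gibbsSum IsTriangle (pairsBelow n i) p (closesTriangle i) := by
  classical
  by_cases hi : i / n < i % n
  · unfold partialProb
    rw [pairsBelow_succ_of_isCode hi, gibbsSum_insert isTripleSystem_isTriangle
      (pairOf_notMem_pairsBelow hi)]
    have h1 := gibbsSum_add (T := IsTriangle) (H := pairsBelow n i) (p := p)
      (fun X => if IsFree IsTriangle (pairOf n i) X then (1 : ℝ) else 0) (closesTriangle i)
    have h2 : gibbsSum IsTriangle (pairsBelow n i) p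
        (fun X => (if IsFree IsTriangle (pairOf n i) X then (1 : ℝ) else 0) + closesTriangle i X)
        = gibbsSum IsTriangle (pairsBelow n i) p (fun _ => 1) := by
      refine gibbsSum_congr fun X _ => ?_
      by_cases h : IsFree IsTriangle (pairOf n i) X <;> simp [closesTriangle, hi, h]
    rw [h2] at h1
    rw [h1]
    ring
  · have : gibbsSum IsTriangle (pairsBelow n i) p (closesTriangle i) = 0 := by
      have h1 := gibbsSum_mul (T := IsTriangle) (H := pairsBelow n i) (p := p) 0 (fun _ => 1)
      simp only [zero_mul] at h1
      exact (gibbsSum_congr fun X _ => by simp [closesTriangle, hi]).trans h1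
    rw [this, mul_zero, sub_zero, partialProb, partialProb, pairsBelow_succ_of_not_isCode hi]

theorem partialProb_pos {p : ℝ} (h0 : 0 ≤ p) (h1 : p < 1) (i : ℕ) : 0 < partialProb n p i :=
  gibbsSum_one_pos h0 h1

theorem one_sub_le_ratio {p : ℝ} (h0 : 0 ≤ p) (h1 : p < 1) (i : ℕ) :
    1 - p ≤ partialProb n p (i + 1) / partialProb n p i := by
  rw [le_div_iff₀ (partialProb_pos h0 h1 i), partialProb_succ]
  have : gibbsSum IsTriangle (pairsBelow n i) p (closesTriangle i) ≤ partialProb n p i :=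
    gibbsSum_mono h0 h1.le fun X _ => (abs_le.1 (abs_closesTriangle_le i X)).2
  nlinarith

theorem prod_ratio {p : ℝ} (h0 : 0 ≤ p) (h1 : p < 1) (i : ℕ) :
    ∏ j ∈ Finset.range i, (partialProb n p (j + 1) / partialProb n p j) = partialProb n p i := by
  induction i with
  | zero => rw [Finset.prod_range_zero, partialProb_zero]
  | succ i ih => rw [Finset.prod_range_succ, ih, mul_div_cancel₀ _ (partialProb_pos h0 h1 i).ne']

open Classical in
/-- The outcome of a trial: a sample of the random graph on the pairs with codes less than `i`,
conditioned on being triangle-free, is drawn, then the pair with code `i` is added with probability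
about `p`; the trial succeeds unless this creates a triangle. -/
noncomputable def trialFn (n : ℕ) [NeZero n] (k q t i : ℕ) (ω : ℕ → Bool) : ℕ :=
  if i / n < i % n ∧ drawFrom 0 k (tail^[2 * k * t] ω) < q ∧
    ¬ IsFree IsTriangle (pairOf n i) (iter (2 * k) (stepFn n k q i) t ∅ ω) then 0 else 1

theorem trialFn_le_one (k q t i : ℕ) (ω : ℕ → Bool) : trialFn n k q t i ω ≤ 1 := by
  unfold trialFn; split_ifs <;> simp

theorem dependsOnFirst_sampler (k q t i : ℕ) :
    DependsOnFirst (2 * k * t) (iter (2 * k) (stepFn n k q i) t ∅) :=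
  dependsOnFirst_iter (dependsOnFirst_stepFn k q i) t ∅

theorem dependsOnFirst_trialFn (k q t i : ℕ) :
    DependsOnFirst (2 * k * t + k) (trialFn n k q t i) := by
  classical
  exact (dependsOnFirst_sampler k q t i).seq (F := fun X ω => if i / n < i % n ∧
    drawFrom 0 k ω < q ∧ ¬ IsFree IsTriangle (pairOf n i) X then 0 else 1)
    (fun X => (dependsOnFirst_drawFrom 0 k).comp fun y => if i / n < i % n ∧
      y < q ∧ ¬ IsFree IsTriangle (pairOf n i) X then 0 else 1)

theorem coinE_trialFn {k q : ℕ} (hq : q ≤ 2 ^ k) (t i : ℕ) :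
    coinE (fun ω => (trialFn n k q t i ω : ℝ)) = 1 - (q / 2 ^ k : ℝ)
      * coinE (fun ω => closesTriangle i (iter (2 * k) (stepFn n k q i) t ∅ ω)) := by
  classical
  set F : Finset (Sym2 (Fin n)) → (ℕ → Bool) → ℝ := fun X ω =>
    1 + (-closesTriangle i X) * (if decide (drawFrom 0 k ω < q) = true then 1 else 0)
  have e1 : (fun ω => (trialFn n k q t i ω : ℝ))
      = fun ω => F (iter (2 * k) (stepFn n k q i) t ∅ ω) (tail^[2 * k * t] ω) := by
    funext ω
    simp only [trialFn, F, closesTriangle, decide_eq_true_eq]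
    split_ifs <;> simp_all
  have dF : ∀ X, DependsOnFirst k (F X) := fun X => (dependsOnFirst_drawFrom 0 k).comp fun y =>
    1 + (-closesTriangle i X) * (if decide (y < q) = true then (1 : ℝ) else 0)
  have e2 : ∀ X, coinE (F X) = 1 + (-(q / 2 ^ k : ℝ)) * closesTriangle i X := by
    intro X
    have := coinE_bernoulli hq fun b => 1 + (-closesTriangle i X) * (if b = true then (1 : ℝ) else 0)
    refine this.trans ?_
    simp
    ring
  have dS := dependsOnFirst_sampler (n := n) k q t i
  rw [e1, coinE_seq dS dF]
  simp only [e2]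
  rw [coinE_add (.const (L := 0) _) (dS.comp fun X => (-(q / 2 ^ k : ℝ)) * closesTriangle i X),
    coinE_const, coinE_mul]
  ring

/-- The probability of success is close to the ratio of two consecutive probabilities. -/
theorem abs_coinE_trialFn_sub_le {K k q : ℕ} {p : ℝ} (h0 : 0 ≤ p) (h1 : p < 1)
    (hq : q ≤ 2 ^ k) (hpq : |(q / 2 ^ k : ℝ) - p| ≤ 1 / 2 ^ k) (i : ℕ)
    (hK : ∀ X ⊆ pairsBelow n i, ∀ Y ⊆ pairsBelow n i,
      (avg (pairsBelow n i) (1 / (n : ℝ) ^ 2) p (coupled IsTriangle) ^ (K * n ^ 3 * k)) differ (X, Y)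
        ≤ (1 / 8) ^ k) :
    |coinE (fun ω => (trialFn n k q (K * n ^ 3 * k) i ω : ℝ))
      - partialProb n p (i + 1) / partialProb n p i| ≤ samplerError K n k + 1 / 2 ^ k := by
  have hZ := partialProb_pos (n := n) h0 h1 i
  have h2 := abs_coinE_sampler_sub_le h0 h1 hq hpq i hK (abs_closesTriangle_le i)
  rw [coinE_trialFn hq, partialProb_succ, sub_div, div_self hZ.ne', mul_div_assoc]
  have h3 : |coinE (fun ω => closesTriangle i
      (iter (2 * k) (stepFn n k q i) (K * n ^ 3 * k) ∅ ω))| ≤ 1 :=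
    abs_coinE_le ((dependsOnFirst_sampler k q _ i).comp (closesTriangle i))
      fun ω => abs_closesTriangle_le i _
  change |_ - gibbsSum IsTriangle (pairsBelow n i) p (closesTriangle i) / partialProb n p i| ≤ _ at h2
  set a := coinE (fun ω => closesTriangle i (iter (2 * k) (stepFn n k q i) (K * n ^ 3 * k) ∅ ω))
  set g := gibbsSum IsTriangle (pairsBelow n i) p (closesTriangle i) / partialProb n p i
  rw [show 1 - (q / 2 ^ k : ℝ) * a - (1 - p * g) = -((q / 2 ^ k - p) * a + p * (a - g)) by ring,
    abs_neg]
  refine (abs_add_le _ _).trans ?_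
  rw [abs_mul, abs_mul, abs_of_nonneg h0]
  have h4 := mul_le_mul hpq h3 (abs_nonneg _) (by positivity)
  have h5 := mul_le_mul h1.le h2 (abs_nonneg _) zero_le_one
  linarith

/-- The product of the numbers of successes, out of `S` trials each, over all codes below `i`. -/
noncomputable def countProd (n : ℕ) [NeZero n] (k q t S : ℕ) : ℕ → (ℕ → Bool) → ℕ
  | 0, _ => 1
  | i + 1, ω => successCount (2 * k * t + k) (trialFn n k q t i) S ω
      * countProd n k q t S i (tail^[(2 * k * t + k) * S] ω)

theorem countProd_eq (k q t S i : ℕ) (ω : ℕ → Bool) : countProd n k q t S i ω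
    = ∏ j ∈ Finset.range i, successCount (2 * k * t + k) (trialFn n k q t j) S
      (tail^[(2 * k * t + k) * S * (i - 1 - j)] ω) := by
  induction i generalizing ω with
  | zero => rfl
  | succ i ih =>
    rw [countProd, ih, Finset.prod_range_succ, mul_comm]
    congr 1
    · refine Finset.prod_congr rfl fun j hj => ?_
      have := Finset.mem_range.1 hj
      rw [← Function.iterate_add_apply, show i + 1 - 1 - j = i - 1 - j + 1 by omega, Nat.mul_succ]
    · simp

theorem dependsOnFirst_countProd (k q t S i : ℕ) :
    DependsOnFirst ((2 * k * t + k) * S * i) (countProd n k q t S i) := by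
  induction i with
  | zero => exact fun _ _ _ => rfl
  | succ i ih =>
    have := (dependsOnFirst_successCount (dependsOnFirst_trialFn (n := n) k q t i) S).seq
      (F := fun x ω => x * countProd n k q t S i ω) fun x => ih.comp fun y => x * y
    rw [Nat.mul_succ, add_comm]
    exact this

theorem exp_bounds {m x η : ℝ} (hm : 1 / 4 ≤ m) (hx : |x - m| ≤ 2 * η) (hη : η ≤ 1 / 16) :
    Real.exp (-(16 * η)) * m ≤ x ∧ x ≤ Real.exp (16 * η) * m := by
  obtain ⟨h1, h2⟩ := abs_le.1 hx
  have hη0 : 0 ≤ η := by linarith [abs_nonneg (x - m)]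
  constructor
  · have h3 : Real.exp (-(16 * η)) ≤ 1 - 8 * η := by
      rw [Real.exp_neg, inv_le_comm₀ (Real.exp_pos _) (by linarith)]
      refine le_trans ?_ (Real.add_one_le_exp _)
      rw [inv_le_iff_one_le_mul₀ (by linarith)]
      nlinarith
    nlinarith [mul_le_mul_of_nonneg_right h3 (by linarith : 0 ≤ m)]
  · have h3 := Real.add_one_le_exp (16 * η)
    nlinarith [mul_le_mul_of_nonneg_right h3 (by linarith : 0 ≤ m)]

/-- If all factors are estimated with error at most `2η`, the product is a relative
approximation. -/
theorem isRelApprox_of_close {p η ε : ℝ} (h0 : 0 ≤ p) (h1 : p ≤ 3 / 4) (hη : η ≤ 1 / 16) {N : ℕ}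
    (hε : N * (16 * η) ≤ ε) {x : ℕ → ℝ}
    (hx : ∀ i < N, |x i - partialProb n p (i + 1) / partialProb n p i| ≤ 2 * η) :
    IsRelApprox ε (∏ i ∈ Finset.range N, x i) (partialProb n p N) := by
  set m : ℕ → ℝ := fun i => partialProb n p (i + 1) / partialProb n p i with hm
  have hm4 : ∀ i, 1 / 4 ≤ m i := fun i => le_trans (by linarith)
    (one_sub_le_ratio h0 (by linarith) i)
  have hb : ∀ i ∈ Finset.range N, Real.exp (-(16 * η)) * m i ≤ x i ∧
      x i ≤ Real.exp (16 * η) * m i :=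
    fun i hi => exp_bounds (hm4 i) (hx i (Finset.mem_range.1 hi)) hη
  have hprod : ∏ i ∈ Finset.range N, m i = partialProb n p N := prod_ratio h0 (by linarith) N
  have hZ := partialProb_pos (n := n) h0 (by linarith) N
  have hlow := Finset.prod_le_prod (fun i _ => mul_nonneg (Real.exp_pos _).le
    (by linarith [hm4 i] : 0 ≤ m i)) fun i hi => (hb i hi).1
  have hup := Finset.prod_le_prod (fun i hi => le_trans (mul_nonneg (Real.exp_pos _).le
    (by linarith [hm4 i] : 0 ≤ m i)) (hb i hi).1) fun i hi => (hb i hi).2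
  rw [Finset.prod_mul_distrib, Finset.prod_const, Finset.card_range, hprod, ← Real.exp_nat_mul]
    at hlow hup
  have hpos : 0 < ∏ i ∈ Finset.range N, x i := lt_of_lt_of_le (by positivity) hlow
  refine ⟨hpos, ?_, ?_⟩
  · calc Real.exp (-ε) * ∏ i ∈ Finset.range N, x i
        ≤ Real.exp (-ε) * (Real.exp (N * (16 * η)) * partialProb n p N) :=
          mul_le_mul_of_nonneg_left hup (Real.exp_pos _).le
      _ ≤ partialProb n p N := by
          rw [← mul_assoc, ← Real.exp_add]
          exact mul_le_of_le_one_left hZ.le (Real.exp_le_one_iff.2 (by linarith))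
  · calc partialProb n p N = Real.exp (N * (16 * η)) * (Real.exp (N * -(16 * η)) * partialProb n p N) := by
          rw [← mul_assoc, ← Real.exp_add, show (N : ℝ) * (16 * η) + N * -(16 * η) = 0 by ring,
            Real.exp_zero, one_mul]
      _ ≤ Real.exp ε * ∏ i ∈ Finset.range N, x i :=
          mul_le_mul (Real.exp_le_exp.2 hε) hlow (by positivity) (Real.exp_pos _).le

open Classical in
/-- With probability at least `2/3`, the product of the estimated ratios is a relative
approximation. -/
theorem two_thirds_le_coinE {K k q S : ℕ} {p η ε : ℝ} (h0 : 0 ≤ p) (h1 : p ≤ 3 / 4)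
    (hq : q ≤ 2 ^ k) (hpq : |(q / 2 ^ k : ℝ) - p| ≤ 1 / 2 ^ k)
    (hK : ∀ i, ∀ X ⊆ pairsBelow n i, ∀ Y ⊆ pairsBelow n i,
      (avg (pairsBelow n i) (1 / (n : ℝ) ^ 2) p (coupled IsTriangle) ^ (K * n ^ 3 * k)) differ (X, Y)
        ≤ (1 / 8) ^ k)
    (hη0 : 0 < η) (hη : η ≤ 1 / 16) (hε : (n * n : ℕ) * (16 * η) ≤ ε)
    (herr : samplerError K n k + 1 / 2 ^ k ≤ η) (hS : 3 * (n * n : ℕ) ≤ S * η ^ 2) :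
    2 / 3 ≤ coinE (fun ω => if IsRelApprox ε
      ((countProd n k q (K * n ^ 3 * k) S (n * n) ω : ℝ) / (S ^ (n * n) : ℕ))
      (partialProb n p (n * n)) then 1 else 0) := by
  set t := K * n ^ 3 * k with ht
  set N := n * n with hN
  have hn := Nat.pos_of_neZero n
  have hN0 : 0 < N := Nat.mul_pos hn hn
  have hN0' : (0 : ℝ) < N := by exact_mod_cast hN0
  have hS0' : (0 : ℝ) < S := by
    by_contra h
    have : (S : ℝ) = 0 := le_antisymm (not_lt.1 h) (by positivity)
    rw [this] at hS
    linarith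
  have hS0 : 0 < S := by exact_mod_cast hS0'
  set κ := 2 * k * t + k with hκ
  set μ : ℕ → ℝ := fun i => coinE (fun ω => (trialFn n k q t i ω : ℝ)) with hμ
  set c : ℕ → (ℕ → Bool) → ℕ := fun i ω => successCount κ (trialFn n k q t i) S
    (tail^[κ * S * (N - 1 - i)] ω) with hc
  -- in the `i`th factor the fraction of successes is far from its mean
  set bad : ℕ → (ℕ → Bool) → ℝ := fun i ω => if η < |(c i ω : ℝ) / S - μ i| then 1 else 0 with hbad
  have dbad' : ∀ i, DependsOnFirst (κ * S) fun ω =>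
      if η < |(successCount κ (trialFn n k q t i) S ω : ℝ) / S - μ i| then (1 : ℝ) else 0 := fun i =>
    (dependsOnFirst_successCount (dependsOnFirst_trialFn k q t i) S).comp fun y =>
      if η < |(y : ℝ) / S - μ i| then (1 : ℝ) else 0
  have hEbad : ∀ i, coinE (bad i) ≤ 1 / (S * η ^ 2) := by
    intro i
    rw [hbad]
    refine (coinE_comp_tail (dbad' i) (κ * S * (N - 1 - i))).trans_le ?_
    exact coinE_deviation_le (dependsOnFirst_trialFn k q t i) (trialFn_le_one k q t i) hS0 hη0
  have dbad : ∀ i, DependsOnFirst (κ * S * N + κ * S) (bad i) := fun i =>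
    ((dbad' i).comp_tail (κ * S * (N - 1 - i))).mono
      (Nat.add_le_add_right (Nat.mul_le_mul_left _ (by omega)) _)
  have hsum : coinE (fun ω => ∑ i ∈ Finset.range N, bad i ω) ≤ 1 / 3 := by
    rw [coinE_sum _ dbad]
    refine (Finset.sum_le_sum fun i _ => hEbad i).trans ?_
    rw [Finset.sum_const, Finset.card_range, nsmul_eq_mul, mul_one_div,
      div_le_div_iff₀ (by positivity) (by norm_num)]
    linarith
  have hgood : ∀ ω, 1 + (-1) * ∑ i ∈ Finset.range N, bad i ω ≤ if IsRelApprox ε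
      ((countProd n k q t S N ω : ℝ) / (S ^ N : ℕ)) (partialProb n p N) then 1 else 0 := by
    intro ω
    have hnn : ∀ i, 0 ≤ bad i ω := fun i => by simp only [hbad]; split_ifs <;> norm_num
    split_ifs with h
    · have := Finset.sum_nonneg fun i (_ : i ∈ Finset.range N) => hnn i
      linarith
    · have : ∃ i ∈ Finset.range N, bad i ω = 1 := by
        by_contra hno
        push Not at hno
        refine h ?_
        have e : (countProd n k q t S N ω : ℝ) / (S ^ N : ℕ)
            = ∏ i ∈ Finset.range N, ((c i ω : ℝ) / S) := by
          rw [countProd_eq, Finset.prod_div_distrib, Finset.prod_const, Finset.card_range]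
          push_cast
          rfl
        rw [e]
        refine isRelApprox_of_close h0 h1 hη hε fun i hi => ?_
        have h2 : |(c i ω : ℝ) / S - μ i| ≤ η := by
          have := hno i (Finset.mem_range.2 hi)
          simp only [hbad] at this
          split_ifs at this with h3
          · exact absurd rfl this
          · exact not_lt.1 h3
        have h3 := abs_coinE_trialFn_sub_le h0 (by linarith) hq hpq i (hK i)
        have h4 := abs_sub_le ((c i ω : ℝ) / S) (μ i)
          (partialProb n p (i + 1) / partialProb n p i)
        have h5 : |μ i - partialProb n p (i + 1) / partialProb n p i| ≤ η := h3.trans herr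
        linarith
      obtain ⟨i, hi, h1⟩ := this
      have := Finset.single_le_sum (f := fun i => bad i ω) (fun i _ => hnn i) hi
      simp only [h1] at this
      linarith
  have dsum : DependsOnFirst (κ * S * N + κ * S) fun ω => ∑ i ∈ Finset.range N, bad i ω :=
    fun ω ω' h => Finset.sum_congr rfl fun i _ => dbad i ω ω' h
  have dsum' : DependsOnFirst (κ * S * N + κ * S) fun ω => (-1) * ∑ i ∈ Finset.range N, bad i ω :=
    dsum.comp fun y => (-1) * y
  have main := coinE_mono ((dsum.comp fun y => 1 + (-1) * y))
    ((dependsOnFirst_countProd (n := n) k q t S N).comp fun y => if IsRelApprox ε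
      ((y : ℝ) / (S ^ N : ℕ)) (partialProb n p N) then (1 : ℝ) else 0) hgood
  rw [coinE_add (.const (L := 0) _) dsum', coinE_const, coinE_mul] at main
  linarith

end Telescope

/-! ### The sampling and counting programs -/

section Counting

/-! Further variables of the counting program: `11` a loop counter, `12` the number of successes,
`13` and `14` the numerator and the denominator of the estimate, `15` the number of trials. -/

/-- One trial for the pair with code `10`: count a success in the variable `12`, unless the pair is
added to the sample and closes a triangle. -/
def trialProg : Prog :=
  .seq samplerProg (.seq (setVar 6 (var 10)) (.seq drawProg (.seq commonProg
    (.cond (.mul (.mul (.sub colExpr rowExpr) (.sub (.query (var 2)) (var 5))) (var 7))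
      .skip (setVar 12 (.add (var 12) (.const 1)))))))

/-- Count the successes among as many trials as the variable `15` says. -/
def countProg : Prog :=
  .seq (setVar 12 (.const 0)) (.seq (setVar 11 (var 15)) (countdown 11 trialProg))

/-- Multiply the fractions of successes for all codes. -/
def productProg : Prog :=
  .seq (setVar 13 (.const 1)) (.seq (setVar 14 (.const 1)) (.seq (setVar 10 (.mul (var 0) (var 0)))
    (countdown 10 (.seq countProg (.seq (setVar 13 (.mul (var 13) (var 12)))
      (setVar 14 (.mul (var 14) (var 15))))))))

/-- From the input `n` and `E = ⌈1/ε⌉`, compute the number `c₀ (n + E)` of bits of the random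
numbers and the number `K n³ c₀ (n + E)` of steps of the dynamics. -/
def setupProg (c₀ K : ℕ) : Prog :=
  .seq (setVar 2 (.mul (.const c₀) (.add (var 0) (.get 0 (.const 1)))))
    (setVar 3 (.mul (.mul (.const K) (.mul (.mul (var 0) (var 0)) (var 0))) (var 2)))

/-- The sampling algorithm. -/
def sampleMain (c₀ K : ℕ) : Prog :=
  .seq (setupProg c₀ K) (.seq (setVar 10 (.mul (var 0) (var 0))) samplerProg)

/-- The number `768 n⁶ E²` of trials. -/
def trialsExpr : Expr :=
  .mul (.const 768) (.mul (.mul (.mul (.mul (var 0) (var 0)) (.mul (var 0) (var 0)))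
    (.mul (var 0) (var 0))) (.mul (.get 0 (.const 1)) (.get 0 (.const 1))))

/-- The counting algorithm. -/
def countMain (c₀ K : ℕ) : Prog :=
  .seq (setupProg c₀ K) (.seq (setVar 15 trialsExpr) (.seq productProg
    (.seq (.assign 1 (.const 0) (var 13)) (.assign 1 (.const 1) (var 14)))))

variable {O : ℕ → ℕ} {b : ℕ} {n : ℕ} [NeZero n]

theorem runs_trial (hO : ∀ k, O k ≤ 2 ^ k) {k i t c : ℕ} (hk : k ≤ b) (hn : n * n ≤ b)
    (ht : t ≤ b) (hc : c + 1 < 2 ^ b) {s : State} (hs : IsBounded b s.mem) (h0 : s.mem 0 0 = n)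
    (h2 : s.mem 2 0 = k) (h3 : s.mem 3 0 = t) (h10 : s.mem 10 0 = i) (h12 : s.mem 12 0 = c) :
    Runs O b trialProg s fun s' => s'.coins = tail^[2 * k * t + k] s.coins ∧
      s'.mem 12 0 = c + trialFn n k (O k) t i s.coins ∧
      AgreeOff [1, 4, 5, 6, 7, 8, 9, 12, 17] s.mem s'.mem := by
  classical
  have hn1 : 1 ≤ n := Nat.pos_of_neZero n
  have hnn : n ≤ n * n := Nat.le_mul_self n
  have hb : 1 ≤ b := by omega
  refine Runs.seq (runs_sampler hO hk hn ht hs h0 h2 h3 h10) ?_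
  rintro s1 hs1 ⟨c1, X1, a1⟩
  set X := iter (2 * k) (stepFn n k (O k) i) t ∅ s.coins with hX
  have m10 : s1.mem 10 0 = i := by rw [a1 10 (by simp), h10]
  have e1 : (var 10).eval O s1.mem = i := by simp [var, Expr.eval, m10]
  refine Runs.setVar_seq hO hs1 trivial (by rw [e1, ← m10]; exact hs1 10 0) ?_
  rw [e1]
  intro hs2
  have a2 := (a1.trans (agreeOff_write s1 6 0 i)).mono (S' := [1, 4, 5, 6, 7, 8, 9, 17]) (by simp)
  refine Runs.seq (runs_draw hO hk hb hs2 (by rw [a2 2 (by simp), h2])) ?_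
  rintro s3 hs3 ⟨c3, v3, a3⟩
  have a4 := (a2.trans a3).mono (S' := [1, 4, 5, 6, 7, 8, 9, 17]) (by simp)
  have e6 : s3.mem 6 0 = i := by rw [a3 6 (by simp)]; simp [mem_write]
  refine Runs.seq (runs_common hO (hnn.trans hn) hb hs3 (by rw [a4 0 (by simp), h0]) e6) ?_
  rintro s5 hs5 ⟨c5, v5, a5⟩
  have a6 := (a4.trans a5).mono (S' := [1, 4, 5, 6, 7, 8, 9, 17]) (by simp)
  have hX3 : Holds n X s3.mem := fun l hl => by
    rw [a3 1 (by simp)]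
    simpa [mem_write] using X1 l hl
  have hcoins : s5.coins = tail^[2 * k * t + k] s.coins := by
    rw [c5, c3, coins_write, c1, ← Function.iterate_add_apply, add_comm]
  have m0 : s5.mem 0 0 = n := by rw [a6 0 (by simp), h0]
  have m2 : s5.mem 2 0 = k := by rw [a6 2 (by simp), h2]
  have m12 : s5.mem 12 0 = c := by rw [a6 12 (by simp), h12]
  have m6 : s5.mem 6 0 = i := by rw [a5 6 (by simp), e6]
  have m5 : s5.mem 5 0 = drawFrom 0 k (tail^[2 * k * t] s.coins) := by
    rw [a5 5 (by simp), v3, coins_write, c1]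
  have ev : (Expr.mul (.mul (.sub colExpr rowExpr) (.sub (.query (var 2)) (var 5))) (var 7)).eval O
      s5.mem = (i % n - i / n) * (O k - drawFrom 0 k (tail^[2 * k * t] s.coins)) * s5.mem 7 0 := by
    simp [Expr.eval, colExpr, rowExpr, var, m0, m2, m5, m6]
  have hfail : (i % n - i / n) * (O k - drawFrom 0 k (tail^[2 * k * t] s.coins)) * s5.mem 7 0 ≠ 0
      ↔ (i / n < i % n ∧ drawFrom 0 k (tail^[2 * k * t] s.coins) < O k ∧
        ¬ IsFree IsTriangle (pairOf n i) X) := by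
    rw [mul_ne_zero_iff, mul_ne_zero_iff, Nat.sub_ne_zero_iff_lt, Nat.sub_ne_zero_iff_lt, and_assoc]
    refine and_congr_right fun hi => and_congr_right fun _ => ?_
    rw [v5]
    simp only [hX3.exists_common_iff hi]
    split_ifs <;> simp_all
  refine Runs.cond hO hs5 (by simp [Expr.QueriesLe, colExpr, rowExpr, var, Expr.eval, m2, hk]) ?_ ?_
  · rw [ev]
    intro h
    have : trialFn n k (O k) t i s.coins = 0 := if_pos (hfail.1 h)
    exact Runs.skip hs5 ⟨hcoins, by rw [m12, this, add_zero], a6.mono (by simp)⟩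
  · rw [ev]
    intro h
    have h1 : trialFn n k (O k) t i s.coins = 1 := if_neg fun h' => hfail.2 h' h
    have e2 : (Expr.add (var 12) (.const 1)).eval O s5.mem = c + 1 := by
      simp [Expr.eval, var, m12]
    refine Runs.setVar hO hs5 ⟨trivial, trivial⟩ (by rw [e2]; exact hc) ?_
    rw [e2]
    exact ⟨hcoins, by simp [mem_write, h1], (a6.trans (agreeOff_write _ _ _ _)).mono (by simp)⟩

theorem iter_add_le {κ : ℕ} {Y : (ℕ → Bool) → ℕ} (hY : ∀ ω, Y ω ≤ 1) (t x : ℕ) (ω : ℕ → Bool) :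
    x ≤ iter κ (fun s ω => s + Y ω) t x ω ∧ iter κ (fun s ω => s + Y ω) t x ω ≤ x + t := by
  induction t generalizing x ω with
  | zero => simp [iter]
  | succ t ih =>
    have h1 := ih (x + Y ω) (tail^[κ] ω)
    have h2 := hY ω
    simp only [iter]
    omega

theorem runs_count (hO : ∀ k, O k ≤ 2 ^ k) {k i t S : ℕ} (hk : k ≤ b) (hn : n * n ≤ b)
    (ht : t ≤ b) (hS : S ≤ b) {s : State} (hs : IsBounded b s.mem) (h0 : s.mem 0 0 = n)
    (h2 : s.mem 2 0 = k) (h3 : s.mem 3 0 = t) (h10 : s.mem 10 0 = i) (h15 : s.mem 15 0 = S) :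
    Runs O b countProg s fun s' => s'.coins = tail^[(2 * k * t + k) * S] s.coins ∧
      s'.mem 12 0 = successCount (2 * k * t + k) (trialFn n k (O k) t i) S s.coins ∧
      AgreeOff [1, 4, 5, 6, 7, 8, 9, 11, 12, 17] s.mem s'.mem := by
  have hbb : b < 2 ^ b := Nat.lt_two_pow_self
  set κ := 2 * k * t + k with hκ
  set R := successCount κ (trialFn n k (O k) t i) S s.coins with hR
  refine Runs.setVar_seq hO hs trivial (by simp [Expr.eval]) fun hs1 => ?_
  have e1 : (var 15).eval O (s.write 12 0 ((Expr.const 0).eval O s.mem)).mem = S := by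
    simp [var, Expr.eval, mem_write, h15]
  refine Runs.setVar_seq hO hs1 trivial (by rw [e1]; omega) ?_
  rw [e1]
  intro hs2
  have hle := iter_add_le (κ := κ) (trialFn_le_one (n := n) k (O k) t i)
  -- invariant: the `j` remaining trials bring the present count to the final result `R`
  refine (Runs.countdown hO (fun j s' => tail^[κ * j] s'.coins = tail^[κ * S] s.coins ∧
    iter κ (fun s ω => s + trialFn n k (O k) t i ω) j (s'.mem 12 0) s'.coins = R ∧
    s'.mem 12 0 + j ≤ S ∧
    AgreeOff [1, 4, 5, 6, 7, 8, 9, 11, 12, 17] s.mem s'.mem) hS ?_ hs2 ?_ ?_).mono ?_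
  · rintro j s' hj hs' hc ⟨g1, g2, g3, g4⟩
    have a5 := (g4.trans (agreeOff_write s' 11 0 j)).mono
      (S' := [1, 4, 5, 6, 7, 8, 9, 11, 12, 17]) (by simp)
    refine (runs_trial hO hk hn ht (c := s'.mem 12 0) (by omega) hs' (by rw [a5 0 (by simp), h0])
      (by rw [a5 2 (by simp), h2]) (by rw [a5 3 (by simp), h3]) (by rw [a5 10 (by simp), h10])
      (by simp [mem_write])).mono ?_
    rintro s'' _ ⟨f1, f2, f3⟩
    refine ⟨by rw [f3 11 (by simp)]; simp [mem_write], ?_, ?_, ?_, (a5.trans f3).mono (by simp)⟩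
    · rw [f1, ← Function.iterate_add_apply, ← g1, Nat.mul_succ]; rfl
    · rw [f1, f2, ← g2]; rfl
    · have := trialFn_le_one (n := n) k (O k) t i s'.coins
      rw [f2, coins_write]
      omega
  · simp [mem_write]
  · refine ⟨rfl, ?_, ?_, ((agreeOff_write _ _ _ _).trans (agreeOff_write _ _ _ _)).mono (by simp)⟩
    · simp [mem_write, Expr.eval, hR, successCount]
    · simp [mem_write, Expr.eval]
  · rintro s' _ ⟨-, g1, g2, -, g4⟩
    exact ⟨by simpa using g1, by simpa [iter] using g2, g4⟩

theorem runs_product (hO : ∀ k, O k ≤ 2 ^ k) {k t S : ℕ} (hk : k ≤ b) (hn : n * n ≤ b)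
    (ht : t ≤ b) (hS : S ≤ b) (hS1 : 1 ≤ S) (hSn : S ^ (n * n) < 2 ^ b) {s : State}
    (hs : IsBounded b s.mem) (h0 : s.mem 0 0 = n)
    (h2 : s.mem 2 0 = k) (h3 : s.mem 3 0 = t) (h15 : s.mem 15 0 = S) :
    Runs O b productProg s fun s' =>
      s'.mem 13 0 = countProd n k (O k) t S (n * n) s.coins ∧ s'.mem 14 0 = S ^ (n * n) := by
  have hbb : b < 2 ^ b := Nat.lt_two_pow_self
  have hn1 : 1 ≤ n * n := Nat.mul_pos (Nat.pos_of_neZero n) (Nat.pos_of_neZero n)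
  have h1b : 1 < 2 ^ b := by omega
  refine Runs.setVar_seq hO hs trivial (by simpa [Expr.eval] using by omega) fun hs1 => ?_
  refine Runs.setVar_seq hO hs1 trivial (by simpa [Expr.eval] using by omega) fun hs2 => ?_
  have e1 : (Expr.mul (var 0) (var 0)).eval O ((s.write 13 0 ((Expr.const 1).eval O s.mem)).write 14 0
      ((Expr.const 1).eval O (s.write 13 0 ((Expr.const 1).eval O s.mem)).mem)).mem = n * n := by
    simp [var, Expr.eval, mem_write, h0]
  refine Runs.setVar_seq hO hs2 ⟨trivial, trivial⟩ (by rw [e1]; omega) ?_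
  rw [e1]
  intro hs3
  set N := n * n with hN
  -- invariant: the present numerator times the factors of the `j` remaining codes is the final one
  refine (Runs.countdown hO (fun j s' => s'.mem 13 0 * countProd n k (O k) t S j s'.coins
      = countProd n k (O k) t S N s.coins ∧
    s'.mem 13 0 ≤ S ^ (N - j) ∧ s'.mem 14 0 = S ^ (N - j) ∧
    AgreeOff [1, 4, 5, 6, 7, 8, 9, 10, 11, 12, 13, 14, 17] s.mem s'.mem) hn ?_ hs3 ?_ ?_).mono ?_
  · rintro j s' hj hs' hc ⟨g1, g2, g3, g4⟩
    have a5 := (g4.trans (agreeOff_write s' 10 0 j)).mono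
      (S' := [1, 4, 5, 6, 7, 8, 9, 10, 11, 12, 13, 14, 17]) (by simp)
    refine Runs.seq (runs_count (n := n) (i := j) hO hk hn ht hS hs' (by rw [a5 0 (by simp), h0])
      (by rw [a5 2 (by simp), h2]) (by rw [a5 3 (by simp), h3]) (by simp [mem_write])
      (by rw [a5 15 (by simp), h15])) ?_
    rintro s1 hs1 ⟨c1, v1, a1⟩
    have a6 := (a5.trans a1).mono (S' := [1, 4, 5, 6, 7, 8, 9, 10, 11, 12, 13, 14, 17]) (by simp)
    have m13 : s1.mem 13 0 = s'.mem 13 0 := by rw [a1 13 (by simp)]; simp [mem_write]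
    have m14 : s1.mem 14 0 = s'.mem 14 0 := by rw [a1 14 (by simp)]; simp [mem_write]
    have m15 : s1.mem 15 0 = S := by rw [a6 15 (by simp), h15]
    have m10 : s1.mem 10 0 = j := by rw [a1 10 (by simp)]; simp [mem_write]
    have hcS : s1.mem 12 0 ≤ S := by
      rw [v1]
      simpa [successCount] using (iter_add_le (κ := 2 * k * t + k)
        (trialFn_le_one (n := n) k (O k) t j) S 0 (s'.write 10 0 j).coins).2
    have hpow : S ^ (N - j) = S ^ (N - (j + 1)) * S := by
      rw [← pow_succ]; congr 1; omega
    have hle : S ^ (N - j) ≤ S ^ N := Nat.pow_le_pow_right hS1 (by omega)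
    have e2 : (Expr.mul (var 13) (var 12)).eval O s1.mem = s'.mem 13 0 * s1.mem 12 0 := by
      simp [var, Expr.eval, m13]
    have hlt : s'.mem 13 0 * s1.mem 12 0 ≤ S ^ (N - j) := by
      rw [hpow]; exact Nat.mul_le_mul g2 hcS
    refine Runs.setVar_seq hO hs1 ⟨trivial, trivial⟩ (by rw [e2]; omega) ?_
    rw [e2]
    intro hs4
    have e3 : (Expr.mul (var 14) (var 15)).eval O (s1.write 13 0 (s'.mem 13 0 * s1.mem 12 0)).mem
        = S ^ (N - j) := by
      simp [var, Expr.eval, mem_write, m14, m15, g3, hpow]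
    refine Runs.setVar hO hs4 ⟨trivial, trivial⟩ (by rw [e3]; omega) ?_
    rw [e3]
    refine ⟨by simp [mem_write, m10], ?_, by simpa [mem_write] using hlt, by simp [mem_write], ?_⟩
    · rw [← g1]
      simp only [mem_write, coins_write, c1, v1, countProd]
      simp [mul_assoc]
    · exact ((a6.trans (agreeOff_write _ _ _ _)).trans (agreeOff_write _ _ _ _)).mono (by simp)
  · simp [mem_write]
  · refine ⟨?_, ?_, ?_, (((agreeOff_write _ _ _ _).trans (agreeOff_write _ _ _ _)).trans
      (agreeOff_write _ _ _ _)).mono (by simp)⟩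
    · simp [mem_write, Expr.eval]
    · simp [mem_write, Expr.eval]
    · simp [mem_write, Expr.eval]
  · rintro s' _ ⟨-, g1, -, g3, -⟩
    exact ⟨by simpa [countProd] using g1, by simpa using g3⟩

omit [NeZero n] in
theorem runs_setup (hO : ∀ k, O k ≤ 2 ^ k) {c₀ K E : ℕ} (hk : c₀ * (n + E) ≤ b)
    (ht : K * n ^ 3 * (c₀ * (n + E)) ≤ b) {s : State} (hs : IsBounded b s.mem)
    (h0 : s.mem 0 0 = n) (hE : s.mem 0 1 = E) :
    Runs O b (setupProg c₀ K) s fun s' => s'.coins = s.coins ∧ s'.mem 2 0 = c₀ * (n + E) ∧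
      s'.mem 3 0 = K * n ^ 3 * (c₀ * (n + E)) ∧ AgreeOff [2, 3] s.mem s'.mem := by
  have hbb : b < 2 ^ b := Nat.lt_two_pow_self
  have e1 : (Expr.mul (.const c₀) (.add (var 0) (.get 0 (.const 1)))).eval O s.mem
      = c₀ * (n + E) := by simp [Expr.eval, var, h0, hE]
  refine Runs.setVar_seq hO hs ⟨trivial, trivial, trivial⟩ (by rw [e1]; omega) ?_
  rw [e1]
  intro hs1
  have e2 : (Expr.mul (.mul (.const K) (.mul (.mul (var 0) (var 0)) (var 0))) (var 2)).eval O
      (s.write 2 0 (c₀ * (n + E))).mem = K * n ^ 3 * (c₀ * (n + E)) := by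
    simp only [Expr.eval, var, mem_write]
    simp [h0]
    ring_nf
    simp
  refine Runs.setVar hO hs1 (by simp [Expr.QueriesLe, var]) (by rw [e2]; omega) ?_
  rw [e2]
  exact ⟨rfl, by simp [mem_write], by simp [mem_write],
    ((agreeOff_write _ _ _ _).trans (agreeOff_write _ _ _ _)).mono (by simp)⟩

theorem runs_sampleMain (hO : ∀ k, O k ≤ 2 ^ k) {c₀ K E : ℕ} (hk : c₀ * (n + E) ≤ b)
    (ht : K * n ^ 3 * (c₀ * (n + E)) ≤ b) (hn : n * n ≤ b) {s : State} (hs : IsBounded b s.mem)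
    (h0 : s.mem 0 0 = n) (hE : s.mem 0 1 = E) :
    Runs O b (sampleMain c₀ K) s fun s' => Holds n (iter (2 * (c₀ * (n + E)))
      (stepFn n (c₀ * (n + E)) (O (c₀ * (n + E))) (n * n)) (K * n ^ 3 * (c₀ * (n + E))) ∅ s.coins)
      s'.mem := by
  have hbb : b < 2 ^ b := Nat.lt_two_pow_self
  refine Runs.seq (runs_setup hO hk ht hs h0 hE) ?_
  rintro s1 hs1 ⟨c1, v2, v3, a1⟩
  have e1 : (Expr.mul (var 0) (var 0)).eval O s1.mem = n * n := by
    simp [Expr.eval, var, a1 0 (by simp), h0]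
  refine Runs.setVar_seq hO hs1 ⟨trivial, trivial⟩ (by rw [e1]; omega) ?_
  rw [e1]
  intro hs2
  have a2 := (a1.trans (agreeOff_write s1 10 0 (n * n))).mono (S' := [2, 3, 10]) (by simp)
  refine (runs_sampler hO hk hn ht hs2 (by rw [a2 0 (by simp), h0]) (i := n * n)
    (by simp [mem_write, v2]) (by simp [mem_write, v3]) (by simp [mem_write])).mono ?_
  rintro s' _ ⟨-, h, -⟩
  rwa [coins_write, c1] at h

theorem runs_countMain (hO : ∀ k, O k ≤ 2 ^ k) {c₀ K E S : ℕ} (hSdef : S = 768 * n ^ 6 * E ^ 2)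
    (hk : c₀ * (n + E) ≤ b) (ht : K * n ^ 3 * (c₀ * (n + E)) ≤ b) (hn : n * n ≤ b) (hS : S ≤ b)
    (hS1 : 1 ≤ S) (hSn : S ^ (n * n) < 2 ^ b) {s : State} (hs : IsBounded b s.mem)
    (h0 : s.mem 0 0 = n) (hE : s.mem 0 1 = E) :
    Runs O b (countMain c₀ K) s fun s' => s'.outNumber
      = (countProd n (c₀ * (n + E)) (O (c₀ * (n + E))) (K * n ^ 3 * (c₀ * (n + E))) S (n * n)
        s.coins : ℝ) / (S ^ (n * n) : ℕ) := by
  have hbb : b < 2 ^ b := Nat.lt_two_pow_self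
  refine Runs.seq (runs_setup hO hk ht hs h0 hE) ?_
  rintro s1 hs1 ⟨c1, v2, v3, a1⟩
  have e1 : trialsExpr.eval O s1.mem = S := by
    simp only [trialsExpr, Expr.eval, var, a1 0 (by simp), h0, hE, hSdef]
    ring
  refine Runs.setVar_seq hO hs1 (by simp [trialsExpr, Expr.QueriesLe, var]) (by rw [e1]; omega) ?_
  rw [e1]
  intro hs2
  have a2 := (a1.trans (agreeOff_write s1 15 0 S)).mono (S' := [2, 3, 15]) (by simp)
  refine Runs.seq (runs_product (n := n) hO hk hn ht hS hS1 hSn hs2 (by rw [a2 0 (by simp), h0])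
    (by simp [mem_write, v2]) (by simp [mem_write, v3]) (by simp [mem_write])) ?_
  rintro s3 hs3 ⟨v13, v14⟩
  have e2 : (var 13).eval O s3.mem = s3.mem 13 0 := rfl
  refine Runs.seq (Φ := fun s' => s' = s3.write 1 0 (s3.mem 13 0)) (Runs.assign hO hs3 trivial trivial
    (hs3 13 0) rfl) ?_
  rintro s4 hs4 rfl
  refine Runs.assign hO hs4 trivial trivial (hs4 14 0) ?_
  simp only [State.outNumber, mem_write, Expr.eval, var]
  rw [coins_write, c1] at v13
  simp [v13, v14]

end Counting

/-! ### Choice of the parameters -/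

section Parameters

/-- With `c₀ (n + E)` bits, for a large constant `c₀`, the sampler is as precise as needed. -/
theorem exists_samplerError_le (K : ℕ) : ∃ c₀ : ℕ, ∀ n E : ℕ, 1 ≤ n → 1 ≤ E →
    samplerError K n (c₀ * (n + E)) + 1 / 2 ^ (c₀ * (n + E)) ≤ 1 / (16 * (n : ℝ) ^ 2 * E) := by
  set A := 16 * (4 * K + 3) with hA
  set e := A + 9 with he
  refine ⟨9 + 2 * e, fun n E hn hE => ?_⟩
  set m := n + E with hm
  set k := (9 + 2 * e) * m with hk
  have hm1 : 1 ≤ m := by omega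
  -- the bits are split into `9 m` ones, which absorb `m ^ 9`, and `2 e m` others, which absorb `A
  -- c₀`
  have hnat : A * (m ^ 8 * k) ≤ 2 ^ k := by
    have h1 : ∀ r : ℕ, 9 + 2 * (r + 9) ≤ 2 ^ (r + 9) := fun r => by
      induction r with
      | zero => norm_num
      | succ r ih => rw [show r + 1 + 9 = (r + 9) + 1 by ring, pow_succ]; omega
    have h2 : A ≤ 2 ^ e := by
      have : e < 2 ^ e := Nat.lt_two_pow_self
      omega
    have h3 : m ^ 9 ≤ 2 ^ (9 * m) := by
      rw [mul_comm 9 m, pow_mul]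
      exact Nat.pow_le_pow_left Nat.lt_two_pow_self.le 9
    have h4 : 2 ^ (e + e) ≤ 2 ^ (2 * e * m) := Nat.pow_le_pow_right (by norm_num) (by nlinarith)
    calc A * (m ^ 8 * k) = A * (9 + 2 * e) * m ^ 9 := by rw [hk]; ring
      _ ≤ 2 ^ e * 2 ^ e * 2 ^ (9 * m) := Nat.mul_le_mul (Nat.mul_le_mul h2 (h1 A)) h3
      _ ≤ 2 ^ (2 * e * m) * 2 ^ (9 * m) := Nat.mul_le_mul_right _ (by rwa [← pow_add])
      _ = 2 ^ k := by rw [← pow_add, hk]; ring_nf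
  have hreal : 16 * (4 * (K : ℝ) + 3) * ((m : ℝ) ^ 8 * k) ≤ 2 ^ k := by exact_mod_cast hnat
  have hn' : (1 : ℝ) ≤ n := by exact_mod_cast hn
  have hE' : (1 : ℝ) ≤ E := by exact_mod_cast hE
  have hm' : (m : ℝ) = n + E := by rw [hm]; push_cast; ring
  have hnm : (n : ℝ) ≤ m := by linarith
  have hEm : (E : ℝ) ≤ m := by linarith
  have hk1 : (1 : ℝ) ≤ k := by
    have : 1 ≤ k := Nat.mul_pos (by omega) hm1
    exact_mod_cast this
  have hpow : (0 : ℝ) < 2 ^ k := by positivity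
  have hm5 : (1 : ℝ) ≤ (m : ℝ) ^ 5 * k := by
    have h := one_le_pow₀ (n := 5) (hn'.trans hnm)
    nlinarith
  have h8 : (1 / 8 : ℝ) ^ k ≤ 1 / 2 ^ k := by
    rw [div_pow, one_pow]
    exact one_div_le_one_div_of_le hpow (pow_le_pow_left₀ (by norm_num) (by norm_num) k)
  have h5 : (K * n ^ 3 * k : ℕ) * (2 * (n : ℝ) ^ 2 + 2) ≤ 4 * K * ((m : ℝ) ^ 5 * k) := by
    push_cast
    have h6 : 2 * (n : ℝ) ^ 2 + 2 ≤ 4 * (m : ℝ) ^ 2 := by nlinarith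
    have h7 : (n : ℝ) ^ 3 ≤ (m : ℝ) ^ 3 := pow_le_pow_left₀ (by linarith) hnm 3
    calc (K : ℝ) * n ^ 3 * k * (2 * (n : ℝ) ^ 2 + 2) ≤ K * m ^ 3 * k * (4 * (m : ℝ) ^ 2) := by
          gcongr
      _ = _ := by ring
  have h9 : samplerError K n k + 1 / 2 ^ k ≤ (4 * K + 3) * ((m : ℝ) ^ 5 * k) / 2 ^ k := by
    unfold samplerError
    have e1 : ((K * n ^ 3 * k : ℕ) : ℝ) * ((2 * (n : ℝ) ^ 2 + 2) / 2 ^ k)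
        ≤ 4 * K * ((m : ℝ) ^ 5 * k) / 2 ^ k := by
      rw [← mul_div_assoc]; gcongr
    have e2 : 3 * (1 / 2 ^ k) ≤ 3 * ((m : ℝ) ^ 5 * k) / 2 ^ k := by
      rw [mul_one_div]; gcongr; linarith
    have e3 : (4 * K + 3) * ((m : ℝ) ^ 5 * k) / 2 ^ k
        = 4 * K * ((m : ℝ) ^ 5 * k) / 2 ^ k + 3 * ((m : ℝ) ^ 5 * k) / 2 ^ k := by ring
    linarith
  refine h9.trans ?_
  rw [div_le_div_iff₀ hpow (by positivity)]
  have h10 : 16 * (n : ℝ) ^ 2 * E ≤ 16 * (m : ℝ) ^ 3 := by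
    have : (n : ℝ) ^ 2 * E ≤ (m : ℝ) ^ 2 * m := by gcongr
    linarith [show (m : ℝ) ^ 2 * m = (m : ℝ) ^ 3 by ring]
  calc (4 * K + 3) * ((m : ℝ) ^ 5 * k) * (16 * (n : ℝ) ^ 2 * E)
      ≤ (4 * K + 3) * ((m : ℝ) ^ 5 * k) * (16 * (m : ℝ) ^ 3) := by gcongr
    _ = 16 * (4 * (K : ℝ) + 3) * ((m : ℝ) ^ 8 * k) := by ring
    _ ≤ 1 * 2 ^ k := by rw [one_mul]; exact hreal

/-- The number of trials for each pair that the counting program makes. -/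
def numTrials (n E : ℕ) : ℕ := 768 * n ^ 6 * E ^ 2

/-- A bound for the number of iterations of all loops, and for the binary lengths of all numbers. -/
def sizeBound (c₀ K n E : ℕ) : ℕ :=
  c₀ * (n + E) + K * n ^ 3 * (c₀ * (n + E)) + n * n + numTrials n E * (n * n) + numTrials n E
    + n + E + 1

theorem numTrials_pow_lt (c₀ K n E : ℕ) : numTrials n E ^ (n * n) < 2 ^ sizeBound c₀ K n E := by
  calc numTrials n E ^ (n * n) ≤ (2 ^ numTrials n E) ^ (n * n) :=
        Nat.pow_le_pow_left Nat.lt_two_pow_self.le _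
    _ = 2 ^ (numTrials n E * (n * n)) := (pow_mul _ _ _).symm
    _ < 2 ^ sizeBound c₀ K n E := Nat.pow_lt_pow_right (by norm_num) (by unfold sizeBound; omega)

/-- The constant `1540 = 1 + 768 + 768 + 1 + 2` collects the terms of `sizeBound` without `c₀`. -/
theorem sizeBound_succ_le (c₀ K : ℕ) {n E : ℕ} (hn : 1 ≤ n) :
    sizeBound c₀ K n E + 1 ≤ (c₀ + K * c₀ + 1540) * (n + E) ^ 10 := by
  set m := n + E with hm
  have hm1 : 1 ≤ m := by omega
  have hp : ∀ j, j ≤ 10 → m ^ j ≤ m ^ 10 := fun j hj => Nat.pow_le_pow_right hm1 hj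
  have hnm : n ≤ m := by omega
  have hEm : E ≤ m := by omega
  have h1 : c₀ * m ≤ c₀ * m ^ 10 := Nat.mul_le_mul_left _ (by simpa using hp 1 (by norm_num))
  have h2 : K * n ^ 3 * (c₀ * m) ≤ K * c₀ * m ^ 10 := by
    calc K * n ^ 3 * (c₀ * m) ≤ K * m ^ 3 * (c₀ * m) := by gcongr
      _ = K * c₀ * m ^ 4 := by ring
      _ ≤ _ := Nat.mul_le_mul_left _ (hp 4 (by norm_num))
  have h3 : n * n ≤ m ^ 10 := (Nat.mul_le_mul hnm hnm).trans (by
    rw [← sq]; exact hp 2 (by norm_num))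
  have h4 : numTrials n E ≤ 768 * m ^ 8 := by
    unfold numTrials
    calc 768 * n ^ 6 * E ^ 2 ≤ 768 * m ^ 6 * m ^ 2 := by gcongr
      _ = _ := by ring
  have h5 : numTrials n E * (n * n) ≤ 768 * m ^ 10 := by
    calc numTrials n E * (n * n) ≤ 768 * m ^ 8 * (m * m) :=
          Nat.mul_le_mul h4 (Nat.mul_le_mul hnm hnm)
      _ = _ := by ring
  have h6 := hp 8 (by norm_num)
  have h7 : m ≤ m ^ 10 := by simpa using hp 1 (by norm_num)
  have h8 : (c₀ + K * c₀ + 1540) * m ^ 10 = c₀ * m ^ 10 + K * c₀ * m ^ 10 + 1540 * m ^ 10 := by ring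
  unfold sizeBound
  rw [← hm, h8]
  omega

end Parameters

/-! ### The machine on its input -/

section Input

theorem digitOracle_le (p : unitInterval) (k : ℕ) : digitOracle p k ≤ 2 ^ k := by
  have h : (p : ℝ) * 2 ^ k ≤ ((2 ^ k : ℕ) : ℝ) := by
    push_cast
    exact mul_le_of_le_one_left (by positivity) p.2.2
  exact Nat.floor_le_of_le h

theorem abs_digitOracle_sub_le (p : unitInterval) (k : ℕ) :
    |(digitOracle p k / 2 ^ k : ℝ) - p| ≤ 1 / 2 ^ k := by
  have hk : (0 : ℝ) < 2 ^ k := by positivity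
  have h1 : (digitOracle p k : ℝ) ≤ p * 2 ^ k := Nat.floor_le (mul_nonneg p.2.1 hk.le)
  have h2 : (p : ℝ) * 2 ^ k < digitOracle p k + 1 := Nat.lt_floor_add_one _
  rw [show (digitOracle p k / 2 ^ k : ℝ) - p = (digitOracle p k - p * 2 ^ k) / 2 ^ k by field_simp,
    abs_div, abs_of_pos hk]
  refine div_le_div_of_nonneg_right (abs_le.2 ⟨?_, ?_⟩) hk.le <;> linarith

theorem isBounded_inputState {n b : ℕ} {ε : ℝ} (hn : n ≤ b) (hE : ⌈1 / ε⌉₊ ≤ b) (ω : ℕ → Bool) :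
    IsBounded b (inputState n ε ω).mem := fun a i => by
  have hb : b < 2 ^ b := Nat.lt_two_pow_self
  simp only [inputState]
  split_ifs <;> omega

theorem isBounded_input_sizeBound (c₀ K n : ℕ) (ε : ℝ) (ω : ℕ → Bool) :
    IsBounded (sizeBound c₀ K n ⌈1 / ε⌉₊) (inputState n ε ω).mem := by
  refine isBounded_inputState ?_ ?_ ω <;> unfold sizeBound <;> omega

/-- A time bound in terms of `n` and `⌈1/ε⌉` gives a polynomial in `n` and `1/ε`. -/
theorem Runs.exists_exec {p : unitInterval} {n B b : ℕ} {ε : ℝ} {ω : ℕ → Bool} {P : Prog}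
    {Φ : State → Prop} (hn : 1 ≤ n) (hε : 0 < ε) (hb : b + 1 ≤ B * (n + ⌈1 / ε⌉₊) ^ 10)
    (h : Runs (digitOracle p) b P (inputState n ε ω) Φ) :
    ∃ t s, Exec (digitOracle p) P (inputState n ε ω) t s ∧
      (t : ℝ) ≤ (P.weight * B ^ (P.depth + 1) * 2 ^ (10 * (P.depth + 1)) : ℕ)
        * ((n : ℝ) + 1 / ε) ^ (10 * (P.depth + 1)) ∧ Φ s := by
  obtain ⟨t, s, h1, h2, -, h3⟩ := h
  refine ⟨t, s, h1, ?_, h3⟩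
  have hn' : (1 : ℝ) ≤ n := by exact_mod_cast hn
  have hε' : 0 < 1 / ε := by positivity
  have h4 : ((n + ⌈1 / ε⌉₊ : ℕ) : ℝ) ≤ 2 * ((n : ℝ) + 1 / ε) := by
    have := Nat.ceil_lt_add_one hε'.le
    push_cast
    linarith
  have h5 : t ≤ P.weight * (B * (n + ⌈1 / ε⌉₊) ^ 10) ^ (P.depth + 1) :=
    h2.trans (Nat.mul_le_mul_left _ (Nat.pow_le_pow_left hb _))
  calc (t : ℝ) ≤ (P.weight * (B * (n + ⌈1 / ε⌉₊) ^ 10) ^ (P.depth + 1) : ℕ) := by exact_mod_cast h5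
    _ = P.weight * B ^ (P.depth + 1) * ((n + ⌈1 / ε⌉₊ : ℕ) : ℝ) ^ (10 * (P.depth + 1)) := by
        push_cast; rw [mul_pow, pow_mul]; ring
    _ ≤ P.weight * B ^ (P.depth + 1) * (2 * ((n : ℝ) + 1 / ε)) ^ (10 * (P.depth + 1)) := by gcongr
    _ = _ := by push_cast; rw [mul_pow]; ring

theorem outputs_iff {P : Prog} {n : ℕ} {p : unitInterval} {ε : ℝ} {ω : ℕ → Bool} {t : ℕ} {s : State}
    (h : Exec (digitOracle p) P (inputState n ε ω) t s) (R : State → Prop) :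
    Outputs P n p ε ω R ↔ R s := by
  constructor
  · rintro ⟨t', s', h', hR⟩
    rwa [(h.deterministic h').2]
  · exact fun hR => ⟨t, s, h, hR⟩

theorem one_le_ceil_inv {ε : ℝ} (hε : 0 < ε) : 1 ≤ ⌈1 / ε⌉₊ :=
  Nat.one_le_ceil_iff.2 (by positivity)

theorem one_div_ceil_inv_le {ε : ℝ} (hε : 0 < ε) : 1 / (⌈1 / ε⌉₊ : ℝ) ≤ ε := by
  have h1 : (1 : ℝ) ≤ ⌈1 / ε⌉₊ := by exact_mod_cast one_le_ceil_inv hε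
  rw [div_le_comm₀ (by linarith) hε]
  exact Nat.le_ceil _

theorem samplerError_lt {K n k : ℕ} {ε : ℝ} (hn : 1 ≤ n) (hε : 0 < ε)
    (h : samplerError K n k + 1 / 2 ^ k ≤ 1 / (16 * (n : ℝ) ^ 2 * ⌈1 / ε⌉₊)) :
    samplerError K n k / 2 < ε := by
  have hn' : (1 : ℝ) ≤ n := by exact_mod_cast hn
  have hE' : (1 : ℝ) ≤ ⌈1 / ε⌉₊ := by exact_mod_cast one_le_ceil_inv hε
  have h1 : (1 : ℝ) / (16 * (n : ℝ) ^ 2 * ⌈1 / ε⌉₊) ≤ 1 / ⌈1 / ε⌉₊ := by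
    refine one_div_le_one_div_of_le (by linarith) ?_
    have : (1 : ℝ) ≤ 16 * (n : ℝ) ^ 2 := by nlinarith
    nlinarith
  have h2 := one_div_ceil_inv_le hε
  have h3 : (0 : ℝ) < 1 / 2 ^ k := by positivity
  linarith

theorem le_three_quarters {c p : ℝ} {n : ℕ} (hc : c < 1 / Real.sqrt 2) (hn : 1 ≤ n) (h0 : 0 ≤ p)
    (hp : p ≤ c / Real.sqrt n) : p ≤ 3 / 4 := by
  have hs : 1 ≤ Real.sqrt n := Real.one_le_sqrt.2 (by exact_mod_cast hn)
  have hc0 : 0 ≤ c := by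
    by_contra h
    have := div_neg_of_neg_of_pos (not_le.1 h) (by linarith : 0 < Real.sqrt n)
    linarith
  have h1 : c / Real.sqrt n ≤ c := div_le_self hc0 hs
  have h2 : (4 / 3 : ℝ) ≤ Real.sqrt 2 := Real.le_sqrt_of_sq_le (by norm_num)
  have h3 : 1 / Real.sqrt 2 ≤ 1 / (4 / 3 : ℝ) := one_div_le_one_div_of_le (by norm_num) h2
  linarith

end Input

/-! ### Approximate counting -/

/-- The fractions of successes are estimated with precision `η = 1 / (16 n² E)`, where `E = ⌈1/ε⌉`,
so that the `n²` relative errors, each at most `16 η`, add up to at most `ε`. -/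
theorem exists_counting {c : ℝ} (hc : c < 1 / Real.sqrt 2) :
    ∃ (P : Prog) (C k : ℕ), ∀ n : ℕ, 1 ≤ n → ∀ p : unitInterval, (p : ℝ) ≤ c / Real.sqrt n →
      ∀ ε : ℝ, 0 < ε →
        (∀ ω : ℕ → Bool,
          HaltsWith P n p ε ω ((C : ℝ) * ((n : ℝ) + 1 / ε) ^ k) fun _ => True) ∧
        2 / 3 ≤ coinLaw.real
          {ω | Outputs P n p ε ω fun s => IsRelApprox ε s.outNumber (probTriangleFree n p)} := by
  classical
  obtain ⟨K, hK⟩ := exists_coalescence_pairsBelow hc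
  obtain ⟨c₀, hc₀⟩ := exists_samplerError_le K
  set B := c₀ + K * c₀ + 1540
  set d := (countMain c₀ K).depth + 1
  refine ⟨countMain c₀ K, (countMain c₀ K).weight * B ^ d * 2 ^ (10 * d), 10 * d,
    fun n hn p hp ε hε => ?_⟩
  have : NeZero n := ⟨by omega⟩
  set E := ⌈1 / ε⌉₊ with hE
  have hE1 : 1 ≤ E := one_le_ceil_inv hε
  have hn' : (1 : ℝ) ≤ n := by exact_mod_cast hn
  have hE' : (1 : ℝ) ≤ E := by exact_mod_cast hE1
  have hS1 : 1 ≤ numTrials n E := by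
    unfold numTrials; exact Nat.mul_pos (by positivity) (by positivity)
  have hrun : ∀ ω, _ := fun ω => (runs_countMain (n := n) (b := sizeBound c₀ K n E) (c₀ := c₀)
    (K := K) (E := E) (S := numTrials n E) (s := inputState n ε ω) (digitOracle_le p) rfl
    (by unfold sizeBound; omega) (by unfold sizeBound; omega) (by unfold sizeBound; omega)
    (by unfold sizeBound; omega) hS1 (numTrials_pow_lt c₀ K n E)
    (isBounded_input_sizeBound c₀ K n ε ω) rfl rfl).exists_exec hn hε (sizeBound_succ_le c₀ K hn)
  refine ⟨fun ω => ?_, ?_⟩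
  · obtain ⟨t, s, h1, h2, -⟩ := hrun ω
    exact ⟨t, s, h1, h2, trivial⟩
  · have hpr : probTriangleFree n p = partialProb n p (n * n) := by
      rw [probTriangleFree_eq, partialProb, pairsBelow_mul_self]
    rw [coinLaw_real_eq (fun ω => by
      obtain ⟨t, s, h1, -, h3⟩ := hrun ω
      rw [Set.mem_ofPred_eq, outputs_iff h1, h3, hpr]
      exact Iff.rfl)
      ((dependsOnFirst_countProd (n := n) _ _ _ _ _).comp fun y => IsRelApprox ε
        ((y : ℝ) / (numTrials n E ^ (n * n) : ℕ)) (partialProb n p (n * n)))]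
    have hη : (0 : ℝ) < 1 / (16 * (n : ℝ) ^ 2 * E) := by positivity
    refine two_thirds_le_coinE (K := K) p.2.1 (le_three_quarters hc hn p.2.1 hp)
      (digitOracle_le p _) (abs_digitOracle_sub_le p _) (fun i => hK n p p.2.1 p.2.2 hp i _) hη
      ?_ ?_ (hc₀ n E hn hE1) ?_
    · refine one_div_le_one_div_of_le (by norm_num) ?_
      have : 1 ≤ (n : ℝ) ^ 2 * E := one_le_mul_of_one_le_of_one_le (one_le_pow₀ hn') hE'
      linarith
    · refine le_of_eq_of_le ?_ (one_div_ceil_inv_le hε)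
      rw [← hE]
      push_cast
      field_simp
    · refine le_of_eq ?_
      unfold numTrials
      push_cast
      field_simp
      norm_num

/-! ### Approximate sampling -/

section Sampling

variable {n : ℕ} [NeZero n]

theorem outGraph_eq_of_holds {X : Finset (Sym2 (Fin n))} {s : State} (h : Holds n X s.mem) :
    s.outGraph n = SimpleGraph.fromEdgeSet (X : Set (Sym2 (Fin n))) := by
  have key : ∀ u v : Fin n, u < v → (s.mem 1 (u * n + v) ≠ 0 ↔ s(u, v) ∈ X) := by
    intro u v huv
    rw [h _ (code_lt u.2 v.2), pairOf_code, code_div v.2, code_mod v.2]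
    simp [huv]
  ext u v
  simp only [State.outGraph, SimpleGraph.fromRel_adj, SimpleGraph.fromEdgeSet_adj, Finset.mem_coe]
  rcases lt_trichotomy u v with huv | huv | huv
  · simp [huv, key u v huv, huv.not_gt, -ne_eq, and_comm]
  · simp [huv]
  · simp [key v u huv, huv.not_gt, huv, Sym2.eq_swap (a := u), -ne_eq, and_comm]

theorem iter_stepFn_subset (k q t : ℕ) {X : Finset (Sym2 (Fin n))} (hX : X ⊆ allPairs n)
    (hI : IsIndep IsTriangle X) (ω : ℕ → Bool) :
    iter (2 * k) (stepFn n k q (n * n)) t X ω ⊆ allPairs n ∧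
      IsIndep IsTriangle (iter (2 * k) (stepFn n k q (n * n)) t X ω) := by
  induction t generalizing X ω with
  | zero => exact ⟨hX, hI⟩
  | succ t ih =>
    simp only [iter]
    unfold stepFn
    simp only
    split_ifs with h
    · refine ih (upd_subset ?_ _ hX) (hI.upd isTripleSystem_isTriangle) _
      rw [← pairsBelow_mul_self]
      exact Finset.mem_image_of_mem _ (Finset.mem_filter.2 ⟨Finset.mem_range.2 h.2, h.1⟩)
    · exact ih hX hI _

end Sampling

theorem exists_sampling {c : ℝ} (hc : c < 1 / Real.sqrt 2) :
    ∃ (P : Prog) (C k : ℕ), ∀ n : ℕ, 1 ≤ n → ∀ p : unitInterval, (p : ℝ) ≤ c / Real.sqrt n →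
      ∀ ε : ℝ, 0 < ε →
        (∀ ω : ℕ → Bool,
          HaltsWith P n p ε ω ((C : ℝ) * ((n : ℝ) + 1 / ε) ^ k)
            fun s => s.outGraph n ∈ triangleFree n) ∧
        tvDist (outGraphLaw P n p ε) (condTriangleFree n p) < ε := by
  classical
  obtain ⟨K, hK⟩ := exists_coalescence_pairsBelow hc
  obtain ⟨c₀, hc₀⟩ := exists_samplerError_le K
  set B := c₀ + K * c₀ + 1540
  set d := (sampleMain c₀ K).depth + 1
  refine ⟨sampleMain c₀ K, (sampleMain c₀ K).weight * B ^ d * 2 ^ (10 * d), 10 * d,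
    fun n hn p hp ε hε => ?_⟩
  have : NeZero n := ⟨by omega⟩
  set E := ⌈1 / ε⌉₊
  have hE1 : 1 ≤ E := one_le_ceil_inv hε
  set k := c₀ * (n + E)
  set q := digitOracle p k
  set X : (ℕ → Bool) → Finset (Sym2 (Fin n)) :=
    iter (2 * k) (stepFn n k q (n * n)) (K * n ^ 3 * k) ∅
  have dX : DependsOnFirst (2 * k * (K * n ^ 3 * k)) X := dependsOnFirst_sampler _ _ _ _
  have hXs : ∀ ω, X ω ⊆ allPairs n ∧ IsIndep IsTriangle (X ω) :=
    iter_stepFn_subset k q _ (Finset.empty_subset _) fun e he => by simp at he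
  set F : (ℕ → Bool) → triangleFree n := fun ω =>
    ⟨SimpleGraph.fromEdgeSet (X ω : Set (Sym2 (Fin n))), cliqueFree_iff_isIndep.2 (by
      rw [edges_fromEdgeSet (hXs ω).1]; exact (hXs ω).2)⟩
  have hrun : ∀ ω, _ := fun ω => ((runs_sampleMain (n := n) (b := sizeBound c₀ K n E) (c₀ := c₀)
    (K := K) (E := E) (s := inputState n ε ω) (digitOracle_le p)
    (by unfold sizeBound; omega) (by unfold sizeBound; omega) (by unfold sizeBound; omega)
    (isBounded_input_sizeBound c₀ K n ε ω) rfl rfl).mono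
      (Ψ := fun s => s.outGraph n = (F ω).1) fun s _ hs =>
        outGraph_eq_of_holds hs).exists_exec hn hε (sizeBound_succ_le c₀ K hn)
  refine ⟨fun ω => ?_, ?_⟩
  · obtain ⟨t, s, h1, h2, h3⟩ := hrun ω
    exact ⟨t, s, h1, h2, by simpa only [h3] using (F ω).2⟩
  have hlaw : ∀ G, outGraphLaw (sampleMain c₀ K) n p ε G
      = coinE fun ω => if X ω = edges G.1 then 1 else 0 := fun G =>
    coinLaw_real_eq (fun ω => by
      obtain ⟨t, s, h1, -, h3⟩ := hrun ω
      rw [Set.mem_ofPred_eq, outputs_iff h1, h3, ← edges_injective.eq_iff,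
        edges_fromEdgeSet (hXs ω).1]) (dX.comp fun Y => Y = edges G.1)
  have hsum : ∀ f : triangleFree n → ℝ, ∑ G, outGraphLaw (sampleMain c₀ K) n p ε G * f G
      = coinE fun ω => extendGraphs f (X ω) := by
    intro f
    have h1 : ∀ G, outGraphLaw (sampleMain c₀ K) n p ε G * f G
        = coinE fun ω => f G * if X ω = edges G.1 then 1 else 0 := fun G => by
      rw [hlaw, coinE_mul, mul_comm]
    rw [Finset.sum_congr rfl fun G _ => h1 G, ← coinE_sum _ fun G =>
      dX.comp fun Y => f G * if Y = edges G.1 then 1 else 0]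
    congr 1
    funext ω
    have hXF : X ω = edges (F ω).1 := (edges_fromEdgeSet (hXs ω).1).symm
    rw [hXF, extendGraphs_edges, Finset.sum_eq_single (F ω)]
    · simp
    · intro G _ hG
      rw [if_neg fun h => hG (Subtype.ext (edges_injective h)).symm, mul_zero]
    · simp
  have hlt : (p : ℝ) < 1 := (le_three_quarters hc hn p.2.1 hp).trans_lt (by norm_num)
  have htv : tvDist (outGraphLaw (sampleMain c₀ K) n p ε) (condTriangleFree n p)
      ≤ samplerError K n k / 2 := by
    refine tvDist_le fun f hf => ?_
    rw [hsum, sum_condTriangleFree_mul]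
    have h1 := abs_coinE_sampler_sub_le (n := n) p.2.1 hlt (digitOracle_le p k)
      (abs_digitOracle_sub_le p k) (n * n) (hK n p p.2.1 p.2.2 hp _ k) (abs_extendGraphs_le hf)
    rw [pairsBelow_mul_self, div_eq_inv_mul] at h1
    exact (le_abs_self _).trans (h1.trans_eq (by ring))
  exact htv.trans_lt (samplerError_lt hn hε (hc₀ n E hn hE1))

theorem mainTheorem2 (c : ℝ) (hc : c < 1 / Real.sqrt 2) :
    (∃ K : ℝ, ∀ n : ℕ, 2 ≤ n → ∀ p : unitInterval, (p : ℝ) ≤ c / Real.sqrt n →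
      mixingTime (glauber n p) (condTriangleFree n p)
        ≤ ((⌊K * (n : ℝ) ^ 2 * Real.log n⌋₊ : ℕ) : ℕ∞)) ∧
    (∃ (P : Prog) (C k : ℕ), ∀ n : ℕ, 1 ≤ n → ∀ p : unitInterval, (p : ℝ) ≤ c / Real.sqrt n →
      ∀ ε : ℝ, 0 < ε →
        (∀ ω : ℕ → Bool,
          HaltsWith P n p ε ω ((C : ℝ) * ((n : ℝ) + 1 / ε) ^ k) fun _ => True) ∧
        2 / 3 ≤ coinLaw.real
          {ω | Outputs P n p ε ω fun s => IsRelApprox ε s.outNumber (probTriangleFree n p)}) ∧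
    (∃ (P : Prog) (C k : ℕ), ∀ n : ℕ, 1 ≤ n → ∀ p : unitInterval, (p : ℝ) ≤ c / Real.sqrt n →
      ∀ ε : ℝ, 0 < ε →
        (∀ ω : ℕ → Bool,
          HaltsWith P n p ε ω ((C : ℝ) * ((n : ℝ) + 1 / ε) ^ k)
            fun s => s.outGraph n ∈ triangleFree n) ∧
        tvDist (outGraphLaw P n p ε) (condTriangleFree n p) < ε) :=
  ⟨glauber_mixingTime hc, exists_counting hc, exists_sampling hc⟩
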